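/- In the metric Steiner tree problem, the input is a metric $w$ on a set $V$ of $n$ vertices (symmetric, zero on the diagonal, positive off the diagonal, satisfying the triangle inequality) and a set $T\subseteq V$ of $k\ge 1$ terminals. A Steiner tree is a tree on a subset of $V$ (a subgraph of the complete graph on $V$) that contains all vertices of $T$; its cost is the sum of $w(u,v)$ over its edges $uv$. For $\alpha\ge 1$, a Steiner tree is $\alpha$-approximate if its cost is at most $\alpha$ times the minimum cost of a Steiner tree. The sets $V$ and $T$ are known to an algorithm; the metric is accessible only through adaptive queries, a query $(u,v)$ being answered by $w(u,v)$. **Theorem 1.5.** 1. (Upper bound.) For every $d\in\mathbb N$ there are a randomized algorithm and a constant $C$ (both depending only on $d$) such that, for every real $\alpha\ge 2$ (which is part of the input) and every instance $(V,T,w)$ with $n$ vertices and $k\ge 1$ terminals, the algorithm always performs at most $$C\cdot\frac{k^2}{\alpha}\cdot(1+\ln n)^{C}=\tilde O(k^2/\alpha)$$ queries and at most $C\,n^{C}$ steps, and with probability at least $1-n^{-d}$ it outputs an $\alpha$-approximate Steiner tree. Here an algorithm is a single program for a randomized random access machine with integer and real memory cells, whose unit-cost operations are addition, subtraction and comparison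 of integers and of reals, indirect addressing, the choice of a uniformly random integer from $\{0,\dots,m\}$, and weight queries. 2. (Lower bound.) There are absolute constants $c,C>0$ such that the following holds for every real $\alpha\ge 2$, every $n$, and every $T\subseteq V$ with $|V|=n$ and $k=|T|\ge C\alpha$. Let $A$ be any randomized query algorithm (an arbitrary random deterministic adaptive query strategy with unlimited computational power, which may depend on $V$, $T$ and $\alpha$) that, on every metric $w$ on $V$, outputs an $\alpha$-approximate Steiner tree for $(V,T,w)$ with probability at least $2/3$. Then there is a metric $w$ on $V$ on which the expected number of queries of $A$ is at least $c\,k^2/\alpha$. In particular, $A$ performs $\Omega(k^2/\alpha)$ queries in the worst case. -/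

import Mathlib

namespace SteinerQuery

/-! ### Metrics and Steiner trees on the vertex set `Fin n` -/

/-- `w` is a metric on the `n` vertices. -/
structure IsMetric {n : ℕ} (w : Fin n → Fin n → ℝ) : Prop where
  self : ∀ u, w u u = 0
  pos : ∀ u v, u ≠ v → 0 < w u v
  symm : ∀ u v, w u v = w v u
  triangle : ∀ u v x, w u x ≤ w u v + w v x

/-- Subgraphs of the complete graph on the `n` vertices. -/
abbrev Graph (n : ℕ) : Type := (⊤ : SimpleGraph (Fin n)).Subgraph

open Classical in
/-- The cost of a subgraph: the sum of the weights of its edges, each edge `{u, v}` being counted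
once (for `u < v`). -/
noncomputable def cost {n : ℕ} (w : Fin n → Fin n → ℝ) (H : Graph n) : ℝ :=
  ∑ u, ∑ v, if u < v ∧ H.Adj u v then w u v else 0

/-- A Steiner tree for the terminal set `T`: a tree that contains all terminals (and possibly
further vertices). -/
def IsSteinerTree {n : ℕ} (T : Finset (Fin n)) (H : Graph n) : Prop :=
  (∀ v ∈ T, v ∈ H.verts) ∧ H.coe.IsTree

/-- An `α`-approximate Steiner tree: its cost is at most `α` times the minimum cost of a Steiner
tree, that is, at most `α` times the cost of every Steiner tree. -/
def IsApproxSteinerTree {n : ℕ} (α : ℝ) (w : Fin n → Fin n → ℝ) (T : Finset (Fin n))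
    (H : Graph n) : Prop :=
  IsSteinerTree T H ∧ ∀ H' : Graph n, IsSteinerTree T H' → cost w H ≤ α * cost w H'

/-! ### Arbitrary (non-uniform, computationally unbounded) query algorithms -/

/-- A deterministic adaptive query algorithm with outputs in `β`: it either stops with an output or
asks for the weight of a pair of vertices and continues depending on the answer. -/
inductive QueryTree (n : ℕ) (β : Type) : Type where
  | done (b : β) : QueryTree n β
  | ask (u v : Fin n) (next : ℝ → QueryTree n β) : QueryTree n β

/-- The output of the algorithm on the weights `w`. -/
def QueryTree.output {n : ℕ} {β : Type} (w : Fin n → Fin n → ℝ) : QueryTree n β → β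
  | .done b => b
  | .ask u v next => (next (w u v)).output w

/-- The number of queries that the algorithm performs on the weights `w`. -/
def QueryTree.queries {n : ℕ} {β : Type} (w : Fin n → Fin n → ℝ) : QueryTree n β → ℕ
  | .done _ => 0
  | .ask u v next => (next (w u v)).queries w + 1

/-- A randomized query algorithm that outputs a graph: a deterministic algorithm that depends on a
random seed `ω : Ω`, such that, on every input, the output and the number of queries are random
variables. -/
structure RandAlg (n : ℕ) (Ω : Type*) [MeasurableSpace Ω] where
  alg : Ω → QueryTree n (Graph n)
  measurable_output : ∀ (w : Fin n → Fin n → ℝ) (H : Graph n),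
    MeasurableSet {ω | (alg ω).output w = H}
  measurable_queries : ∀ w : Fin n → Fin n → ℝ, Measurable fun ω => (alg ω).queries w

/-! ### Uniform algorithms with a step count

A randomized random access machine with integer arrays and real arrays, programmed in a structured
language. All operations have unit cost; integer and real arithmetic is restricted to addition and
subtraction, so that no hidden computation can be performed by multiplying long numbers. All loops
have a bound that is computed before the loop is entered, so every program terminates. -/

/-- The memory (`nat a i` is cell `i` of the integer array `a`, and `real a i` is cell `i` of the
real array `a`), the number of steps performed and the number of queries performed so far. -/
structure State where
  nat : ℕ → ℕ → ℕ
  real : ℕ → ℕ → ℝ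
  steps : ℕ
  queries : ℕ

/-- Integer expressions; `sub` is truncated subtraction. -/
inductive NExp where
  | lit (c : ℕ)
  | get (a : ℕ) (i : NExp)
  | add (x y : NExp)
  | sub (x y : NExp)

/-- Real expressions. -/
inductive RExp where
  | lit (c : ℕ)
  | get (a : ℕ) (i : NExp)
  | add (x y : RExp)
  | sub (x y : RExp)

/-- Tests. -/
inductive BExp where
  | natLt (x y : NExp)
  | realLt (x y : RExp)
  | not (b : BExp)
  | and (b c : BExp)

/-- Programs. -/
inductive Prog where
  | skip
  /-- integer cell `i` of array `a` becomes `x` -/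
  | setNat (a : ℕ) (i x : NExp)
  /-- real cell `i` of array `a` becomes `x` -/
  | setReal (a : ℕ) (i : NExp) (x : RExp)
  /-- integer cell `i` of array `a` becomes a uniformly random element of `{0, …, x}` -/
  | rand (a : ℕ) (i x : NExp)
  /-- real cell `i` of array `a` becomes the weight of the pair `u, v`, obtained by a query -/
  | query (a : ℕ) (i u v : NExp)
  | seq (p q : Prog)
  | ite (b : BExp) (p q : Prog)
  /-- evaluate `x` and then run `p` that many times -/
  | loop (x : NExp) (p : Prog)

def NExp.eval (σ : State) : NExp → ℕ
  | .lit c => c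
  | .get a i => σ.nat a (i.eval σ)
  | .add x y => x.eval σ + y.eval σ
  | .sub x y => x.eval σ - y.eval σ

def RExp.eval (σ : State) : RExp → ℝ
  | .lit c => (c : ℝ)
  | .get a i => σ.real a (i.eval σ)
  | .add x y => x.eval σ + y.eval σ
  | .sub x y => x.eval σ - y.eval σ

def BExp.eval (σ : State) : BExp → Prop
  | .natLt x y => x.eval σ < y.eval σ
  | .realLt x y => x.eval σ < y.eval σ
  | .not b => ¬ b.eval σ
  | .and b c => b.eval σ ∧ c.eval σ

/-- Count one step. -/
def State.tick (σ : State) : State := { σ with steps := σ.steps + 1 }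

/-- Count one query. -/
def State.tickQuery (σ : State) : State := { σ with queries := σ.queries + 1 }

def State.writeNat (a i x : ℕ) (σ : State) : State :=
  { σ with nat := fun b j => if b = a ∧ j = i then x else σ.nat b j }

def State.writeReal (a i : ℕ) (x : ℝ) (σ : State) : State :=
  { σ with real := fun b j => if b = a ∧ j = i then x else σ.real b j }

/-- Run the random state transformation `f` successively `m` times, counting one additional step
per round. -/
noncomputable def iterate (f : State → PMF State) : ℕ → State → PMF State
  | 0, σ => PMF.pure σ
  | m + 1, σ => (f σ.tick).bind (iterate f m)

open Classical in
/-- The distribution of the state after a run of the program, where `oracle u v` is the answer to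
the query `u, v`. Every executed instruction, every branching and every round of a loop costs one
step. -/
noncomputable def Prog.run (oracle : ℕ → ℕ → ℝ) : Prog → State → PMF State
  | .skip => fun σ => PMF.pure σ.tick
  | .setNat a i x => fun σ => PMF.pure (σ.writeNat a (i.eval σ) (x.eval σ)).tick
  | .setReal a i x => fun σ => PMF.pure (σ.writeReal a (i.eval σ) (x.eval σ)).tick
  | .rand a i x => fun σ =>
      (PMF.uniformOfFintype (Fin (x.eval σ + 1))).map fun r =>
        (σ.writeNat a (i.eval σ) r).tick
  | .query a i u v => fun σ =>
      PMF.pure (σ.writeReal a (i.eval σ) (oracle (u.eval σ) (v.eval σ))).tickQuery.tick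
  | .seq p q => fun σ => (p.run oracle σ).bind (q.run oracle)
  | .ite b p q => fun σ =>
      if b.eval σ then p.run oracle σ.tick else q.run oracle σ.tick
  | .loop x p => fun σ => iterate (p.run oracle) (x.eval σ) σ.tick

/-- The query oracle for `w`; vertices are named by the numbers `0, …, n - 1`, and queries outside
this range are answered by `0`. -/
noncomputable def oracle {n : ℕ} (w : Fin n → Fin n → ℝ) (u v : ℕ) : ℝ :=
  if h : u < n ∧ v < n then w ⟨u, h.1⟩ ⟨v, h.2⟩ else 0

/-- The input: `n` in cell `0` of integer array `0`, `k` in cell `0` of integer array `1`, the list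
of the `k` terminals in the first `k` cells of integer array `2`, and `α` in cell `0` of real
array `0`. Every other cell is `0`. -/
noncomputable def initial {n k : ℕ} (t : Fin k → Fin n) (α : ℝ) : State where
  nat a i :=
    if a = 0 ∧ i = 0 then n
    else if a = 1 ∧ i = 0 then k
    else if h : a = 2 ∧ i < k then (t ⟨i, h.2⟩ : ℕ)
    else 0
  real a i := if a = 0 ∧ i = 0 then α else 0
  steps := 0
  queries := 0

/-- The distribution of the final state on the instance with weights `w`, list of terminals `t` and
approximation factor `α`. -/
noncomputable def Prog.exec {n k : ℕ} (p : Prog) (w : Fin n → Fin n → ℝ) (t : Fin k → Fin n)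
    (α : ℝ) : PMF State :=
  p.run (oracle w) (initial t α)

/-- The graph that is output in a state: with `m` the content of cell `0` of integer array `3`, its
edges are the `m` pairs formed by the `j`-th cells of the integer arrays `4` and `5`, `j < m`, and
its vertices are the terminals and the endpoints of these pairs. -/
def State.graph {n : ℕ} (T : Finset (Fin n)) (σ : State) : Graph n where
  verts := {v | v ∈ T ∨ ∃ j < σ.nat 3 0, σ.nat 4 j = v ∨ σ.nat 5 j = v}
  Adj u v := u ≠ v ∧ ∃ j < σ.nat 3 0,
    (σ.nat 4 j = u ∧ σ.nat 5 j = v) ∨ (σ.nat 4 j = v ∧ σ.nat 5 j = u)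
  adj_sub h := h.1
  edge_vert := by
    rintro u v ⟨-, j, hj, h | h⟩
    · exact Or.inr ⟨j, hj, Or.inl h.1⟩
    · exact Or.inr ⟨j, hj, Or.inr h.2⟩
  symm := by
    constructor
    rintro u v ⟨hne, j, hj, h⟩
    exact ⟨hne.symm, j, hj, h.symm⟩

end SteinerQuery

namespace SteinerQuery

/-! ### Graphs given by indexed edges -/

/-! Upper bound. A Steiner tree, walked around and shortcut, yields a path through all terminals of
length at most twice its cost (`exists_short_path`). The program draws about (k/α)·log n terminals
at random, with repetition, and queries their distances to all k terminals. With high probability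
every window of L + 1 ≈ α/12 consecutive positions of the path contains a sample (`miss_window_le`,
`miss_bound`). Joining each terminal to a sample within L positions, and joining the samples chosen
for consecutive positions, gives a connected graph that costs at most 6L + 1 times the path, hence
at most 12L + 2 ≤ α times any Steiner tree (`sum_comparison_le`). Every edge of this graph has an
end at a sample, so its weight is in the table.

Prim's algorithm is run on the terminals with the length of the cheapest detour via a sample as edge
length. This length is at least the true distance, and equals it if one end is a sample. So the tree
costs at most its total detour length, which the exchange argument (`prim_cost_le`) bounds by the
comparison graph. If α > 2k no query is needed: any spanning tree on the terminals has fewer than k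
edges, each at most twice the optimum. The rest verifies the program: `Prog.wp` asserts a property
of all reachable states, `wp_steps` counts steps, and probability enters only through the sampling
loop.

Lower bound. Colour the vertices at random with q ≈ k/(8α) colours; terminals of equal colour are at
distance 1/k, all other pairs at distance 1. The optimum is at most q, so an α-approximate tree
costs at most k/8 and has at least k/2 monochromatic edges along a rooting. Let the algorithm also
query these edges of its output, at most k more queries. It has then merged at least k/2 pairs of
classes in the partition of vertices known to have equal colour. A query between two classes merges
them with probability about 1/q, so the moment of 16 to the number of merges grows by at most 1 +
16/q per query (`sum_classes_le`). After t + k queries with t ≤ kq/32, this moment is at most e^k,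
and success needs 16^(k/2): at most about a fraction (e/4)^k of the colourings can succeed
(`card_success_le`). Averaging over the seed and Markov's inequality for the number of queries give
`lower_bound`. -/

theorem mem_edgeSet_of_indexed {n : ℕ} {ι : Type*} {H : Graph n} {s : Finset ι}
    {a b : ι → Fin n}
    (hadj : ∀ u v, H.Adj u v → ∃ j ∈ s, (a j = u ∧ b j = v) ∨ (a j = v ∧ b j = u)) :
    H.edgeSet ⊆ (s.image fun j => s(a j, b j) : Finset (Sym2 (Fin n))) := by
  intro e
  induction e using Sym2.ind with
  | h u v =>
    intro h
    obtain ⟨j, hj, h | h⟩ := hadj u v h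
    · simp only [Finset.coe_image, Set.mem_image]
      exact ⟨j, hj, by rw [h.1, h.2]⟩
    · simp only [Finset.coe_image, Set.mem_image]
      exact ⟨j, hj, by rw [h.1, h.2, Sym2.eq_swap]⟩

/-- A connected graph has at least as many edges as vertices minus one; listing its edges by too few
indices, possibly with repetition, forces equality. -/
theorem isTree_of_indexed {n : ℕ} {ι : Type*} {H : Graph n} {s : Finset ι}
    {a b : ι → Fin n} {T : Finset (Fin n)} (hv : H.verts = T) (hs : s.card + 1 ≤ T.card)
    (hadj : ∀ u v, H.Adj u v → ∃ j ∈ s, (a j = u ∧ b j = v) ∨ (a j = v ∧ b j = u))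
    (hconn : H.coe.Connected) : H.coe.IsTree := by
  classical
  rw [SimpleGraph.isTree_iff_connected_and_card]
  refine ⟨hconn, le_antisymm ?_ hconn.card_vert_le_card_edgeSet_add_one⟩
  have h1 : Nat.card H.coe.edgeSet ≤ s.card := by
    have h2 : Nat.card H.coe.edgeSet ≤ Nat.card H.edgeSet := by
      refine Nat.card_le_card_of_injective
        (fun e => ⟨Sym2.map (fun x : H.verts => (x : Fin n)) e.1, ?_⟩) ?_
      · rcases e with ⟨e, he⟩
        induction e using Sym2.ind with
        | h u v => exact he
      · intro e e' h
        apply Subtype.ext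
        exact Sym2.map.injective Subtype.val_injective (congrArg Subtype.val h)
    refine h2.trans ?_
    rw [Nat.card_coe_set_eq]
    refine (Set.ncard_le_ncard (mem_edgeSet_of_indexed hadj) (Finset.finite_toSet _)).trans ?_
    rw [Set.ncard_coe_finset]
    exact Finset.card_image_le
  have h2 : Nat.card H.verts = T.card := by
    rw [hv]; simp
  omega

/-- Passing repeatedly to a neighbour of smaller `ht` can only end at `r`. -/
theorem connected_of_height {n : ℕ} {H : Graph n} {r : Fin n} (hr : r ∈ H.verts)
    (ht : Fin n → ℕ)
    (hpar : ∀ v ∈ H.verts, v ≠ r → ∃ u, H.Adj v u ∧ ht u < ht v) : H.coe.Connected := by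
  have key : ∀ m, ∀ v (hv : v ∈ H.verts), ht v = m → H.coe.Reachable ⟨v, hv⟩ ⟨r, hr⟩ := by
    intro m
    induction m using Nat.strong_induction_on with
    | _ m ih =>
      intro v hv hm
      by_cases hvr : v = r
      · subst hvr; exact SimpleGraph.Reachable.refl _
      · obtain ⟨u, hu, hlt⟩ := hpar v hv hvr
        have hu' : u ∈ H.verts := H.edge_vert hu.symm
        have h1 : H.coe.Adj ⟨v, hv⟩ ⟨u, hu'⟩ := hu
        exact h1.reachable.trans (ih (ht u) (hm ▸ hlt) u hu' rfl)
  have : Nonempty H.verts := ⟨⟨r, hr⟩⟩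
  refine ⟨fun x y => (key _ x.1 x.2 rfl).trans (key _ y.1 y.2 rfl).symm⟩

theorem IsMetric.nonneg {n : ℕ} {w : Fin n → Fin n → ℝ} (hw : IsMetric w) (u v : Fin n) :
    0 ≤ w u v := by
  by_cases h : u = v
  · rw [h, hw.self]
  · exact (hw.pos u v h).le

/-- Listed pairs that repeat, or that are not edges, only increase the right-hand side, because
weights are nonnegative. -/
theorem cost_le_of_indexed {n : ℕ} {ι : Type*} {w : Fin n → Fin n → ℝ} (hw : IsMetric w)
    {H : Graph n} {s : Finset ι} {a b : ι → Fin n}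
    (hadj : ∀ u v, H.Adj u v → ∃ j ∈ s, (a j = u ∧ b j = v) ∨ (a j = v ∧ b j = u)) :
    cost w H ≤ ∑ j ∈ s, w (a j) (b j) := by
  classical
  have h1 : ∀ u v, (if u < v ∧ H.Adj u v then w u v else 0) ≤
      ∑ j ∈ s, if min (a j) (b j) = u ∧ max (a j) (b j) = v then w (a j) (b j) else 0 := by
    intro u v
    split_ifs with h
    · obtain ⟨j, hj, hj'⟩ := hadj u v h.2
      refine le_trans ?_ (Finset.single_le_sum (f := fun j =>
        if min (a j) (b j) = u ∧ max (a j) (b j) = v then w (a j) (b j) else 0) ?_ hj)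
      · rcases hj' with h' | h'
        · simp only [h'.1, h'.2, min_eq_left h.1.le, max_eq_right h.1.le, and_self, if_true]
          exact le_rfl
        · simp only [h'.1, h'.2, min_eq_right h.1.le, max_eq_left h.1.le, and_self, if_true]
          exact (hw.symm _ _).le
      · intro j _
        split_ifs
        · exact hw.nonneg _ _
        · exact le_rfl
    · refine Finset.sum_nonneg fun j _ => ?_
      split_ifs
      · exact hw.nonneg _ _
      · exact le_rfl
  calc cost w H ≤ ∑ u, ∑ v, ∑ j ∈ s,
      (if min (a j) (b j) = u ∧ max (a j) (b j) = v then w (a j) (b j) else 0) := by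
        unfold cost
        refine Finset.sum_le_sum fun u _ => Finset.sum_le_sum fun v _ => ?_
        convert h1 u v
    _ = ∑ j ∈ s, ∑ u, ∑ v,
      (if min (a j) (b j) = u ∧ max (a j) (b j) = v then w (a j) (b j) else 0) := by
        simp_rw [Finset.sum_comm (s := Finset.univ) (t := s)]
    _ = ∑ j ∈ s, w (a j) (b j) := by
        refine Finset.sum_congr rfl fun j _ => ?_
        simp [ite_and]

theorem sum_le_cost {n : ℕ} {w : Fin n → Fin n → ℝ} (hw : IsMetric w) {H : Graph n}
    (s : Finset (Sym2 (Fin n))) (hs : ∀ e ∈ s, e ∈ H.edgeSet) :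
    ∑ e ∈ s, Sym2.lift ⟨w, hw.symm⟩ e ≤ cost w H := by
  classical
  have hc : cost w H = ∑ p ∈ (Finset.univ : Finset (Fin n × Fin n)) with
      p.1 < p.2 ∧ H.Adj p.1 p.2, w p.1 p.2 := by
    rw [Finset.sum_filter, Fintype.sum_prod_type]
    unfold cost
    exact Finset.sum_congr rfl fun u _ => Finset.sum_congr rfl fun v _ => by congr
  rw [hc]
  have hinj : ∀ e : Sym2 (Fin n), s(e.inf, e.sup) = e := by
    intro e
    induction e using Sym2.ind with
    | h u v =>
      rcases le_total u v with h | h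
      · simp [h]
      · simp [h, Sym2.eq_swap]
  have hI : Set.InjOn (fun e : Sym2 (Fin n) => (e.inf, e.sup)) s := by
    intro e _ e' _ h
    simp only [Prod.mk.injEq] at h
    rw [← hinj e, ← hinj e', h.1, h.2]
  calc ∑ e ∈ s, Sym2.lift ⟨w, hw.symm⟩ e
      = ∑ p ∈ s.image (fun e : Sym2 (Fin n) => (e.inf, e.sup)), w p.1 p.2 := by
        rw [Finset.sum_image hI]
        refine Finset.sum_congr rfl fun e _ => ?_
        conv_lhs => rw [← hinj e]
        rfl
    _ ≤ _ := by
        refine Finset.sum_le_sum_of_subset_of_nonneg ?_ fun p _ _ => hw.nonneg _ _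
        intro p hp
        obtain ⟨e, he, rfl⟩ := Finset.mem_image.1 hp
        have := hs e he
        rw [← hinj e] at this
        have hadj : H.Adj e.inf e.sup := this
        have hne : e.inf ≠ e.sup := H.adj_sub hadj
        have hle : e.inf ≤ e.sup := by
          induction e using Sym2.ind with
          | h u v => simp
        simp [hadj, lt_of_le_of_ne hle hne]

/-- The height is the distance to `r`, and the parent is the next vertex on a shortest walk to `r`.
-/
theorem exists_parent {n : ℕ} {H : Graph n} (hH : H.coe.Connected) {r : Fin n}
    (hr : r ∈ H.verts) : ∃ (par : Fin n → Fin n) (ht : Fin n → ℕ),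
      ∀ v ∈ H.verts, v ≠ r → H.Adj v (par v) ∧ ht (par v) < ht v := by
  classical
  let ht : Fin n → ℕ := fun v => if h : v ∈ H.verts then H.coe.dist ⟨v, h⟩ ⟨r, hr⟩ else 0
  have key : ∀ v, ∃ u, v ∈ H.verts → v ≠ r → H.Adj v u ∧ ht u < ht v := by
    intro v
    by_cases hv : v ∈ H.verts
    · by_cases hvr : v = r
      · exact ⟨v, fun _ h => absurd hvr h⟩
      · obtain ⟨p, hp⟩ := (hH ⟨v, hv⟩ ⟨r, hr⟩).exists_walk_length_eq_dist
        cases p with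
        | nil => exact absurd rfl hvr
        | @cons _ u _ h p =>
          refine ⟨u.1, fun _ _ => ⟨h, ?_⟩⟩
          have h2 : H.coe.dist u ⟨r, hr⟩ ≤ p.length := SimpleGraph.dist_le p
          simp only [SimpleGraph.Walk.length_cons] at hp
          simp only [ht, hv, u.2, dif_pos]
          show H.coe.dist u ⟨r, hr⟩ < _
          omega
    · exact ⟨v, fun h => absurd h hv⟩
  choose par hpar using key
  exact ⟨par, ht, fun v hv hvr => hpar v hv hvr⟩

/-- Heights drop strictly towards the parent, so two vertices are never parents of each other and
the edges to the parents are distinct. -/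
theorem sum_parent_le_cost {n : ℕ} {w : Fin n → Fin n → ℝ} (hw : IsMetric w) {H : Graph n}
    {par : Fin n → Fin n} {ht : Fin n → ℕ} {s : Finset (Fin n)}
    (hpar : ∀ v ∈ s, H.Adj v (par v) ∧ ht (par v) < ht v) :
    ∑ v ∈ s, w v (par v) ≤ cost w H := by
  classical
  have hI : Set.InjOn (fun v => s(v, par v)) s := by
    intro u hu v hv h
    simp only [Sym2.eq_iff] at h
    rcases h with h | h
    · exact h.1
    · have h1 := (hpar u hu).2
      have h2 := (hpar v hv).2
      rw [h.2] at h1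
      rw [← h.1] at h2
      omega
  refine le_trans (le_of_eq ?_) (sum_le_cost hw (H := H) (s.image fun v => s(v, par v)) ?_)
  · rw [Finset.sum_image hI]
    rfl
  · intro e he
    obtain ⟨v, hv, rfl⟩ := Finset.mem_image.1 he
    exact (hpar v hv).1

/-! ### Random colourings and query trees -/

/-- The metric of a colouring: terminals of the same colour are at distance `ε`, other pairs of
vertices at distance `1`. -/
noncomputable def colorMetric {n q : ℕ} (T : Finset (Fin n)) (ε : ℝ) (f : Fin n → Fin q)
    (u v : Fin n) : ℝ :=
  if u = v then 0 else if u ∈ T ∧ v ∈ T ∧ f u = f v then ε else 1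

theorem isMetric_colorMetric {n q : ℕ} (T : Finset (Fin n)) {ε : ℝ} (h0 : 0 < ε) (h1 : ε ≤ 1)
    (f : Fin n → Fin q) : IsMetric (colorMetric T ε f) where
  self u := by simp [colorMetric]
  pos u v h := by
    simp only [colorMetric, h, if_false]
    split_ifs <;> linarith
  symm u v := by
    unfold colorMetric
    by_cases h : u = v
    · simp [h]
    · have h' : ¬ v = u := fun e => h e.symm
      have : (u ∈ T ∧ v ∈ T ∧ f u = f v) ↔ (v ∈ T ∧ u ∈ T ∧ f v = f u) := by
        constructor <;> rintro ⟨a, b, c⟩ <;> exact ⟨b, a, c.symm⟩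
      simp only [h, h', if_false, this]
  triangle u v x := by
    unfold colorMetric
    by_cases huv : u = v
    · subst huv; simp
    by_cases hvx : v = x
    · subst hvx; simp
    by_cases hux : u = x
    · subst hux
      simp only [huv, hvx, if_true, if_false]
      split_ifs <;> linarith
    · simp only [huv, hvx, hux, if_false]
      split_ifs <;> first | linarith | grind

/-- Identify the classes of `u` and `v` in the partition into the fibres of `κ`. -/
def mergeClass {n : ℕ} (κ : Fin n → Fin n) (u v : Fin n) : Fin n → Fin n :=
  fun x => if κ x = κ v then κ u else κ x

/-- The partition generated by `κ` and by the pairs of terminals of the same colour among the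
queries. -/
noncomputable def QueryTree.classes {n q : ℕ} {β : Type} (T : Finset (Fin n)) (ε : ℝ)
    (f : Fin n → Fin q) : QueryTree n β → (Fin n → Fin n) → Fin n → Fin n
  | .done _ => fun κ => κ
  | .ask u v next => fun κ =>
      (next (colorMetric T ε f u v)).classes T ε f
        (if u ∈ T ∧ v ∈ T ∧ f u = f v then mergeClass κ u v else κ)

/-- An idempotent `κ` encodes a partition by representatives. A colouring constant on the classes is
a free choice of one colour per representative, so each merge divides the number of colourings by
`q`. -/
theorem card_factoring {n q : ℕ} {κ : Fin n → Fin n} (hκ : ∀ x, κ (κ x) = κ x) :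
    (Finset.univ.filter fun f : Fin n → Fin q => ∀ x, f x = f (κ x)).card =
      q ^ (Finset.univ.image κ).card := by
  classical
  rw [← Fintype.card_subtype]
  have e : {f : Fin n → Fin q // ∀ x, f x = f (κ x)} ≃ (↥(Finset.univ.image κ) → Fin q) :=
    { toFun := fun f x => f.1 x.1
      invFun := fun g => ⟨fun x => g ⟨κ x, Finset.mem_image_of_mem _ (Finset.mem_univ _)⟩,
        fun x => by simp [hκ]⟩
      left_inv := fun f => by
        ext x
        simp [← f.2 x]
      right_inv := fun g => by
        funext ⟨x, hx⟩
        obtain ⟨y, -, rfl⟩ := Finset.mem_image.1 hx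
        simp [hκ] }
  rw [Fintype.card_congr e, Fintype.card_fun, Fintype.card_fin, Fintype.card_coe]

theorem mergeClass_idem {n : ℕ} {κ : Fin n → Fin n} (hκ : ∀ x, κ (κ x) = κ x) (u v : Fin n) :
    ∀ x, mergeClass κ u v (mergeClass κ u v x) = mergeClass κ u v x := by
  intro x
  unfold mergeClass
  by_cases h : κ x = κ v
  · simp [h, hκ]
  · simp [h, hκ]

theorem card_image_mergeClass {n : ℕ} {κ : Fin n → Fin n} {u v : Fin n} (h : κ u ≠ κ v) :
    (Finset.univ.image (mergeClass κ u v)).card + 1 = (Finset.univ.image κ).card := by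
  have : Finset.univ.image (mergeClass κ u v) = (Finset.univ.image κ).erase (κ v) := by
    ext y
    simp only [Finset.mem_image, Finset.mem_univ, true_and, Finset.mem_erase, mergeClass]
    constructor
    · rintro ⟨x, hx⟩
      split_ifs at hx with h1
      · exact ⟨hx ▸ h, u, hx⟩
      · exact ⟨hx ▸ h1, x, hx⟩
    · rintro ⟨h1, x, rfl⟩
      exact ⟨x, by simp [h1]⟩
  rw [this]
  exact Finset.card_erase_add_one (Finset.mem_image_of_mem _ (Finset.mem_univ _))

theorem factor_mergeClass {n q : ℕ} {κ : Fin n → Fin n} {u v : Fin n}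
    {f : Fin n → Fin q} (hf : ∀ x, f x = f (κ x)) (h : f u = f v) :
    ∀ x, f x = f (mergeClass κ u v x) := by
  intro x
  unfold mergeClass
  split_ifs with h1
  · rw [← hf u, h, hf v, ← h1, ← hf x]
  · exact hf x

theorem mergeClass_of_eq {n : ℕ} {κ : Fin n → Fin n} {u v : Fin n} (h : κ u = κ v) :
    mergeClass κ u v = κ := by
  funext x
  unfold mergeClass
  split_ifs with h1
  · rw [h, h1]
  · rfl

open Classical in
/-- Exponential moment of the number of class merges discovered with at most `t` queries. -/
theorem sum_classes_le {n q : ℕ} {β : Type} (T : Finset (Fin n)) (ε : ℝ) {D : ℝ} (hD : 0 < D)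
    (hq : 0 < q) (A : QueryTree n β) : ∀ (t : ℕ) (κ : Fin n → Fin n), (∀ x, κ (κ x) = κ x) →
    (∑ f : Fin n → Fin q, if (∀ x, f x = f (κ x)) ∧ A.queries (colorMetric T ε f) ≤ t then
      (1 / D) ^ (Finset.univ.image (A.classes T ε f κ)).card else 0) ≤
    (1 + D / q) ^ t * (q / D) ^ (Finset.univ.image κ).card := by
  have hq' : (0 : ℝ) < q := by exact_mod_cast hq
  induction A with
  | done b =>
    intro t κ hκ
    have h1 : (∑ f : Fin n → Fin q, if (∀ x, f x = f (κ x)) ∧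
        (QueryTree.done b : QueryTree n β).queries (colorMetric T ε f) ≤ t then
        (1 / D) ^ (Finset.univ.image ((QueryTree.done b : QueryTree n β).classes T ε f κ)).card
        else 0) = (q / D) ^ (Finset.univ.image κ).card := by
      simp only [QueryTree.queries, QueryTree.classes, zero_le, and_true]
      rw [← Finset.sum_filter, Finset.sum_const, nsmul_eq_mul]
      have := card_factoring (q := q) hκ
      rw [show (Finset.univ.filter fun f : Fin n → Fin q => ∀ x, f x = f (κ x)).card =
        q ^ (Finset.univ.image κ).card by convert this]
      push_cast
      rw [← mul_pow]
      congr 1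
      ring
    rw [h1]
    have : (1 : ℝ) ≤ (1 + D / q) ^ t := one_le_pow₀ (by have := div_pos hD hq'; linarith)
    exact le_mul_of_one_le_left (by positivity) this
  | ask u v next ih =>
    intro t κ hκ
    cases t with
    | zero =>
      simp only [QueryTree.queries, Nat.le_zero, Nat.add_eq_zero_iff, one_ne_zero, and_false,
        if_false, Finset.sum_const_zero]
      positivity
    | succ t =>
      simp only [QueryTree.queries, add_le_add_iff_right, QueryTree.classes]
      have h1 : (1 : ℝ) ≤ 1 + D / q := by have := div_pos hD hq'; linarith
      have hstep : (1 + D / q) ^ t * (q / D) ^ (Finset.univ.image κ).card ≤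
          (1 + D / q) ^ (t + 1) * (q / D) ^ (Finset.univ.image κ).card := by
        gcongr
        · omega
      by_cases hT : u ∈ T ∧ v ∈ T
      · by_cases hκuv : κ u = κ v
        -- Within one class the answer is already determined, and nothing is merged.
        · refine le_trans ?_ ((ih (if u = v then 0 else ε) t κ hκ).trans hstep)
          refine Finset.sum_le_sum fun f _ => le_of_eq ?_
          by_cases hf : ∀ x, f x = f (κ x)
          · have hfuv : f u = f v := by rw [hf u, hκuv, ← hf v]
            have hw : colorMetric T ε f u v = if u = v then 0 else ε := by
              simp [colorMetric, hT, hfuv]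
            simp only [hw, hT, hfuv, and_self, if_true, mergeClass_of_eq hκuv]
          · simp [hf]
        · have huv : u ≠ v := fun e => hκuv (by rw [e])
          -- Equal colours at `u` and `v`: these are colourings for the merged partition, with one
          -- class fewer, which brings the factor D/q. Different colours: the sum is enlarged to all
          -- colourings for `κ`, so that negative answers need not be remembered. Together this is
          -- the factor 1 + D/q.
          have hm := ih ε t (mergeClass κ u v) (mergeClass_idem hκ u v)
          have hd := ih 1 t κ hκ
          have hc := card_image_mergeClass hκuv
          rw [← hc] at hd ⊢
          refine le_trans ?_ ((add_le_add hm hd).trans (le_of_eq ?_))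
          · rw [← Finset.sum_add_distrib]
            refine Finset.sum_le_sum fun f _ => ?_
            by_cases hfuv : f u = f v
            · have hw : colorMetric T ε f u v = ε := by
                simp [colorMetric, hT, hfuv, huv]
              simp only [hw, hT, hfuv, and_self, if_true]
              refine le_add_of_le_of_nonneg ?_ (by split_ifs <;> positivity)
              by_cases hf : ∀ x, f x = f (κ x)
              · have h2 := factor_mergeClass hf hfuv
                by_cases hQ : (next ε).queries (colorMetric T ε f) ≤ t
                · rw [if_pos ⟨hf, hQ⟩, if_pos ⟨h2, hQ⟩]
                · rw [if_neg (fun h => hQ h.2), if_neg (fun h => hQ h.2)]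
              · rw [if_neg (fun h => hf h.1)]
                split_ifs <;> positivity
            · have hw : colorMetric T ε f u v = 1 := by
                simp [colorMetric, hfuv, huv]
              simp only [hw, hfuv, and_false, if_false]
              exact le_add_of_nonneg_left (by split_ifs <;> positivity)
          · rw [pow_succ, pow_succ (1 + D / q)]
            field_simp
            ring
      · refine le_trans ?_ ((ih (if u = v then 0 else 1) t κ hκ).trans hstep)
        refine Finset.sum_le_sum fun f _ => le_of_eq ?_
        have hT' : ¬ (u ∈ T ∧ v ∈ T ∧ f u = f v) := fun h => hT ⟨h.1, h.2.1⟩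
        have hw : colorMetric T ε f u v = if u = v then 0 else 1 := by
          simp only [colorMetric, if_neg hT']
        simp only [hw, if_neg hT']

/-! ### Verification queries appended to an algorithm -/

/-- Query all pairs in a list and then stop with output `b`. -/
def QueryTree.askAll {n : ℕ} {β : Type} (b : β) : List (Fin n × Fin n) → QueryTree n β
  | [] => .done b
  | e :: l => .ask e.1 e.2 fun _ => askAll b l

/-- After stopping with output `b`, query in addition all pairs in the list `g b`. -/
def QueryTree.thenAsk {n : ℕ} {β : Type} (g : β → List (Fin n × Fin n)) :
    QueryTree n β → QueryTree n β
  | .done b => .askAll b (g b)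
  | .ask u v next => .ask u v fun x => (next x).thenAsk g

theorem QueryTree.queries_askAll {n : ℕ} {β : Type} (w : Fin n → Fin n → ℝ) (b : β)
    (l : List (Fin n × Fin n)) : (askAll b l).queries w = l.length := by
  induction l with
  | nil => rfl
  | cons e l ih => simp [askAll, queries, ih]

theorem QueryTree.queries_thenAsk {n : ℕ} {β : Type} (w : Fin n → Fin n → ℝ)
    (g : β → List (Fin n × Fin n)) (A : QueryTree n β) :
    (A.thenAsk g).queries w = A.queries w + (g (A.output w)).length := by
  induction A with
  | done b => simp [thenAsk, queries, queries_askAll, output]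
  | ask u v next ih => simp only [thenAsk, queries, ih, output]; omega

theorem mergeClass_congr {n : ℕ} {κ : Fin n → Fin n} {x y : Fin n} (h : κ x = κ y)
    (u v : Fin n) : mergeClass κ u v x = mergeClass κ u v y := by
  simp [mergeClass, h]

/-- Classes are only merged, never split. -/
theorem QueryTree.classes_congr {n q : ℕ} {β : Type} (T : Finset (Fin n)) (ε : ℝ)
    (f : Fin n → Fin q) (A : QueryTree n β) : ∀ {κ : Fin n → Fin n} {x y : Fin n}, κ x = κ y →
    A.classes T ε f κ x = A.classes T ε f κ y := by
  induction A with
  | done b => exact fun h => h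
  | ask u v next ih =>
    intro κ x y h
    simp only [classes]
    apply ih
    split_ifs
    · exact mergeClass_congr h u v
    · exact h

theorem QueryTree.classes_askAll {n q : ℕ} {β : Type} (T : Finset (Fin n)) (ε : ℝ)
    (f : Fin n → Fin q) (b : β) (l : List (Fin n × Fin n)) : ∀ (κ : Fin n → Fin n)
    {e : Fin n × Fin n}, e ∈ l → e.1 ∈ T → e.2 ∈ T → f e.1 = f e.2 →
    (askAll b l).classes T ε f κ e.1 = (askAll b l).classes T ε f κ e.2 := by
  induction l with
  | nil => intro κ e h; simp at h
  | cons e' l ih =>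
    intro κ e he h1 h2 h3
    simp only [askAll, classes]
    rcases List.mem_cons.1 he with rfl | he
    · apply classes_congr
      rw [if_pos ⟨h1, h2, h3⟩]
      simp [mergeClass]
    · exact ih _ he h1 h2 h3

/-- This is the purpose of the appended queries: every monochromatic terminal pair listed for the
output becomes known, whatever the algorithm itself had asked. -/
theorem QueryTree.classes_thenAsk {n q : ℕ} {β : Type} (T : Finset (Fin n)) (ε : ℝ)
    (f : Fin n → Fin q) (g : β → List (Fin n × Fin n)) (A : QueryTree n β) :
    ∀ (κ : Fin n → Fin n) {e : Fin n × Fin n}, e ∈ g (A.output (colorMetric T ε f)) →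
    e.1 ∈ T → e.2 ∈ T → f e.1 = f e.2 →
    (A.thenAsk g).classes T ε f κ e.1 = (A.thenAsk g).classes T ε f κ e.2 := by
  induction A with
  | done b => intro κ e he h1 h2 h3; exact classes_askAll T ε f b _ κ he h1 h2 h3
  | ask u v next ih =>
    intro κ e he h1 h2 h3
    simp only [thenAsk, classes]
    exact ih _ _ he h1 h2 h3

/-! ### The lower bound -/

/-- Attach every terminal to a representative of its colour at distance `ε`, and every other
representative to `r`, the representative of its own colour. There are at most q - 1 unit edges, and
the short edges cost at most 1 in total. -/
theorem exists_steinerTree_colorMetric {n q : ℕ} {T : Finset (Fin n)} (hT : T.Nonempty)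
    {ε : ℝ} (h0 : 0 < ε) (h1 : T.card * ε ≤ 1) (f : Fin n → Fin q) :
    ∃ H : Graph n, IsSteinerTree T H ∧ cost (colorMetric T ε f) H ≤ q := by
  classical
  obtain ⟨r, hr⟩ := hT
  have hcard : 1 ≤ T.card := Finset.card_pos.2 ⟨r, hr⟩
  have hcard' : (1 : ℝ) ≤ T.card := by exact_mod_cast hcard
  have hε1 : ε ≤ 1 := by nlinarith
  have hrep : ∀ c, ∃ x, (c = f r → x = r) ∧ ∀ v ∈ T, f v = c → x ∈ T ∧ f x = c := by
    intro c
    by_cases hc : c = f r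
    · exact ⟨r, fun _ => rfl, fun v _ _ => ⟨hr, hc.symm⟩⟩
    · by_cases h : ∃ v ∈ T, f v = c
      · obtain ⟨v, hv, hvc⟩ := h
        exact ⟨v, fun e => absurd e hc, fun _ _ _ => ⟨hv, hvc⟩⟩
      · exact ⟨r, fun _ => rfl, fun v hv hvc => absurd ⟨v, hv, hvc⟩ h⟩
  choose rep hrep1 hrep2 using hrep
  have hrr : rep (f r) = r := hrep1 _ rfl
  let par : Fin n → Fin n := fun v => if v = rep (f v) then r else rep (f v)
  have hparr : par r = r := by simp [par, hrr]
  have hparT : ∀ v ∈ T, par v ∈ T := by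
    intro v hv
    simp only [par]
    split_ifs
    · exact hr
    · exact (hrep2 _ v hv rfl).1
  let H : Graph n :=
    { verts := T
      Adj := fun u v => u ≠ v ∧ u ∈ T ∧ v ∈ T ∧ (par u = v ∨ par v = u)
      adj_sub := fun h => h.1
      edge_vert := fun h => h.2.1
      symm := ⟨fun u v h => ⟨h.1.symm, h.2.2.1, h.2.1, h.2.2.2.symm⟩⟩ }
  have hadj : ∀ u v, H.Adj u v →
      ∃ j ∈ T.erase r, (id j = u ∧ par j = v) ∨ (id j = v ∧ par j = u) := by
    rintro u v ⟨hne, hu, hv, h | h⟩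
    · refine ⟨u, Finset.mem_erase.2 ⟨?_, hu⟩, Or.inl ⟨rfl, h⟩⟩
      rintro rfl
      exact hne (hparr.symm.trans h)
    · refine ⟨v, Finset.mem_erase.2 ⟨?_, hv⟩, Or.inr ⟨rfl, h⟩⟩
      rintro rfl
      exact hne (h.symm.trans hparr)
  have hconn : H.coe.Connected := by
    refine connected_of_height (r := r) hr
      -- Root, representatives and remaining terminals form three levels.
      (fun v => if v = r then 0 else if v = rep (f v) then 1 else 2) ?_
    intro v hv hvr
    have hv' : v ∈ T := hv
    refine ⟨par v, ⟨?_, hv', hparT v hv', Or.inl rfl⟩, ?_⟩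
    · simp only [par]
      split_ifs with h
      · exact hvr
      · exact h
    · simp only [par, hvr, if_false]
      split_ifs with h h2 h3
      · exact one_pos
      · exact absurd rfl h2
      · exact absurd rfl h2
      · omega
      · omega
      · exfalso
        rename_i h4
        apply h4
        rw [(hrep2 _ v hv' rfl).2]
  have hle := cost_le_of_indexed (isMetric_colorMetric T h0 hε1 f) (H := H) hadj
  have hs : (T.erase r).card + 1 = T.card := Finset.card_erase_add_one hr
  refine ⟨H, ⟨fun v hv => hv, isTree_of_indexed rfl hs.le hadj hconn⟩, hle.trans ?_⟩
  have hb : ∀ v ∈ T.erase r, colorMetric T ε f (id v) (par v) ≤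
      (if v = rep (f v) then 1 else 0) + ε := by
    intro v hv
    have hvT := Finset.mem_of_mem_erase hv
    by_cases h : v = rep (f v)
    · rw [if_pos h]
      unfold colorMetric
      split_ifs <;> linarith
    · rw [if_neg h]
      have h3 := hrep2 _ v hvT rfl
      have : par v = rep (f v) := by simp [par, h]
      rw [this]
      simp only [colorMetric, id, h, if_false]
      rw [if_pos ⟨hvT, h3.1, h3.2.symm⟩]
      linarith
  refine (Finset.sum_le_sum hb).trans ?_
  rw [Finset.sum_add_distrib, Finset.sum_const, nsmul_eq_mul, ← Finset.sum_filter,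
    Finset.sum_const, nsmul_eq_mul, mul_one]
  have h5 : ((T.erase r).filter fun v => v = rep (f v)).card ≤ (Finset.univ.erase (f r)).card := by
    refine Finset.card_le_card_of_injOn f ?_ ?_
    · intro v hv
      have hv := Finset.mem_filter.1 hv
      have hvr := Finset.ne_of_mem_erase hv.1
      refine Finset.mem_coe.2 (Finset.mem_erase.2 ⟨fun h => hvr ?_, Finset.mem_univ _⟩)
      rw [hv.2, h, hrr]
    · intro u hu v hv h
      have hu := (Finset.mem_filter.1 hu).2
      have hv := (Finset.mem_filter.1 hv).2
      rw [hu, hv, h]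
  have h6 : (Finset.univ.erase (f r)).card + 1 = q := by
    rw [Finset.card_erase_add_one (Finset.mem_univ _)]; simp
  have h7 : (((T.erase r).filter fun v => v = rep (f v)).card : ℝ) + 1 ≤ q := by
    rw [← h6]; push_cast; gcongr
  have h8 : ((T.erase r).card : ℝ) ≤ T.card := by
    exact_mod_cast Finset.card_erase_le
  nlinarith

open Classical in
/-- A deterministic algorithm with few queries succeeds on few colourings. -/
theorem card_success_le {n q M t : ℕ} {T : Finset (Fin n)} (hT : T.Nonempty) {ε α D : ℝ}
    (h0 : 0 < ε) (h1 : T.card * ε ≤ 1) (hα : 0 ≤ α) (hD : 1 ≤ D) (hq : 0 < q)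
    (hM : M + α * q + 1 ≤ T.card) (A : QueryTree n (Graph n)) :
    ((Finset.univ.filter fun f : Fin n → Fin q =>
      IsApproxSteinerTree α (colorMetric T ε f) T (A.output (colorMetric T ε f)) ∧
      A.queries (colorMetric T ε f) ≤ t).card : ℝ) * D ^ M ≤
    q ^ n * (1 + D / q) ^ (t + T.card) := by
  obtain ⟨r, hr⟩ := id hT
  have hcard : 1 ≤ T.card := Finset.card_pos.2 ⟨r, hr⟩
  have hcard' : (1 : ℝ) ≤ T.card := by exact_mod_cast hcard
  have hε1 : ε ≤ 1 := by nlinarith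
  have hD0 : 0 < D := by linarith
  have hpar : ∀ H : Graph n, ∃ (par : Fin n → Fin n) (ht : Fin n → ℕ), IsSteinerTree T H →
      ∀ v ∈ H.verts, v ≠ r → H.Adj v (par v) ∧ ht (par v) < ht v := by
    intro H
    by_cases h : IsSteinerTree T H
    · obtain ⟨par, ht, h2⟩ := exists_parent h.2.connected (h.1 r hr)
      exact ⟨par, ht, fun _ => h2⟩
    · exact ⟨id, fun _ => 0, fun h' => absurd h' h⟩
  choose par ht hpar using hpar
  -- The pairs to verify depend only on the output: the edges from the terminals other than `r` to
  -- their parents, at most `T.card` of them.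
  let g : Graph n → List (Fin n × Fin n) := fun H => (T.erase r).toList.map fun v => (v, par H v)
  have hg : ∀ H, (g H).length ≤ T.card := fun H => by
    simp only [g, List.length_map, Finset.length_toList]
    exact Finset.card_erase_le
  have hsum := sum_classes_le T ε hD0 hq (A.thenAsk g) (t + T.card) id (fun _ => rfl)
  have hid : (Finset.univ.image (id : Fin n → Fin n)).card = n := by simp
  simp only [id, implies_true, true_and] at hsum
  rw [hid] at hsum
  -- A successful run ends with at most n - M classes. Since D ≥ 1, its colouring contributes at
  -- least (1/D)^(n - M) to the moment sum.
  have hterm : ∀ f ∈ (Finset.univ.filter fun f : Fin n → Fin q =>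
      IsApproxSteinerTree α (colorMetric T ε f) T (A.output (colorMetric T ε f)) ∧
      A.queries (colorMetric T ε f) ≤ t), (1 / D) ^ n * D ^ M ≤
      if (A.thenAsk g).queries (colorMetric T ε f) ≤ t + T.card then
      (1 / D) ^ (Finset.univ.image ((A.thenAsk g).classes T ε f id)).card else 0 := by
    intro f hf
    obtain ⟨hap, hqu⟩ := (Finset.mem_filter.1 hf).2
    have hw := isMetric_colorMetric T h0 hε1 f
    rw [if_pos (by rw [QueryTree.queries_thenAsk]; exact add_le_add hqu (hg _))]
    set H := A.output (colorMetric T ε f) with hH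
    set κ := (A.thenAsk g).classes T ε f id with hκ
    obtain ⟨H', hH', hc'⟩ := exists_steinerTree_colorMetric hT h0 h1 f
    have hc : cost (colorMetric T ε f) H ≤ α * q :=
      (hap.2 H' hH').trans (mul_le_mul_of_nonneg_left hc' hα)
    have hparH : ∀ v ∈ T.erase r, H.Adj v (par H v) ∧ ht H (par H v) < ht H v := fun v hv =>
      hpar H hap.1 v (hap.1.1 v (Finset.mem_of_mem_erase hv)) (Finset.ne_of_mem_erase hv)
    have hlow := (sum_parent_le_cost hw hparH).trans hc
    let P : Fin n → Prop := fun v => par H v ∈ T ∧ f v = f (par H v)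
    -- Every parent edge that does not join terminals of equal colour has length 1.
    have hlow2 : (((T.erase r).filter fun v => ¬ P v).card : ℝ) ≤ α * q := by
      refine le_trans ?_ hlow
      rw [Finset.card_filter]
      push_cast
      refine Finset.sum_le_sum fun v hv => ?_
      by_cases hP : P v
      · simp only [hP, not_true, if_false]
        exact hw.nonneg _ _
      · simp only [hP, not_false_eq_true, if_true]
        have hne : v ≠ par H v := fun e => by
          have := (hparH v hv).2
          rw [← e] at this
          omega
        have : ¬ (v ∈ T ∧ par H v ∈ T ∧ f v = f (par H v)) := fun h => hP h.2
        simp [colorMetric, hne, this]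
    have hsplit := Finset.card_filter_add_card_filter_not (s := T.erase r) P
    have hs : (T.erase r).card + 1 = T.card := Finset.card_erase_add_one hr
    have hMle : M ≤ ((T.erase r).filter P).card := by
      have h3 : (((T.erase r).filter P).card : ℝ) +
        ((T.erase r).filter fun v => ¬ P v).card + 1 = T.card := by
        rw [← hs, ← hsplit]; push_cast; ring
      have : (M : ℝ) ≤ ((T.erase r).filter P).card := by linarith
      exact_mod_cast this
    have hκe : ∀ v ∈ (T.erase r).filter P, κ v = κ (par H v) := by
      intro v hv
      obtain ⟨hv1, hv2⟩ := Finset.mem_filter.1 hv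
      refine QueryTree.classes_thenAsk T ε f g A id (e := (v, par H v)) ?_
        (Finset.mem_of_mem_erase hv1) hv2.1 hv2.2
      simp only [g, List.mem_map, Finset.mem_toList]
      exact ⟨v, hv1, rfl⟩
    -- Moving up along monochromatic parent edges stays in the class and ends outside the filtered
    -- set. So every class has a member there.
    have him : (Finset.univ.image κ).card ≤ (((T.erase r).filter P)ᶜ).card := by
      have hsub : Finset.univ.image κ ⊆ (((T.erase r).filter P)ᶜ).image κ := by
        have : ∀ m, ∀ v, ht H v = m → κ v ∈ (((T.erase r).filter P)ᶜ).image κ := by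
          intro m
          induction m using Nat.strong_induction_on with
          | _ m ih =>
            intro v hm
            by_cases hv : v ∈ (T.erase r).filter P
            · rw [hκe v hv]
              have := (hparH v (Finset.mem_filter.1 hv).1).2
              exact ih _ (hm ▸ this) _ rfl
            · exact Finset.mem_image_of_mem _ (Finset.mem_compl.2 hv)
        intro y hy
        obtain ⟨v, -, rfl⟩ := Finset.mem_image.1 hy
        exact this _ v rfl
      exact (Finset.card_le_card hsub).trans Finset.card_image_le
    rw [Finset.card_compl, Fintype.card_fin] at him
    have hle : ((T.erase r).filter P).card ≤ n := by
      simpa using Finset.card_le_univ ((T.erase r).filter P)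
    have hexp : (Finset.univ.image κ).card + M ≤ n := by omega
    obtain ⟨j, hj⟩ := Nat.exists_eq_add_of_le hexp
    have e1 : (1 / D) ^ n = (1 / D) ^ ((Finset.univ.image κ).card + (M + j)) := by
      congr 1; omega
    rw [e1, pow_add, pow_add, mul_assoc, mul_assoc]
    refine mul_le_of_le_one_right (by positivity) ?_
    have h4 : (1 / D) ^ j ≤ 1 := pow_le_one₀ (by positivity) (by rw [div_le_one hD0]; exact hD)
    calc (1 / D) ^ M * ((1 / D) ^ j * D ^ M) = (1 / D * D) ^ M * (1 / D) ^ j := by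
          rw [mul_pow]; ring
      _ ≤ 1 := by rw [one_div_mul_cancel hD0.ne', one_pow, one_mul]; exact h4
  have hfin := (Finset.sum_le_sum hterm).trans ((Finset.sum_le_univ_sum_of_nonneg fun f => by
    split_ifs <;> positivity).trans hsum)
  rw [Finset.sum_const, nsmul_eq_mul] at hfin
  have h5 : ((q : ℝ) / D) ^ n = q ^ n * (1 / D) ^ n := by rw [← mul_pow]; congr 1; ring
  rw [h5] at hfin
  have hpos : 0 < (1 / D) ^ n := by positivity
  refine le_of_mul_le_mul_right ?_ hpos
  linarith


/-- Since e < 3, the gain is at least (4/3)^k ≥ 1 + k/3 by Bernoulli's inequality; this absorbs the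
factor 3 and the factor 4 lost by rounding k/2. -/
theorem pow_arith {k : ℕ} (hk : 600 ≤ k) : 3 * Real.exp k < (16 : ℝ) ^ (k / 2) := by
  have h1 : (4 : ℝ) ^ k ≤ 4 * 16 ^ (k / 2) := by
    have : (16 : ℝ) ^ (k / 2) = 4 ^ (2 * (k / 2)) := by rw [pow_mul]; norm_num
    rw [this, ← pow_succ']
    exact pow_le_pow_right₀ (by norm_num) (by omega)
  have h2 : Real.exp k ≤ 3 ^ k := by
    rw [← mul_one (k : ℝ), Real.exp_nat_mul]
    gcongr
    linarith [Real.exp_one_lt_d9]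
  have h3 : (1 : ℝ) + k * (1 / 3) ≤ (1 + 1 / 3) ^ k :=
    one_add_mul_le_pow (by norm_num) k
  have h4 : (600 : ℝ) ≤ k := by exact_mod_cast hk
  have h5 : (4 : ℝ) ^ k = (1 + 1 / 3) ^ k * 3 ^ k := by rw [← mul_pow]; norm_num
  have h6 : (0 : ℝ) < 3 ^ k := by positivity
  have h7 : 200 * (3 : ℝ) ^ k ≤ 4 ^ k := by
    rw [h5]; gcongr; linarith
  linarith

theorem lower_bound : ∃ c C : ℝ, 0 < c ∧ 0 < C ∧
      ∀ (α : ℝ), 2 ≤ α → ∀ (n : ℕ) (T : Finset (Fin n)), C * α ≤ (T.card : ℝ) →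
      ∀ (Ω : Type*) [MeasurableSpace Ω] (μ : MeasureTheory.Measure Ω)
        [MeasureTheory.IsProbabilityMeasure μ] (A : RandAlg n Ω),
        (∀ w : Fin n → Fin n → ℝ, IsMetric w →
          2 / 3 ≤ μ {ω | IsApproxSteinerTree α w T ((A.alg ω).output w)}) →
        ∃ w : Fin n → Fin n → ℝ, IsMetric w ∧
          ENNReal.ofReal (c * ((T.card : ℝ) ^ 2 / α)) ≤
            ∫⁻ ω, ((A.alg ω).queries w : ENNReal) ∂μ := by
  classical
  -- With 1536 = 3 · 512, Markov's inequality at 3E allows t ≤ k²/(512α) ≤ kq/32 queries. The bound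
  -- k ≥ 300α gives k ≥ 600 and q ≥ 32.
  refine ⟨1 / 1536, 300, by norm_num, by norm_num, ?_⟩
  intro α hα n T hTα Ω _ μ _ A hA
  by_contra! hcon
  set k : ℕ := T.card with hk
  have hα0 : 0 < α := by linarith
  have hk600 : (600 : ℝ) ≤ k := by linarith
  have hk0 : (0 : ℝ) < k := by linarith
  have hkN : 600 ≤ k := by exact_mod_cast hk600
  have hT : T.Nonempty := Finset.card_pos.1 (by omega)
  -- With this number of colours, an approximate tree costs at most αq ≤ k/8.
  set q : ℕ := ⌊(k : ℝ) / (8 * α)⌋₊ with hqdef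
  have hx : 37 ≤ (k : ℝ) / (8 * α) := by rw [le_div_iff₀ (by positivity)]; linarith
  have hq1 : (q : ℝ) ≤ k / (8 * α) := Nat.floor_le (by positivity)
  have hq2 : (k : ℝ) / (8 * α) < q + 1 := Nat.lt_floor_add_one _
  have hq32 : (32 : ℝ) ≤ q := by linarith
  have hq0 : 0 < q := by
    have : (0 : ℝ) < q := by linarith
    exact_mod_cast this
  have hαq : α * q ≤ k / 8 := by
    rw [le_div_iff₀ (by positivity)] at hq1
    linarith
  have hkq : (k : ℝ) / α ≤ 16 * q := by
    have : (k : ℝ) / α = 8 * (k / (8 * α)) := by field_simp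
    linarith
  have hε0 : (0 : ℝ) < 1 / k := by positivity
  have hε1 : (T.card : ℝ) * (1 / k) ≤ 1 := by rw [← hk]; field_simp; exact le_rfl
  have hε2 : (1 : ℝ) / k ≤ 1 := by rw [div_le_one hk0]; linarith
  set E : ℝ := 1 / 1536 * ((k : ℝ) ^ 2 / α) with hE
  have hE0 : 0 < E := by positivity
  set t : ℕ := ⌊3 * E⌋₊ with ht
  have ht1 : (t : ℝ) ≤ 3 * E := Nat.floor_le (by positivity)
  have ht2 : 3 * E < t + 1 := Nat.lt_floor_add_one _
  have hM : ((k / 2 : ℕ) : ℝ) + α * q + 1 ≤ T.card := by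
    have : ((k / 2 : ℕ) : ℝ) ≤ (k : ℝ) / 2 := Nat.cast_div_le
    rw [← hk]
    linarith
  let w : (Fin n → Fin q) → Fin n → Fin n → ℝ := fun f => colorMetric T (1 / k) f
  have hw : ∀ f, IsMetric (w f) := fun f => isMetric_colorMetric T hε0 hε2 f
  let S : (Fin n → Fin q) → Set Ω := fun f =>
    {ω | IsApproxSteinerTree α (w f) T ((A.alg ω).output (w f)) ∧ (A.alg ω).queries (w f) ≤ t}
  have hSm1 : ∀ f, MeasurableSet {ω | IsApproxSteinerTree α (w f) T ((A.alg ω).output (w f))} := by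
    intro f
    -- There are finitely many graphs on `Fin n`, so measurability of the single outputs suffices.
    have : {ω | IsApproxSteinerTree α (w f) T ((A.alg ω).output (w f))} =
        ⋃ H ∈ {H | IsApproxSteinerTree α (w f) T H}, {ω | (A.alg ω).output (w f) = H} := by
      ext ω; simp
    rw [this]
    exact MeasurableSet.biUnion (Set.toFinite _).countable fun H _ => A.measurable_output _ _
  have hSm2 : ∀ f, MeasurableSet {ω | (A.alg ω).queries (w f) ≤ t} := fun f =>
    A.measurable_queries (w f) (measurableSet_Iic (a := t))
  have hSm : ∀ f, MeasurableSet (S f) := fun f => (hSm1 f).inter (hSm2 f)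
  have hSlow : ∀ f, ENNReal.ofReal (1 / 3) ≤ μ (S f) := by
    intro f
    -- Markov's inequality: the expectation is below E, and t + 1 > 3E.
    have hmk : μ {ω | ¬ (A.alg ω).queries (w f) ≤ t} ≤ ENNReal.ofReal (1 / 3) := by
      have h1 := MeasureTheory.mul_meas_ge_le_lintegral (μ := μ)
        (f := fun ω => ((A.alg ω).queries (w f) : ENNReal))
        (measurable_from_top.comp (A.measurable_queries (w f))) ((t + 1 : ℕ) : ENNReal)
      have h2 : {ω | ¬ (A.alg ω).queries (w f) ≤ t} ⊆
          {ω | ((t + 1 : ℕ) : ENNReal) ≤ ((A.alg ω).queries (w f) : ENNReal)} := by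
        intro ω hω
        simp only [Set.mem_ofPred_eq, not_le] at hω
        exact_mod_cast hω
      have h3 := h1.trans (hcon (w f) (hw f)).le
      have h4 : ((t + 1 : ℕ) : ENNReal) * μ {ω | ¬ (A.alg ω).queries (w f) ≤ t} ≤
          ((t + 1 : ℕ) : ENNReal) * ENNReal.ofReal (1 / 3) := by
        refine (mul_le_mul_right (MeasureTheory.measure_mono h2) _).trans (h3.trans ?_)
        rw [← ENNReal.ofReal_natCast, ← ENNReal.ofReal_mul (by positivity)]
        apply ENNReal.ofReal_le_ofReal
        push_cast
        linarith
      exact (ENNReal.mul_le_mul_iff_right (by simp) (ENNReal.natCast_ne_top _)).1 h4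
    have h5 : {ω | IsApproxSteinerTree α (w f) T ((A.alg ω).output (w f))} ⊆
        S f ∪ {ω | ¬ (A.alg ω).queries (w f) ≤ t} := by
      intro ω hω
      by_cases h : (A.alg ω).queries (w f) ≤ t
      · exact Or.inl ⟨hω, h⟩
      · exact Or.inr h
    have h6 := (hA (w f) (hw f)).trans ((MeasureTheory.measure_mono h5).trans
      ((MeasureTheory.measure_union_le _ _).trans (add_le_add_right hmk _)))
    have h7 : (2 / 3 : ENNReal) = ENNReal.ofReal (1 / 3) + ENNReal.ofReal (1 / 3) := by
      rw [← ENNReal.ofReal_add (by norm_num) (by norm_num)]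
      rw [show (1 / 3 + 1 / 3 : ℝ) = 2 / 3 by norm_num, ENNReal.ofReal_div_of_pos (by norm_num)]
      simp
    rw [h7] at h6
    exact (ENNReal.add_le_add_iff_right ENNReal.ofReal_ne_top).1 h6
  -- For each seed at most `N` colourings are solved with at most `t` queries, while each colouring
  -- is solved so with probability at least 1/3. Interchanging sum and integral gives q^n / 3 ≤ N.
  set N : ℝ := q ^ n * (1 + 16 / q) ^ (t + k) / 16 ^ (k / 2) with hN
  have hpt : ∀ ω, (∑ f, (S f).indicator (1 : Ω → ENNReal) ω) ≤ ENNReal.ofReal N := by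
    intro ω
    have h1 := card_success_le (q := q) (t := t) hT hε0 hε1 hα0.le (D := 16) (by norm_num)
      hq0 hM (A.alg ω)
    have h2 : (∑ f, (S f).indicator (1 : Ω → ENNReal) ω) =
        (((Finset.univ.filter fun f : Fin n → Fin q =>
      IsApproxSteinerTree α (colorMetric T (1 / k) f) T
        ((A.alg ω).output (colorMetric T (1 / k) f)) ∧
      (A.alg ω).queries (colorMetric T (1 / k) f) ≤ t).card : ℕ) : ENNReal) := by
      rw [Finset.card_filter]
      push_cast
      refine Finset.sum_congr rfl fun f _ => ?_
      simp only [Set.indicator_apply, Pi.one_apply]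
      rfl
    rw [h2, ← ENNReal.ofReal_natCast]
    apply ENNReal.ofReal_le_ofReal
    rw [hN, le_div_iff₀ (by positivity)]
    exact h1
  have hint : ∑ f, μ (S f) ≤ ENNReal.ofReal N := by
    calc ∑ f, μ (S f) = ∫⁻ ω, ∑ f, (S f).indicator (1 : Ω → ENNReal) ω ∂μ := by
          rw [MeasureTheory.lintegral_finsetSum _ fun f _ => measurable_one.indicator (hSm f)]
          exact Finset.sum_congr rfl fun f _ => (MeasureTheory.lintegral_indicator_one (hSm f)).symm
      _ ≤ ∫⁻ _, ENNReal.ofReal N ∂μ := MeasureTheory.lintegral_mono hpt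
      _ = ENNReal.ofReal N := by simp
  have hlow : ENNReal.ofReal (q ^ n * (1 / 3)) ≤ ENNReal.ofReal N := by
    refine le_trans (le_of_eq ?_) ((Finset.sum_le_sum fun f _ => hSlow f).trans hint)
    rw [Finset.sum_const, nsmul_eq_mul, ENNReal.ofReal_mul (by positivity)]
    congr 1
    rw [Finset.card_univ, Fintype.card_fun, Fintype.card_fin, Fintype.card_fin,
      ← ENNReal.ofReal_natCast]
    push_cast
    rfl
  have hN0 : 0 ≤ N := by positivity
  have hlow' := (ENNReal.ofReal_le_ofReal_iff hN0).1 hlow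
  have hqn : (0 : ℝ) < q ^ n := by positivity
  rw [hN, le_div_iff₀ (by positivity), mul_assoc, mul_le_mul_iff_right₀ hqn] at hlow'
  -- Both t and k are at most kq/32, so 16(t + k)/q ≤ k.
  have hexp : (1 + 16 / (q : ℝ)) ^ (t + k) ≤ Real.exp k := by
    have h1 : 1 + 16 / (q : ℝ) ≤ Real.exp (16 / q) := by
      rw [add_comm]; exact Real.add_one_le_exp _
    calc (1 + 16 / (q : ℝ)) ^ (t + k) ≤ Real.exp (16 / q) ^ (t + k) := by gcongr
      _ = Real.exp ((t + k : ℕ) * (16 / q)) := (Real.exp_nat_mul _ _).symm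
      _ ≤ Real.exp k := by
        apply Real.exp_le_exp.2
        have h2 : (k : ℝ) ^ 2 / α ≤ k * (16 * q) := by
          rw [pow_two, mul_div_assoc]; gcongr
        rw [mul_div_assoc', div_le_iff₀ (by linarith)]
        push_cast
        have h3 : (k : ℝ) * 32 ≤ k * q := by gcongr
        linarith
  have := pow_arith hkN
  linarith

/-! ### Reasoning about programs -/

@[simp] theorem State.tick_nat (σ : State) : σ.tick.nat = σ.nat := rfl
@[simp] theorem State.tick_real (σ : State) : σ.tick.real = σ.real := rfl
@[simp] theorem State.tick_queries (σ : State) : σ.tick.queries = σ.queries := rfl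
@[simp] theorem State.tick_steps (σ : State) : σ.tick.steps = σ.steps + 1 := rfl
@[simp] theorem State.tickQuery_nat (σ : State) : σ.tickQuery.nat = σ.nat := rfl
@[simp] theorem State.tickQuery_real (σ : State) : σ.tickQuery.real = σ.real := rfl
@[simp] theorem State.tickQuery_queries (σ : State) :
    σ.tickQuery.queries = σ.queries + 1 := rfl
@[simp] theorem State.writeNat_nat (a i x : ℕ) (σ : State) (b j : ℕ) :
    (σ.writeNat a i x).nat b j = if b = a ∧ j = i then x else σ.nat b j := rfl
@[simp] theorem State.writeNat_real (a i x : ℕ) (σ : State) :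
    (σ.writeNat a i x).real = σ.real := rfl
@[simp] theorem State.writeNat_queries (a i x : ℕ) (σ : State) :
    (σ.writeNat a i x).queries = σ.queries := rfl
@[simp] theorem State.writeReal_nat (a i : ℕ) (x : ℝ) (σ : State) :
    (σ.writeReal a i x).nat = σ.nat := rfl
@[simp] theorem State.writeReal_real (a i : ℕ) (x : ℝ) (σ : State) (b j : ℕ) :
    (σ.writeReal a i x).real b j = if b = a ∧ j = i then x else σ.real b j := rfl
@[simp] theorem State.writeReal_queries (a i : ℕ) (x : ℝ) (σ : State) :
    (σ.writeReal a i x).queries = σ.queries := rfl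

/-- `Q` holds in every state that `p` can reach from `σ`. -/
def Prog.wp (o : ℕ → ℕ → ℝ) (p : Prog) (Q : State → Prop) (σ : State) : Prop :=
  ∀ σ' ∈ (p.run o σ).support, Q σ'

section

variable {o : ℕ → ℕ → ℝ} {Q R : State → Prop} {σ : State}

theorem Prog.wp.mono {p : Prog} (h : p.wp o Q σ) (hQR : ∀ σ', Q σ' → R σ') : p.wp o R σ :=
  fun σ' hσ' => hQR σ' (h σ' hσ')

theorem Prog.wp.and {p : Prog} (h : p.wp o Q σ) (h' : p.wp o R σ) :
    p.wp o (fun σ' => Q σ' ∧ R σ') σ :=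
  fun σ' hσ' => ⟨h σ' hσ', h' σ' hσ'⟩

theorem wp_skip : Prog.skip.wp o Q σ ↔ Q σ.tick := by
  simp [Prog.wp, Prog.run, PMF.support_pure]

theorem wp_setNat {a : ℕ} {i x : NExp} :
    (Prog.setNat a i x).wp o Q σ ↔ Q (σ.writeNat a (i.eval σ) (x.eval σ)).tick := by
  simp [Prog.wp, Prog.run, PMF.support_pure]

theorem wp_setReal {a : ℕ} {i : NExp} {x : RExp} :
    (Prog.setReal a i x).wp o Q σ ↔ Q (σ.writeReal a (i.eval σ) (x.eval σ)).tick := by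
  simp [Prog.wp, Prog.run, PMF.support_pure]

theorem wp_query {a : ℕ} {i u v : NExp} :
    (Prog.query a i u v).wp o Q σ ↔
      Q (σ.writeReal a (i.eval σ) (o (u.eval σ) (v.eval σ))).tickQuery.tick := by
  simp [Prog.wp, Prog.run, PMF.support_pure]

/-- The definition of `Prog.run` coerces the random element of `Fin` to `ℕ` by a map of its own;
here the two maps are composed. -/
theorem run_rand (o : ℕ → ℕ → ℝ) (a : ℕ) (i x : NExp) (σ : State) :
    (Prog.rand a i x).run o σ =
      PMF.map (fun r : Fin (x.eval σ + 1) => (σ.writeNat a (i.eval σ) r).tick)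
        (PMF.uniformOfFintype (Fin (x.eval σ + 1))) :=
  PMF.map_comp (fun r : Fin (x.eval σ + 1) => (r : ℕ)) _ _

theorem wp_rand {a : ℕ} {i x : NExp} :
    (Prog.rand a i x).wp o Q σ ↔
      ∀ r ≤ x.eval σ, Q (σ.writeNat a (i.eval σ) r).tick := by
  simp only [Prog.wp, run_rand, PMF.support_map, PMF.support_uniformOfFintype]
  constructor
  · intro h r hr
    exact h _ ⟨⟨r, Nat.lt_succ_of_le hr⟩, trivial, rfl⟩
  · rintro h _ ⟨r, -, rfl⟩
    exact h r (Nat.le_of_lt_succ r.2)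

theorem wp_seq {p q : Prog} : (Prog.seq p q).wp o Q σ ↔ p.wp o (fun σ' => q.wp o Q σ') σ := by
  simp only [Prog.wp, Prog.run, PMF.mem_support_bind_iff]
  grind

theorem wp_ite {b : BExp} {p q : Prog} : (Prog.ite b p q).wp o Q σ ↔
    (b.eval σ → p.wp o Q σ.tick) ∧ (¬ b.eval σ → q.wp o Q σ.tick) := by
  simp only [Prog.wp, Prog.run]
  by_cases h : b.eval σ <;> simp [h]

theorem iterate_invariant {f : State → PMF State} (I : ℕ → State → Prop) (m : ℕ) :
    ∀ (j : ℕ) (σ : State), I j σ →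
    (∀ i < j + m, j ≤ i → ∀ σ', I i σ' → ∀ σ'' ∈ (f σ'.tick).support, I (i + 1) σ'') →
    ∀ σ' ∈ (iterate f m σ).support, I (j + m) σ' := by
  induction m with
  | zero =>
    intro j σ h _ σ' hσ'
    simp only [iterate, PMF.support_pure, Set.mem_singleton_iff] at hσ'
    rw [hσ']; exact h
  | succ m ih =>
    intro j σ h hs σ' hσ'
    simp only [iterate, PMF.mem_support_bind_iff] at hσ'
    obtain ⟨σ1, h1, h2⟩ := hσ'
    have := ih (j + 1) σ1 (hs j (by omega) le_rfl σ h σ1 h1)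
      (fun i hi hji => hs i (by omega) (by omega)) σ' h2
    rwa [show j + 1 + m = j + (m + 1) by omega] at this

theorem wp_loop {x : NExp} {p : Prog} (I : ℕ → State → Prop) (h0 : I 0 σ.tick)
    (hs : ∀ i < x.eval σ, ∀ σ', I i σ' → p.wp o (I (i + 1)) σ'.tick)
    (hQ : ∀ σ', I (x.eval σ) σ' → Q σ') : (Prog.loop x p).wp o Q σ := by
  intro σ' hσ'
  have := iterate_invariant I (x.eval σ) 0 σ.tick h0
    (fun i hi _ σ' h => hs i (by omega) σ' h) σ' hσ'
  rw [zero_add] at this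
  exact hQ σ' this

/-- The integer arrays that the program may write. -/
def Prog.natWrites : Prog → Finset ℕ
  | .setNat a _ _ => {a}
  | .rand a _ _ => {a}
  | .seq p q => p.natWrites ∪ q.natWrites
  | .ite _ p q => p.natWrites ∪ q.natWrites
  | .loop _ p => p.natWrites
  | _ => ∅

/-- The real arrays that the program may write. -/
def Prog.realWrites : Prog → Finset ℕ
  | .setReal a _ _ => {a}
  | .query a _ _ _ => {a}
  | .seq p q => p.realWrites ∪ q.realWrites
  | .ite _ p q => p.realWrites ∪ q.realWrites
  | .loop _ p => p.realWrites
  | _ => ∅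

/-- The program contains no query. -/
def Prog.QueryFree : Prog → Prop
  | .query _ _ _ _ => False
  | .seq p q => p.QueryFree ∧ q.QueryFree
  | .ite _ p q => p.QueryFree ∧ q.QueryFree
  | .loop _ p => p.QueryFree
  | _ => True

/-- The states agree on all arrays that `p` does not write. -/
def Prog.Same (p : Prog) (σ σ' : State) : Prop :=
  (∀ a ∉ p.natWrites, σ'.nat a = σ.nat a) ∧ ∀ a ∉ p.realWrites, σ'.real a = σ.real a

theorem iterate_rel {f : State → PMF State} {R : State → State → Prop} (hr : ∀ σ, R σ σ)
    (ht : ∀ σ σ' σ'', R σ σ' → R σ' σ'' → R σ σ'')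
    (hf : ∀ σ, ∀ σ' ∈ (f σ.tick).support, R σ σ') (m : ℕ) (σ : State) :
    ∀ σ' ∈ (iterate f m σ).support, R σ σ' :=
  iterate_invariant (fun _ => R σ) m 0 σ (hr σ) fun _ _ _ σ' h σ'' h' =>
    ht _ _ _ h (hf σ' σ'' h')

/-- The frame rule: each specification needs to mention only what its program changes, and
everything else is carried over by `Prog.Same`. -/
theorem wp_same (p : Prog) : ∀ σ, p.wp o (p.Same σ) σ := by
  induction p with
  | skip => intro σ; rw [wp_skip]; exact ⟨fun _ _ => rfl, fun _ _ => rfl⟩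
  | setNat a i x =>
    intro σ; rw [wp_setNat]
    refine ⟨fun b hb => ?_, fun _ _ => rfl⟩
    have hb : b ≠ a := fun h => hb (by simp [Prog.natWrites, h])
    funext j; simp [hb]
  | setReal a i x =>
    intro σ; rw [wp_setReal]
    refine ⟨fun _ _ => rfl, fun b hb => ?_⟩
    have hb : b ≠ a := fun h => hb (by simp [Prog.realWrites, h])
    funext j; simp [hb]
  | rand a i x =>
    intro σ; rw [wp_rand]
    intro r _
    refine ⟨fun b hb => ?_, fun _ _ => rfl⟩
    have hb : b ≠ a := fun h => hb (by simp [Prog.natWrites, h])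
    funext j; simp [hb]
  | query a i u v =>
    intro σ; rw [wp_query]
    refine ⟨fun _ _ => rfl, fun b hb => ?_⟩
    have hb : b ≠ a := fun h => hb (by simp [Prog.realWrites, h])
    funext j; simp [hb]
  | seq p q ihp ihq =>
    intro σ; rw [wp_seq]
    refine (ihp σ).mono fun σ' h => (ihq σ').mono fun σ'' h' => ?_
    simp only [Prog.Same, Prog.natWrites, Prog.realWrites, Finset.mem_union, not_or] at *
    exact ⟨fun a ha => (h'.1 a ha.2).trans (h.1 a ha.1),
      fun a ha => (h'.2 a ha.2).trans (h.2 a ha.1)⟩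
  | ite b p q ihp ihq =>
    intro σ; rw [wp_ite]
    constructor
    · refine fun _ => (ihp σ.tick).mono fun σ'' h' => ?_
      simp only [Prog.Same, Prog.natWrites, Prog.realWrites, Finset.mem_union, not_or] at *
      exact ⟨fun a ha => h'.1 a ha.1, fun a ha => h'.2 a ha.1⟩
    · refine fun _ => (ihq σ.tick).mono fun σ'' h' => ?_
      simp only [Prog.Same, Prog.natWrites, Prog.realWrites, Finset.mem_union, not_or] at *
      exact ⟨fun a ha => h'.1 a ha.2, fun a ha => h'.2 a ha.2⟩
  | loop x p ih =>
    intro σ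
    exact iterate_rel (R := p.Same) (fun _ => ⟨fun _ _ => rfl, fun _ _ => rfl⟩)
      (fun _ _ _ h h' => ⟨fun a ha => (h'.1 a ha).trans (h.1 a ha),
        fun a ha => (h'.2 a ha).trans (h.2 a ha)⟩) (fun σ => ih σ.tick) _ σ.tick

theorem wp_queryFree (p : Prog) : p.QueryFree → ∀ σ, p.wp o (fun σ' => σ'.queries = σ.queries) σ := by
  induction p with
  | skip => intro _ σ; rw [wp_skip]; rfl
  | setNat a i x => intro _ σ; rw [wp_setNat]; rfl
  | setReal a i x => intro _ σ; rw [wp_setReal]; rfl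
  | rand a i x => intro _ σ; rw [wp_rand]; exact fun _ _ => rfl
  | query a i u v => intro h; exact h.elim
  | seq p q ihp ihq =>
    intro h σ; rw [wp_seq]
    exact (ihp h.1 σ).mono fun σ' e => (ihq h.2 σ').mono fun σ'' e' => e'.trans e
  | ite b p q ihp ihq =>
    intro h σ; rw [wp_ite]
    exact ⟨fun _ => ihp h.1 σ.tick, fun _ => ihq h.2 σ.tick⟩
  | loop x p ih =>
    intro h σ
    exact iterate_rel (R := fun σ σ' => σ'.queries = σ.queries) (fun _ => rfl)
      (fun _ _ _ h h' => h'.trans h) (fun σ => ih h σ.tick) _ σ.tick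

/-! ### Step counting -/

/-- All loop bounds in `p` are cells `0` of integer arrays in `V`, and `p` does not write the
arrays in `V`. -/
def Prog.Bounded (V : Finset ℕ) : Prog → Prop
  | .setNat a _ _ => a ∉ V
  | .rand a _ _ => a ∉ V
  | .seq p q => p.Bounded V ∧ q.Bounded V
  | .ite _ p q => p.Bounded V ∧ q.Bounded V
  | .loop x p => (∃ a ∈ V, x = .get a (.lit 0)) ∧ p.Bounded V
  | _ => True

/-- A bound for the number of steps if all loop bounds are at most `M`. -/
def Prog.runtime (M : ℕ) : Prog → ℕ
  | .seq p q => p.runtime M + q.runtime M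
  | .ite _ p q => 1 + p.runtime M + q.runtime M
  | .loop _ p => 1 + M * (1 + p.runtime M)
  | _ => 1

theorem Prog.Bounded.disjoint {V : Finset ℕ} {p : Prog} (h : p.Bounded V) :
    ∀ a ∈ V, a ∉ p.natWrites := by
  induction p with
  | skip => simp [natWrites]
  | setNat b i x =>
    intro a ha hb
    simp only [natWrites, Finset.mem_singleton] at hb
    exact h (hb ▸ ha)
  | setReal b i x => simp [natWrites]
  | rand b i x =>
    intro a ha hb
    simp only [natWrites, Finset.mem_singleton] at hb
    exact h (hb ▸ ha)
  | query b i u v => simp [natWrites]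
  | seq p q ihp ihq =>
    intro a ha
    simp only [natWrites, Finset.mem_union, not_or]
    exact ⟨ihp h.1 a ha, ihq h.2 a ha⟩
  | ite b p q ihp ihq =>
    intro a ha
    simp only [natWrites, Finset.mem_union, not_or]
    exact ⟨ihp h.1 a ha, ihq h.2 a ha⟩
  | loop x p ih => exact ih h.2

/-- The cells that serve as loop bounds are never written by `p`, so the bound `M` on them at the
start remains valid. A program that computes its own loop bounds has to be cut into phases. -/
theorem wp_steps {V : Finset ℕ} {M : ℕ} (p : Prog) : p.Bounded V → ∀ σ,
    (∀ a ∈ V, σ.nat a 0 ≤ M) → p.wp o (fun σ' => σ'.steps ≤ σ.steps + p.runtime M) σ := by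
  induction p with
  | skip => intro _ σ _; rw [wp_skip]; exact le_rfl
  | setNat a i x => intro _ σ _; rw [wp_setNat]; exact le_rfl
  | setReal a i x => intro _ σ _; rw [wp_setReal]; exact le_rfl
  | rand a i x => intro _ σ _; rw [wp_rand]; exact fun _ _ => le_rfl
  | query a i u v => intro _ σ _; rw [wp_query]; exact le_rfl
  | seq p q ihp ihq =>
    intro h σ hM; rw [wp_seq]
    refine ((ihp h.1 σ hM).and (wp_same p σ)).mono fun σ' e => ?_
    refine (ihq h.2 σ' fun a ha => ?_).mono fun σ'' e' => ?_
    · rw [e.2.1 a (h.1.disjoint a ha)]; exact hM a ha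
    · simp only [Prog.runtime]
      have := e.1
      omega
  | ite b p q ihp ihq =>
    intro h σ hM; rw [wp_ite]
    simp only [Prog.runtime]
    constructor
    · refine fun _ => (ihp h.1 σ.tick hM).mono fun σ' e => ?_
      rw [State.tick_steps] at e; omega
    · refine fun _ => (ihq h.2 σ.tick hM).mono fun σ' e => ?_
      rw [State.tick_steps] at e; omega
  | loop x p ih =>
    intro h σ hM
    obtain ⟨⟨a, ha, rfl⟩, hp⟩ := h
    have hx : (NExp.get a (.lit 0)).eval σ ≤ M := hM a ha
    refine wp_loop (fun i σ' => σ'.steps ≤ σ.steps + 1 + i * (1 + p.runtime M) ∧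
      ∀ a ∈ V, σ'.nat a 0 ≤ M) ⟨by simp, hM⟩ ?_ ?_
    · rintro i - σ' ⟨h1, h2⟩
      refine ((ih hp σ'.tick h2).and (wp_same p σ'.tick)).mono fun σ'' e => ⟨?_, ?_⟩
      · have := e.1
        rw [State.tick_steps] at this
        rw [add_mul]; omega
      · intro a ha
        rw [e.2.1 a (hp.disjoint a ha)]; exact h2 a ha
    · rintro σ' ⟨h1, -⟩
      refine h1.trans ?_
      simp only [Prog.runtime]
      have : (NExp.get a (.lit 0)).eval σ * (1 + p.runtime M) ≤ M * (1 + p.runtime M) :=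
        Nat.mul_le_mul_right _ hx
      omega

/-- One number serves as coefficient and as exponent, so that bounds for subprograms are combined by
simply enlarging it. -/
theorem runtime_le (p : Prog) : ∃ C : ℕ, ∀ M, 1 ≤ M → p.runtime M ≤ C * M ^ C := by
  have mono : ∀ {C C' M : ℕ}, C ≤ C' → 1 ≤ M → C * M ^ C ≤ C' * M ^ C' := fun h hM =>
    Nat.mul_le_mul h (Nat.pow_le_pow_right hM h)
  have one : ∀ M : ℕ, 1 ≤ M → 1 ≤ 1 * M ^ 1 := fun M hM => by simpa using hM
  induction p with
  | skip => exact ⟨1, one⟩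
  | setNat a i x => exact ⟨1, one⟩
  | setReal a i x => exact ⟨1, one⟩
  | rand a i x => exact ⟨1, one⟩
  | query a i u v => exact ⟨1, one⟩
  | seq p q ihp ihq =>
    obtain ⟨C, hC⟩ := ihp
    obtain ⟨C', hC'⟩ := ihq
    refine ⟨C + C', fun M hM => ?_⟩
    refine (Nat.add_le_add (hC M hM) (hC' M hM)).trans ?_
    rw [add_mul]
    gcongr <;> omega
  | ite b p q ihp ihq =>
    obtain ⟨C, hC⟩ := ihp
    obtain ⟨C', hC'⟩ := ihq
    refine ⟨1 + C + C', fun M hM => ?_⟩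
    refine (Nat.add_le_add (Nat.add_le_add le_rfl (hC M hM)) (hC' M hM)).trans ?_
    rw [add_mul, add_mul]
    have : 1 ≤ 1 * M ^ (1 + C + C') := by rw [one_mul]; exact Nat.one_le_pow _ _ hM
    gcongr <;> omega
  | loop x p ih =>
    obtain ⟨C, hC⟩ := ih
    refine ⟨C + 2, fun M hM => ?_⟩
    have h1 : 1 ≤ M ^ C := Nat.one_le_pow _ _ hM
    have h2 : 1 ≤ M ^ (C + 2) := Nat.one_le_pow _ _ hM
    have h3 : M ^ (C + 1) ≤ M ^ (C + 2) := Nat.pow_le_pow_right hM (by omega)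
    calc 1 + M * (1 + p.runtime M) ≤ M ^ (C + 2) + M * (M ^ C + C * M ^ C) := by
          gcongr
          exact hC M hM
      _ = M ^ (C + 2) + (C + 1) * M ^ (C + 1) := by ring
      _ ≤ M ^ (C + 2) + (C + 1) * M ^ (C + 2) := by gcongr
      _ = (C + 2) * M ^ (C + 2) := by ring

/-- The content of cell `0` of an integer array. -/
abbrev NExp.var (a : ℕ) : NExp := .get a (.lit 0)

/-- Increment cell `0` of an integer array. -/
abbrev Prog.inc (a : ℕ) : Prog := .setNat a (.lit 0) (.add (.var a) (.lit 1))

/-- Run `p` for all values of cell `0` of array `c` that are smaller than cell `0` of array `a`. -/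
abbrev Prog.for (c a : ℕ) (p : Prog) : Prog :=
  .seq (.setNat c (.lit 0) (.lit 0)) (.loop (.var a) (.seq p (.inc c)))

/-- The invariant must survive writes to cell 0 of the counter array. In return the body may assume
the value of the counter and that all arrays not written by the loop are as before the loop. -/
theorem wp_for {c a : ℕ} {p : Prog} (I : ℕ → State → Prop) (hca : c ≠ a)
    (hc : c ∉ p.natWrites)
    (hI : ∀ i σ v, I i σ → I i (σ.writeNat c 0 v).tick) (htick : ∀ i σ, I i σ → I i σ.tick)
    (h0 : I 0 σ)
    (hs : ∀ i < σ.nat a 0, ∀ σ', σ'.nat c 0 = i → (Prog.for c a p).Same σ σ' → I i σ' →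
      p.wp o (I (i + 1)) σ')
    (hQ : ∀ σ', (Prog.for c a p).Same σ σ' → I (σ.nat a 0) σ' → Q σ') :
    (Prog.for c a p).wp o Q σ := by
  rw [wp_seq, wp_setNat]
  have hval : (NExp.var a).eval
      (σ.writeNat c ((NExp.lit 0).eval σ) ((NExp.lit 0).eval σ)).tick = σ.nat a 0 := by
    simp [NExp.eval, hca.symm]
  have hsub : ∀ b, b ∉ (Prog.for c a p).natWrites → b ≠ c ∧ b ∉ p.natWrites := by
    intro b hb
    simp only [Prog.natWrites, Finset.mem_union, Finset.mem_singleton, not_or] at hb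
    exact ⟨hb.1, hb.2.1⟩
  have hsubr : ∀ b, b ∉ (Prog.for c a p).realWrites → b ∉ p.realWrites := by
    intro b hb
    simp only [Prog.realWrites, Finset.mem_union, not_or] at hb
    exact hb.2.1
  refine wp_loop (fun i σ' => σ'.nat c 0 = i ∧ (Prog.for c a p).Same σ σ' ∧ I i σ') ?_ ?_ ?_
  · refine ⟨by simp [NExp.eval], ⟨fun b hb => ?_, fun _ _ => rfl⟩, ?_⟩
    · funext j; simp [(hsub b hb).1]
    · exact htick _ _ (hI _ _ _ h0)
  · rintro i hi σ' ⟨h1, h2, h3⟩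
    rw [hval] at hi
    rw [wp_seq]
    refine ((hs i hi σ'.tick h1 h2 (htick _ _ h3)).and (wp_same p σ'.tick)).mono ?_
    rintro σ'' ⟨h4, h5⟩
    have h6 : σ''.nat c 0 = i := by rw [h5.1 c hc]; exact h1
    rw [wp_setNat]
    refine ⟨by simp [NExp.eval, h6], ⟨fun b hb => ?_, fun b hb => ?_⟩, hI _ _ _ h4⟩
    · funext j
      simp only [State.tick_nat, State.writeNat_nat, (hsub b hb).1, false_and, if_false]
      rw [h5.1 b (hsub b hb).2]
      exact congrFun (h2.1 b hb) j
    · exact (h5.2 b (hsubr b hb)).trans (h2.2 b hb)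
  · rintro σ' ⟨-, h2, h3⟩
    rw [hval] at h3
    exact hQ σ' h2 h3

end

/-! ### The algorithm -/

/-- Real cell `0` of array `2` becomes the number `k` of terminals. -/
def countTerminals : Prog :=
  .loop (.var 1) (.setReal 2 (.lit 0) (.add (.get 2 (.lit 0)) (.lit 1)))

/-- Integer cell `0` of array `10` becomes the least `s` with `k ≤ s * α`. -/
def countBlocks : Prog :=
  .loop (.var 1) (.ite (.realLt (.get 3 (.lit 0)) (.get 2 (.lit 0)))
    (.seq (.setReal 3 (.lit 0) (.add (.get 3 (.lit 0)) (.get 0 (.lit 0)))) (.inc 10)) .skip)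

/-- Integer cell `0` of array `12` becomes the least `L` with `n < 2 ^ L`. -/
def countBits : Prog :=
  .seq (.setNat 11 (.lit 0) (.lit 1))
    (.loop (.var 0) (.ite (.natLt (.var 11) (.add (.var 0) (.lit 1)))
      (.seq (.setNat 11 (.lit 0) (.add (.var 11) (.var 11))) (.inc 12)) .skip))

/-- Compute the number of samples (integer array `13`) and the number of sampled terminals all of
whose distances are queried (integer array `14`). -/
def countSamples (c : ℕ) : Prog :=
  .seq (.loop (.var 10) (.loop (.var 12) (.setNat 13 (.lit 0) (.add (.var 13) (.lit c)))))
    (.ite (.realLt (.add (.get 2 (.lit 0)) (.get 2 (.lit 0))) (.get 0 (.lit 0)))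
      (.setNat 13 (.lit 0) (.lit 1)) (.setNat 14 (.lit 0) (.var 13)))

/-- Mark the first terminal as visited, and compute the number of tree edges. -/
def initTree : Prog :=
  .seq (.setNat 7 (.lit 0) (.lit 1)) (.setNat 25 (.lit 0) (.sub (.var 1) (.lit 1)))

/-- Fill integer array `6` with indices of random terminals. -/
def drawSamples : Prog :=
  .loop (.var 13) (.seq (.rand 6 (.var 15) (.sub (.var 1) (.lit 1))) (.inc 15))

/-- Query the distances between the sampled terminals and all terminals. The row of the `q`-th
sample starts at the cell of real array `1` stored in the `q`-th cell of integer array `9`. -/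
def queryTable : Prog :=
  .for 17 14 (.seq (.setNat 9 (.var 17) (.var 16))
    (.for 18 1 (.seq (.query 1 (.var 16) (.get 2 (.get 6 (.var 17))) (.get 2 (.var 18)))
      (.inc 16))))

/-- Entry of the table for the sample in array `21` and the terminal in array `a`. -/
def tableEntry (a : ℕ) : RExp := .get 1 (.add (.get 9 (.var 21)) (.var a))

/-- Length of the connection of two terminals via a sampled terminal. -/
def detour : RExp := .add (tableEntry 19) (tableEntry 20)

/-- Compare the connection of terminal `19` to terminal `20` via sample `21` with the best one. -/
def scanStep : Prog :=
  .ite (.and (.and (.natLt (.lit 0) (.get 7 (.var 19))) (.not (.natLt (.lit 0) (.get 7 (.var 20)))))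
      (.not (.and (.natLt (.lit 0) (.var 22)) (.not (.realLt detour (.get 4 (.lit 0)))))))
    (.seq (.setNat 22 (.lit 0) (.lit 1)) (.seq (.setNat 23 (.lit 0) (.var 19))
      (.seq (.setNat 24 (.lit 0) (.var 20)) (.setReal 4 (.lit 0) detour)))) .skip

/-- Find the cheapest connection from a visited terminal to a terminal that is not visited. -/
def scan : Prog :=
  .seq (.setNat 22 (.lit 0) (.lit 0)) (.for 19 1 (.for 20 1 (.for 21 13 scanStep)))

/-- Add the connection found to the tree, and record it in the arrays `26`, `27` and `5`. -/
def addEdge : Prog :=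
  .seq (.setNat 26 (.var 3) (.var 23)) (.seq (.setNat 27 (.var 3) (.var 24))
    (.seq (.setReal 5 (.var 3) (.get 4 (.lit 0)))
      (.seq (.setNat 4 (.var 3) (.get 2 (.var 23))) (.seq (.setNat 5 (.var 3) (.get 2 (.var 24)))
        (.seq (.setNat 7 (.var 24) (.lit 1)) (.inc 3))))))

/-- Prim's algorithm for the lengths of the detours via sampled terminals. -/
def growTree : Prog := .loop (.var 25) (.seq scan addEdge)

/-- Compute the numbers that determine the number of samples. -/
def setup : Prog := .seq countTerminals (.seq countBlocks countBits)
/-- Compute the number of samples, and initialize the tree. -/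
def setup' (c : ℕ) : Prog := .seq (countSamples c) initTree
/-- Query the table of distances and compute the tree. -/
def buildTree : Prog := .seq queryTable growTree

/-- The algorithm; `c` controls the number of samples. -/
def steinerProg (c : ℕ) : Prog :=
  .seq (.seq setup (setup' c)) (.seq drawSamples buildTree)

/-! ### Specifications of the setup and of the sampling -/

section

variable {o : ℕ → ℕ → ℝ} {σ : State}

theorem wp_countTerminals :
    countTerminals.wp o (fun σ' => σ'.real 2 0 = σ.real 2 0 + σ.nat 1 0) σ := by
  refine wp_loop (fun i σ' => σ'.real 2 0 = σ.real 2 0 + i) (by simp) ?_ (fun σ' h => h)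
  intro i _ σ' h
  rw [wp_setReal]
  simp [NExp.eval, RExp.eval, h]
  ring

/-- Adding α repeatedly until the total reaches k yields ⌈k/α⌉ without division; k rounds suffice
because α ≥ 1. -/
theorem wp_countBlocks (hα : 1 ≤ σ.real 0 0) (hk : σ.real 2 0 = σ.nat 1 0)
    (hk1 : 1 ≤ σ.nat 1 0)
    (h3 : σ.real 3 0 = 0) (h10 : σ.nat 10 0 = 0) :
    countBlocks.wp o (fun σ' => σ'.nat 10 0 ≤ σ.nat 1 0 ∧ 1 ≤ σ'.nat 10 0 ∧
      (σ.nat 1 0 : ℝ) ≤ σ'.nat 10 0 * σ.real 0 0 ∧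
      (σ'.nat 10 0 - 1) * σ.real 0 0 < σ.nat 1 0) σ := by
  have hk1' : (1 : ℝ) ≤ σ.nat 1 0 := by exact_mod_cast hk1
  refine wp_loop (fun i σ' => σ'.real 0 0 = σ.real 0 0 ∧ σ'.real 2 0 = σ.real 2 0 ∧
    σ'.real 3 0 = σ'.nat 10 0 * σ.real 0 0 ∧ σ'.nat 10 0 ≤ i ∧
    (σ.real 2 0 ≤ σ'.real 3 0 ∨ σ'.nat 10 0 = i) ∧
    (σ'.nat 10 0 - 1) * σ.real 0 0 < σ.real 2 0) ?_ ?_ ?_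
  · refine ⟨rfl, rfl, by simp [h3, h10], by simp [h10], Or.inr (by simp [h10]), ?_⟩
    simp only [State.tick_nat, h10, hk]
    push_cast
    linarith
  · rintro i - σ' ⟨h0, h2, h3, h4, h5, h6⟩
    rw [wp_ite]
    simp only [BExp.eval, RExp.eval, NExp.eval, State.tick_real]
    constructor
    · intro hlt
      have hi : σ'.nat 10 0 = i := h5.resolve_left (by rw [← h2]; exact not_le.2 hlt)
      rw [wp_seq, wp_setReal, wp_setNat]
      simp only [NExp.eval, RExp.eval, State.tick_real, State.tick_nat, State.writeReal_real,
        State.writeReal_nat, State.writeNat_nat, State.writeNat_real]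
      refine ⟨by simpa using h0, by simpa using h2, ?_, ?_, ?_, ?_⟩
      · simp [h3, h0]; ring
      · simp [hi]
      · exact Or.inr (by simp [hi])
      · simp only [and_self, if_true]
        push_cast
        rw [h2, h3] at hlt
        linarith
    · intro hlt
      rw [wp_skip]
      refine ⟨h0, h2, h3, by simp; omega, Or.inl ?_, h6⟩
      simp only [State.tick_real]
      rw [← h2]
      exact not_lt.1 hlt
  · rintro σ' ⟨h0, h2, h3, h4, h5, h6⟩
    simp only [NExp.eval] at h4 h5
    have hle : (σ.nat 1 0 : ℝ) ≤ σ'.nat 10 0 * σ.real 0 0 := by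
      rcases h5 with h5 | h5
      · rw [← hk, ← h3]; exact h5
      · rw [h5]; nlinarith
    refine ⟨h4, ?_, hle, by rw [← hk]; exact h6⟩
    by_contra h
    have h0 : σ'.nat 10 0 = 0 := by omega
    rw [h0] at hle
    push_cast at hle
    linarith

/-- Doubling from 1 passes n within n rounds, since n < 2^n; the last doubling started from a value
at most n, which gives the upper estimate. -/
theorem wp_countBits (hn : 1 ≤ σ.nat 0 0) (h12 : σ.nat 12 0 = 0) :
    countBits.wp o (fun σ' => σ'.nat 12 0 ≤ σ.nat 0 0 ∧ 1 ≤ σ'.nat 12 0 ∧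
      σ.nat 0 0 < 2 ^ (σ'.nat 12 0) ∧ 2 ^ (σ'.nat 12 0) ≤ 2 * σ.nat 0 0) σ := by
  rw [countBits, wp_seq, wp_setNat]
  have hx : (NExp.var 0).eval (σ.writeNat 11 ((NExp.lit 0).eval σ) ((NExp.lit 1).eval σ)).tick =
      σ.nat 0 0 := by simp [NExp.eval]
  refine wp_loop (fun i σ' => σ'.nat 0 0 = σ.nat 0 0 ∧ σ'.nat 11 0 = 2 ^ (σ'.nat 12 0) ∧
    σ'.nat 12 0 ≤ i ∧ (σ.nat 0 0 < σ'.nat 11 0 ∨ σ'.nat 12 0 = i) ∧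
    σ'.nat 11 0 ≤ 2 * σ.nat 0 0) ?_ ?_ ?_
  · simp [NExp.eval, h12]
    omega
  · rintro i - σ' ⟨h0, h1, h2, h3, h4⟩
    rw [wp_ite]
    simp only [BExp.eval, NExp.eval, State.tick_nat]
    constructor
    · intro hlt
      rw [h0] at hlt
      have hi : σ'.nat 12 0 = i := h3.resolve_left (by omega)
      rw [wp_seq, wp_setNat, wp_setNat]
      simp only [NExp.eval, State.tick_nat, State.writeNat_nat]
      refine ⟨by simpa using h0, ?_, ?_, Or.inr (by simp [hi]), ?_⟩
      · simp [h1]; ring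
      · simp [hi]
      · simp; omega
    · intro hlt
      rw [wp_skip]
      simp only [State.tick_nat]
      rw [h0] at hlt
      exact ⟨h0, h1, by omega, Or.inl (by omega), h4⟩
  · rintro σ' ⟨h0, h1, h2, h3, h4⟩
    rw [hx] at h2 h3
    rw [← h1]
    have hlt : σ.nat 0 0 < σ'.nat 11 0 := by
      rcases h3 with h3 | h3
      · exact h3
      · rw [h1, h3]; exact Nat.lt_two_pow_self
    refine ⟨h2, ?_, hlt, h4⟩
    by_contra h
    rw [h1, show σ'.nat 12 0 = 0 by omega] at hlt
    omega

-- The nested loops replace multiplication. For α > 2k no row is queried, but one nominal sample is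
-- kept so that the scan finds some candidate; the contents of its table row are irrelevant.
open Classical in
theorem wp_countSamples (c : ℕ) (h13 : σ.nat 13 0 = 0) (h14 : σ.nat 14 0 = 0) :
    (countSamples c).wp o (fun σ' =>
      if σ.real 2 0 + σ.real 2 0 < σ.real 0 0 then σ'.nat 13 0 = 1 ∧ σ'.nat 14 0 = 0
      else σ'.nat 13 0 = σ.nat 10 0 * (σ.nat 12 0 * c) ∧
        σ'.nat 14 0 = σ.nat 10 0 * (σ.nat 12 0 * c)) σ := by
  rw [countSamples, wp_seq]
  have h : (Prog.loop (.var 10) (.loop (.var 12)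
      (.setNat 13 (.lit 0) (.add (.var 13) (.lit c))))).wp o
      (fun σ' => σ'.nat 13 0 = σ.nat 10 0 * (σ.nat 12 0 * c)) σ := by
    refine wp_loop (fun i σ' => σ'.nat 13 0 = i * (σ.nat 12 0 * c) ∧ σ'.nat 12 = σ.nat 12)
      (by simp [h13]) ?_ (fun σ' h => h.1)
    rintro i - σ' ⟨h1, h2⟩
    refine Prog.wp.and ?_ ((wp_same _ _).mono fun σ'' h3 =>
      (h3.1 12 (by simp [Prog.natWrites])).trans h2)
    refine wp_loop (fun j σ'' => σ''.nat 13 0 = i * (σ.nat 12 0 * c) + j * c) (by simp [h1]) ?_ ?_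
    · intro j _ σ'' h3
      rw [wp_setNat]
      simp [NExp.eval, h3]
      ring
    · intro σ'' h3
      rw [h3]
      simp [NExp.eval, h2]
      ring
  refine (h.and (wp_same _ σ)).mono ?_
  rintro σ' ⟨h1, h2⟩
  have h14' : σ'.nat 14 = σ.nat 14 := h2.1 14 (by simp [Prog.natWrites])
  have hr2 : σ'.real 2 = σ.real 2 := h2.2 2 (by simp [Prog.realWrites])
  have hr0 : σ'.real 0 = σ.real 0 := h2.2 0 (by simp [Prog.realWrites])
  rw [wp_ite]
  simp only [BExp.eval, RExp.eval, NExp.eval, hr2, hr0]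
  constructor
  · intro hlt
    rw [wp_setNat, if_pos hlt]
    simp [NExp.eval, h14', h14]
  · intro hlt
    rw [wp_setNat, if_neg hlt]
    simp [NExp.eval, h1]

theorem wp_initTree : initTree.wp o (fun σ' => σ'.nat 25 0 = σ.nat 1 0 - 1 ∧
    ∀ i, σ'.nat 7 i = if i = 0 then 1 else σ.nat 7 i) σ := by
  rw [initTree, wp_seq, wp_setNat, wp_setNat]
  simp [NExp.eval]

theorem wp_drawSamples (hk : 1 ≤ σ.nat 1 0) (h15 : σ.nat 15 0 = 0) :
    drawSamples.wp o (fun σ' => ∀ q < σ.nat 13 0, σ'.nat 6 q < σ.nat 1 0) σ := by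
  refine wp_loop (fun i σ' => σ'.nat 15 0 = i ∧ σ'.nat 1 0 = σ.nat 1 0 ∧
    ∀ q < i, σ'.nat 6 q < σ.nat 1 0) (by simp [h15]) ?_ (fun σ' h => h.2.2)
  rintro i - σ' ⟨h1, h2, h3⟩
  rw [wp_seq, wp_rand]
  intro r hr
  rw [wp_setNat]
  simp only [NExp.eval, State.tick_nat, h2] at hr
  simp only [NExp.eval, State.tick_nat, State.writeNat_nat, h1]
  refine ⟨by simp, by simp [h2], fun q hq => ?_⟩
  by_cases hqi : q = i
  · simp [hqi]; omega
  · simp [hqi]; exact h3 q (by omega)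

end

/-! ### Specifications of the distance table and of the scan -/

section

variable {o : ℕ → ℕ → ℝ} {σ : State}

theorem Prog.Same.refl (p : Prog) (σ : State) : p.Same σ σ := ⟨fun _ _ => rfl, fun _ _ => rfl⟩

theorem Prog.Same.trans {p : Prog} {σ σ' σ'' : State} (h : p.Same σ σ') (h' : p.Same σ' σ'') :
    p.Same σ σ'' :=
  ⟨fun a ha => (h'.1 a ha).trans (h.1 a ha), fun a ha => (h'.2 a ha).trans (h.2 a ha)⟩

theorem wp_loop_same {Q : State → Prop} {x : NExp} {p : Prog} (I : ℕ → State → Prop)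
    (h0 : I 0 σ.tick)
    (hs : ∀ i < x.eval σ, ∀ σ', p.Same σ σ' → I i σ' → p.wp o (I (i + 1)) σ'.tick)
    (hQ : ∀ σ', I (x.eval σ) σ' → Q σ') : (Prog.loop x p).wp o Q σ := by
  refine wp_loop (fun i σ' => p.Same σ σ' ∧ I i σ') ⟨Prog.Same.refl p σ, h0⟩ ?_
    (fun σ' h => hQ σ' h.2)
  rintro i hi σ' ⟨h1, h2⟩
  exact ((wp_same p σ'.tick).mono fun σ'' h => h1.trans h).and (hs i hi σ' h1 h2)

theorem wp_queryTable (h16 : σ.nat 16 0 = 0) :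
    queryTable.wp o (fun σ' => σ'.queries = σ.queries + σ.nat 14 0 * σ.nat 1 0 ∧
      ∀ q < σ.nat 14 0, ∀ j < σ.nat 1 0,
        σ'.real 1 (σ'.nat 9 q + j) = o (σ.nat 2 (σ.nat 6 q)) (σ.nat 2 j)) σ := by
  set k := σ.nat 1 0 with hk
  -- The table is filled row by row, with `k` entries per row. The row offsets are stored in array
  -- `9` because the machine cannot multiply.
  let F : ℕ → ℝ := fun x => o (σ.nat 2 (σ.nat 6 (x / k))) (σ.nat 2 (x % k))
  refine wp_for (fun i σ' => σ'.nat 16 0 = i * k ∧ σ'.queries = σ.queries + i * k ∧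
    (∀ q < i, σ'.nat 9 q = q * k) ∧ ∀ x < i * k, σ'.real 1 x = F x) (by decide)
    (by simp [Prog.natWrites]) (fun i σ v h => by simpa using h) (fun i σ h => h)
    (by simp [h16]) ?_ ?_
  · rintro i hi σ' h17 hsame ⟨h1, h2, h3, h4⟩
    have e1 : σ'.nat 1 = σ.nat 1 := hsame.1 1 (by simp [Prog.natWrites])
    have e2 : σ'.nat 2 = σ.nat 2 := hsame.1 2 (by simp [Prog.natWrites])
    have e6 : σ'.nat 6 = σ.nat 6 := hsame.1 6 (by simp [Prog.natWrites])
    rw [wp_seq, wp_setNat]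
    simp only [NExp.eval, h17, h1]
    refine wp_for (fun j σ'' => σ''.nat 16 0 = i * k + j ∧
      σ''.queries = σ.queries + (i * k + j) ∧ ∀ x < i * k + j, σ''.real 1 x = F x) (by decide)
      (by simp [Prog.natWrites]) (fun i σ v h => by simpa using h) (fun i σ h => h)
      (by simpa [h1, h2] using h4) ?_ ?_
    · rintro j hj σ'' h18 hsame' ⟨h5, h6, h7⟩
      have e1' : σ''.nat 2 = σ'.nat 2 := by
        rw [hsame'.1 2 (by simp [Prog.natWrites])]; funext x; simp
      have e2' : σ''.nat 6 = σ'.nat 6 := by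
        rw [hsame'.1 6 (by simp [Prog.natWrites])]; funext x; simp
      have e3' : σ''.nat 17 = σ'.nat 17 := by
        rw [hsame'.1 17 (by simp [Prog.natWrites])]; funext x; simp
      have hj' : j < k := by simpa [e1] using hj
      rw [wp_seq, wp_query, wp_setNat]
      simp only [NExp.eval, State.tick_nat, State.tickQuery_nat, State.writeReal_nat,
        State.writeNat_nat, State.tick_queries, State.writeNat_queries, State.tickQuery_queries,
        State.writeReal_queries, State.tick_real, State.writeNat_real, State.tickQuery_real,
        State.writeReal_real, e1', e2', e3', h17, h18, h5, h6, e2, e6]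
      refine ⟨by simp; omega, by omega, fun x hx => ?_⟩
      by_cases hxe : x = i * k + j
      · simp only [hxe, and_self, if_true, F]
        have hk0 : 0 < k := by omega
        rw [mul_comm i k, Nat.mul_add_div hk0, Nat.div_eq_of_lt hj', Nat.mul_add_mod,
          Nat.mod_eq_of_lt hj', add_zero]
      · simp only [hxe, and_false, if_false]
        exact h7 x (by omega)
    · rintro σ'' hsame' ⟨h5, h6, h7⟩
      have e9 := hsame'.1 9 (by simp [Prog.natWrites])
      have hkk : (State.writeNat 9 i (i * k) σ').tick.nat 1 0 = k := by simp [e1, hk]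
      rw [hkk] at h5 h6 h7
      rw [show i * k + k = (i + 1) * k by ring] at h5 h6 h7
      refine ⟨h5, h6, fun q hq => ?_, h7⟩
      rw [e9]
      by_cases hqi : q = i
      · simp [hqi]
      · simp [hqi]; exact h3 q (by omega)
  · rintro σ' - ⟨h1, h2, h3, h4⟩
    refine ⟨h2, fun q hq j hj => ?_⟩
    rw [h3 q hq, h4]
    · simp only [F]
      have hk0 : 0 < k := by omega
      rw [mul_comm q k, Nat.mul_add_div hk0, Nat.div_eq_of_lt hj, Nat.mul_add_mod,
          Nat.mod_eq_of_lt hj, add_zero]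
    · calc q * k + j < (q + 1) * k := by rw [add_mul]; omega
        _ ≤ _ := Nat.mul_le_mul_right _ hq

/-- The table of the distances between samples and terminals. -/
def State.table (σ : State) (q i : ℕ) : ℝ := σ.real 1 (σ.nat 9 q + i)

/-- Result of comparing the connections of `i` to `j` via `q` with `S i j q`. -/
def IsBest (σ : State) (S : ℕ → ℕ → ℕ → Prop) (σ' : State) : Prop :=
  (σ'.nat 22 0 = 0 ∧ ∀ i j q, S i j q → ¬ (0 < σ.nat 7 i ∧ ¬ 0 < σ.nat 7 j)) ∨
  (0 < σ'.nat 22 0 ∧ σ'.nat 23 0 < σ.nat 1 0 ∧ σ'.nat 24 0 < σ.nat 1 0 ∧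
    0 < σ.nat 7 (σ'.nat 23 0) ∧ ¬ 0 < σ.nat 7 (σ'.nat 24 0) ∧
    (∃ q < σ.nat 13 0, σ'.real 4 0 =
      σ.table q (σ'.nat 23 0) + σ.table q (σ'.nat 24 0)) ∧
    ∀ i j q, S i j q → 0 < σ.nat 7 i → ¬ 0 < σ.nat 7 j →
      σ'.real 4 0 ≤ σ.table q i + σ.table q j)

theorem IsBest.mono {S S' : ℕ → ℕ → ℕ → Prop} {σ' : State} (h : IsBest σ S σ')
    (hS : ∀ i j q, S' i j q → S i j q) : IsBest σ S' σ' := by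
  rcases h with ⟨h1, h2⟩ | ⟨h1, h2, h3, h4, h5, h6, h7⟩
  · exact Or.inl ⟨h1, fun i j q h => h2 i j q (hS i j q h)⟩
  · exact Or.inr ⟨h1, h2, h3, h4, h5, h6, fun i j q h => h7 i j q (hS i j q h)⟩

theorem wp_scanStep {S : ℕ → ℕ → ℕ → Prop} {σ' : State} (h : IsBest σ S σ')
    (e7 : σ'.nat 7 = σ.nat 7) (e9 : σ'.nat 9 = σ.nat 9) (er : σ'.real 1 = σ.real 1)
    (hi : σ'.nat 19 0 < σ.nat 1 0) (hj : σ'.nat 20 0 < σ.nat 1 0)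
    (hq : σ'.nat 21 0 < σ.nat 13 0) :
    scanStep.wp o (IsBest σ fun i j q => S i j q ∨
      (i = σ'.nat 19 0 ∧ j = σ'.nat 20 0 ∧ q = σ'.nat 21 0)) σ' := by
  rw [scanStep, wp_ite]
  simp only [BExp.eval, NExp.eval, RExp.eval, detour, tableEntry, e7, e9, er]
  constructor
  · rintro ⟨⟨h1, h2⟩, h3⟩
    rw [wp_seq, wp_setNat, wp_seq, wp_setNat, wp_seq, wp_setNat, wp_setReal]
    refine Or.inr ?_
    simp only [NExp.eval, RExp.eval, State.tick_nat, State.tick_real, State.writeNat_nat,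
      State.writeReal_nat, State.writeReal_real, State.writeNat_real, e9, er]
    simp only [Nat.reduceEqDiff, false_and, if_false, if_true, and_self]
    refine ⟨one_pos, hi, hj, h1, h2, ⟨_, hq, rfl⟩, ?_⟩
    rintro i j q (hS | ⟨rfl, rfl, rfl⟩) hi' hj'
    · rcases h with ⟨g1, g2⟩ | ⟨g1, g2, g3, g4, g5, g6, g7⟩
      · exact absurd ⟨hi', hj'⟩ (g2 i j q hS)
      · have h4 := not_and.1 h3 g1
        rw [not_not] at h4
        exact h4.le.trans (g7 i j q hS hi' hj')
    · exact le_rfl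
  · intro h1
    rw [wp_skip]
    rcases h with ⟨g1, g2⟩ | ⟨g1, g2, g3, g4, g5, g6, g7⟩
    · refine Or.inl ⟨g1, ?_⟩
      rintro i j q (hS | ⟨rfl, rfl, rfl⟩)
      · exact g2 i j q hS
      · intro h2
        exact h1 ⟨h2, fun h3 => by rw [g1] at h3; exact lt_irrefl _ h3.1⟩
    · refine Or.inr ⟨g1, g2, g3, g4, g5, g6, ?_⟩
      rintro i j q (hS | ⟨rfl, rfl, rfl⟩) hi' hj'
      · exact g7 i j q hS hi' hj'
      · by_contra h2
        exact h1 ⟨⟨hi', hj'⟩, fun h3 => h3.2 (not_le.1 h2)⟩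

theorem IsBest.congr {S : ℕ → ℕ → ℕ → Prop} {σ' σ'' : State} (h : IsBest σ S σ')
    (h22 : σ''.nat 22 = σ'.nat 22) (h23 : σ''.nat 23 = σ'.nat 23)
    (h24 : σ''.nat 24 = σ'.nat 24) (hr : σ''.real 4 = σ'.real 4) : IsBest σ S σ'' := by
  unfold IsBest at *
  rw [h22, h23, h24, hr]
  exact h

theorem IsBest.writeNat {S : ℕ → ℕ → ℕ → Prop} {σ' : State} (h : IsBest σ S σ') {c : ℕ} (v : ℕ)
    (h22 : 22 ≠ c) (h23 : 23 ≠ c) (h24 : 24 ≠ c) : IsBest σ S (σ'.writeNat c 0 v).tick := by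
  refine h.congr ?_ ?_ ?_ rfl <;> funext j <;> simp [*]

/-- The three invariants describe the triples already compared in lexicographic order, and
`wp_scanStep` adds one triple. -/
theorem wp_scan : scan.wp o (IsBest σ fun i j q =>
    i < σ.nat 1 0 ∧ j < σ.nat 1 0 ∧ q < σ.nat 13 0) σ := by
  set k := σ.nat 1 0 with hk
  set s := σ.nat 13 0 with hs
  rw [scan, wp_seq, wp_setNat]
  set σ1 := (σ.writeNat 22 ((NExp.lit 0).eval σ) ((NExp.lit 0).eval σ)).tick with hσ1
  have f1 : σ1.nat 1 = σ.nat 1 := by funext x; simp [hσ1]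
  have f13 : σ1.nat 13 = σ.nat 13 := by funext x; simp [hσ1]
  have f7 : σ1.nat 7 = σ.nat 7 := by funext x; simp [hσ1]
  have f9 : σ1.nat 9 = σ.nat 9 := by funext x; simp [hσ1]
  refine wp_for (fun i => IsBest σ fun i' j' q' => i' < i ∧ j' < k ∧ q' < s) (by decide)
    (by decide) (fun i σ v h => h.writeNat v (by decide) (by decide) (by decide))
    (fun i σ h => h) ?_ ?_ ?_
  · exact Or.inl ⟨by simp [hσ1, NExp.eval], fun i j q h => absurd h.1 (by omega)⟩
  · intro i hi σ2 h19 hsame2 hI2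
    have g1 : σ2.nat 1 = σ.nat 1 := (hsame2.1 1 (by decide)).trans f1
    have g13 : σ2.nat 13 = σ.nat 13 := (hsame2.1 13 (by decide)).trans f13
    have g7 : σ2.nat 7 = σ.nat 7 := (hsame2.1 7 (by decide)).trans f7
    have g9 : σ2.nat 9 = σ.nat 9 := (hsame2.1 9 (by decide)).trans f9
    have gr : σ2.real 1 = σ.real 1 := hsame2.2 1 (by decide)
    refine wp_for (fun j => IsBest σ fun i' j' q' => (i' < i ∧ j' < k ∧ q' < s) ∨
        (i' = i ∧ j' < j ∧ q' < s)) (by decide)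
      (by decide) (fun i σ v h => h.writeNat v (by decide) (by decide) (by decide))
      (fun i σ h => h) (hI2.mono fun i' j' q' h => by omega) ?_ ?_
    · intro j hj σ3 h20 hsame3 hI3
      refine wp_for (fun q => IsBest σ fun i' j' q' => ((i' < i ∧ j' < k ∧ q' < s) ∨
        (i' = i ∧ j' < j ∧ q' < s)) ∨ (i' = i ∧ j' = j ∧ q' < q)) (by decide)
        (by decide) (fun i σ v h => h.writeNat v (by decide) (by decide) (by decide))
        (fun i σ h => h) (hI3.mono fun i' j' q' h => by omega) ?_ ?_
      · intro q hq σ4 h21 hsame4 hI4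
        have e19 : σ4.nat 19 0 = i := by
          rw [hsame4.1 19 (by decide), hsame3.1 19 (by decide), h19]
        have e20 : σ4.nat 20 0 = j := by
          rw [hsame4.1 20 (by decide), h20]
        refine (wp_scanStep hI4 ?_ ?_ ?_ ?_ ?_ ?_).mono fun σ' h => h.mono ?_
        · rw [hsame4.1 7 (by decide), hsame3.1 7 (by decide), g7]
        · rw [hsame4.1 9 (by decide), hsame3.1 9 (by decide), g9]
        · rw [hsame4.2 1 (by decide), hsame3.2 1 (by decide), gr]
        · rw [e19, ← f1]; exact hi
        · rw [e20, ← g1]; exact hj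
        · rw [h21, ← g13, ← hsame3.1 13 (by decide)]; exact hq
        · intro i' j' q' h
          rw [e19, e20, h21]
          omega
      · intro σ' _ h
        rw [hsame3.1 13 (by decide), g13] at h
        exact h.mono fun i' j' q' h => by omega
    · intro σ' _ h
      rw [g1] at h
      exact h.mono fun i' j' q' h => by omega
  · intro σ' _ h
    rw [f1] at h
    exact h

/-! ### Prim's loop -/

/-- The indices of the terminals that are in the tree before step `x`, if `b y` is added in
step `y`. -/
def Visited (b : ℕ → ℕ) (x i : ℕ) : Prop := i = 0 ∨ ∃ y < x, b y = i

/-- In step `x` of Prim's algorithm for the table `tab`, the terminal `b x` is connected to `a x`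
by a cheapest detour, whose length is `val x`. -/
structure PrimStep (k s : ℕ) (tab : ℕ → ℕ → ℝ) (a b : ℕ → ℕ) (val : ℕ → ℝ) (x : ℕ) : Prop where
  source_lt : a x < k
  target_lt : b x < k
  source : Visited b x (a x)
  target : ¬ Visited b x (b x)
  value : ∃ q < s, val x = tab q (a x) + tab q (b x)
  minimal : ∀ i < k, ∀ j < k, Visited b x i → ¬ Visited b x j → ∀ q < s,
    val x ≤ tab q i + tab q j

theorem Visited.congr {b b' : ℕ → ℕ} {x : ℕ} (h : ∀ y < x, b y = b' y) (i : ℕ) :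
    Visited b x i ↔ Visited b' x i := by
  unfold Visited
  refine or_congr_right ?_
  constructor
  · rintro ⟨y, hy, e⟩; exact ⟨y, hy, (h y hy) ▸ e⟩
  · rintro ⟨y, hy, e⟩; exact ⟨y, hy, (h y hy).symm ▸ e⟩

theorem PrimStep.congr {k s : ℕ} {tab : ℕ → ℕ → ℝ} {a b a' b' : ℕ → ℕ} {val val' : ℕ → ℝ} {x : ℕ}
    (h : PrimStep k s tab a b val x) (ha : a x = a' x) (hb : ∀ y ≤ x, b y = b' y)
    (hv : val x = val' x) : PrimStep k s tab a' b' val' x := by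
  have hV := Visited.congr (x := x) fun y hy => hb y hy.le
  have hbx := hb x le_rfl
  obtain ⟨h1, h2, h3, h4, h5, h6⟩ := h
  rw [ha] at h1 h3 h5
  rw [hbx] at h2 h4 h5
  rw [hv] at h5
  simp only [hV, hv] at h3 h4 h6
  exact ⟨h1, h2, h3, h4, h5, h6⟩

/-- Only the root and the `x` targets of earlier steps are visited. Hence no scan comes out empty
before the tree is complete. -/
theorem exists_not_visited {k x : ℕ} (b : ℕ → ℕ) (hx : x + 1 < k) :
    ∃ j < k, ¬ Visited b x j := by
  by_contra! h
  have hsub : Finset.range k ⊆ insert 0 ((Finset.range x).image b) := by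
    intro j hj
    rcases h j (Finset.mem_range.1 hj) with rfl | ⟨y, hy, rfl⟩
    · exact Finset.mem_insert_self _ _
    · exact Finset.mem_insert_of_mem (Finset.mem_image_of_mem _ (Finset.mem_range.2 hy))
  have h1 := Finset.card_le_card hsub
  have h2 := Finset.card_insert_le 0 ((Finset.range x).image b)
  have h3 : ((Finset.range x).image b).card ≤ (Finset.range x).card := Finset.card_image_le
  simp only [Finset.card_range] at h1 h3
  omega

/-- The state after `r` steps of Prim's algorithm that was started in the state `σ`. -/
structure PrimState (σ : State) (r : ℕ) (σ' : State) : Prop where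
  count : σ'.nat 3 0 = r
  visited : ∀ i, 0 < σ'.nat 7 i ↔ Visited (σ'.nat 27) r i
  left : ∀ x < r, σ'.nat 4 x = σ.nat 2 (σ'.nat 26 x)
  right : ∀ x < r, σ'.nat 5 x = σ.nat 2 (σ'.nat 27 x)
  step : ∀ x < r, PrimStep (σ.nat 1 0) (σ.nat 13 0) σ.table (σ'.nat 26) (σ'.nat 27) (σ'.real 5) x

theorem wp_growTree (hs : 1 ≤ σ.nat 13 0) (h25 : σ.nat 25 0 = σ.nat 1 0 - 1)
    (h3 : σ.nat 3 0 = 0) (h7 : ∀ i, 0 < σ.nat 7 i ↔ i = 0) :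
    growTree.wp o (PrimState σ (σ.nat 1 0 - 1)) σ := by
  rw [growTree, ← h25]
  refine wp_loop_same (PrimState σ) ?_ ?_ (fun σ' h => h)
  · exact ⟨h3, fun i => by simp [h7, Visited], by simp, by simp, by simp⟩
  · intro r hr σ1 hsame hI
    have hr' : r + 1 < σ.nat 1 0 := by
      have : r < σ.nat 25 0 := hr
      omega
    have e1 : σ1.nat 1 = σ.nat 1 := hsame.1 1 (by decide)
    have e2 : σ1.nat 2 = σ.nat 2 := hsame.1 2 (by decide)
    have e9 : σ1.nat 9 = σ.nat 9 := hsame.1 9 (by decide)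
    have e13 : σ1.nat 13 = σ.nat 13 := hsame.1 13 (by decide)
    have er : σ1.real 1 = σ.real 1 := hsame.2 1 (by decide)
    have etab : σ1.tick.table = σ.table := by
      funext q i; simp [State.table, e9, er]
    rw [wp_seq]
    refine (wp_scan.and (wp_same _ _)).mono ?_
    rintro σ2 ⟨hbest, hsame2⟩
    have f2 : σ2.nat 2 = σ.nat 2 := (hsame2.1 2 (by decide)).trans e2
    have f3 : σ2.nat 3 0 = r := by rw [hsame2.1 3 (by decide)]; exact hI.count
    have f4 : σ2.nat 4 = σ1.nat 4 := hsame2.1 4 (by decide)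
    have f5 : σ2.nat 5 = σ1.nat 5 := hsame2.1 5 (by decide)
    have f7 : σ2.nat 7 = σ1.nat 7 := hsame2.1 7 (by decide)
    have f26 : σ2.nat 26 = σ1.nat 26 := hsame2.1 26 (by decide)
    have f27 : σ2.nat 27 = σ1.nat 27 := hsame2.1 27 (by decide)
    have fr5 : σ2.real 5 = σ1.real 5 := hsame2.2 5 (by decide)
    obtain ⟨jn, hjn, hjv⟩ := exists_not_visited (σ1.nat 27) hr'
    unfold IsBest at hbest
    simp only [etab, State.tick_nat, e1, e13, hI.visited] at hbest
    rcases hbest with ⟨-, g⟩ | ⟨-, g1, g2, g3, g4, g5, g6⟩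
    -- The root, an unvisited terminal and sample 0 form an admissible triple, so the scan cannot
    -- have failed.
    · exact absurd ⟨Or.inl rfl, hjv⟩ (g 0 jn 0 ⟨by omega, hjn, by omega⟩)
    rw [addEdge]
    simp only [wp_seq, wp_setNat, wp_setReal]
    constructor
    · simp [NExp.eval, f3]
    · intro i
      by_cases hi : i = σ2.nat 24 0
      · simp only [NExp.eval, State.tick_nat, State.writeNat_nat, State.writeReal_nat, f3, hi]
        simp only [Nat.reduceEqDiff, false_and, if_false, if_true, and_self, zero_lt_one, true_iff]
        exact Or.inr ⟨r, by omega, by simp⟩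
      · simp [NExp.eval, f3, hi, f7, hI.visited]
        unfold Visited
        refine or_congr_right ?_
        constructor
        · rintro ⟨y, hy, e⟩
          exact ⟨y, by omega, by simp [hy.ne, f27, e]⟩
        · rintro ⟨y, hy, e⟩
          by_cases hyr : y = r
          · simp [hyr] at e; exact absurd e.symm hi
          · simp [hyr, f27] at e; exact ⟨y, by omega, e⟩
    · intro x hx
      by_cases hxr : x = r
      · simp [NExp.eval, f3, hxr, f2]
      · simp [NExp.eval, f3, hxr, f4, f26]; exact hI.left x (by omega)
    · intro x hx
      by_cases hxr : x = r
      · simp [NExp.eval, f3, hxr, f2]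
      · simp [NExp.eval, f3, hxr, f5, f27]; exact hI.right x (by omega)
    · intro x hx
      by_cases hxr : x = r
      · subst hxr
        have : PrimStep (σ.nat 1 0) (σ.nat 13 0) σ.table (fun _ => σ2.nat 23 0)
            (fun y => if y = x then σ2.nat 24 0 else σ1.nat 27 y) (fun _ => σ2.real 4 0) x := by
          have hV : ∀ i, Visited (fun y => if y = x then σ2.nat 24 0 else σ1.nat 27 y) x i ↔
              Visited (σ1.nat 27) x i := Visited.congr fun y hy => by simp [hy.ne]
          refine ⟨g1, by simpa using g2, (hV _).2 g3, ?_, by simpa using g5, ?_⟩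
          · simp only [if_true, hV]; exact g4
          · intro i hi j hj hvi hvj q hq
            exact g6 i j q ⟨hi, hj, hq⟩ ((hV i).1 hvi) (fun h => hvj ((hV j).2 h))
        refine this.congr ?_ ?_ ?_
        · simp [NExp.eval, f3]
        · intro y hy
          simp [NExp.eval, f3, f27]
        · simp [NExp.eval, RExp.eval, f3]
      · refine (hI.step x (by omega)).congr ?_ ?_ ?_
        · simp [NExp.eval, f3, f26, hxr]
        · intro y hy
          have : y ≠ r := by omega
          simp [NExp.eval, f3, f27, this]
        · simp [NExp.eval, f3, fr5, hxr]

end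

/-! ### Short paths through the terminals -/

/-- The length of the path that visits the vertices in the list. -/
def pathLen {n : ℕ} (w : Fin n → Fin n → ℝ) : List (Fin n) → ℝ
  | [] => 0
  | [_] => 0
  | a :: b :: l => w a b + pathLen w (b :: l)

theorem pathLen_nonneg {n : ℕ} {w : Fin n → Fin n → ℝ} (hw : IsMetric w) :
    ∀ l : List (Fin n), 0 ≤ pathLen w l
  | [] => le_rfl
  | [_] => le_rfl
  | a :: b :: l => add_nonneg (hw.nonneg a b) (pathLen_nonneg hw (b :: l))

theorem pathLen_cons_sublist {n : ℕ} {w : Fin n → Fin n → ℝ} (hw : IsMetric w)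
    {l' l : List (Fin n)} (h : l'.Sublist l) : ∀ a, pathLen w (a :: l') ≤ pathLen w (a :: l) := by
  induction h with
  | slnil => intro a; exact le_rfl
  | @cons l1 l2 b _ ih =>
    intro a
    refine le_trans ?_ (add_le_add_right (ih b) (w a b))
    cases l1 with
    | nil => exact add_nonneg (hw.nonneg a b) (pathLen_nonneg hw _)
    | cons c l1 =>
      simp only [pathLen]
      linarith [hw.triangle a b c]
  | @cons_cons l1 l2 b _ ih => intro a; exact add_le_add_right (ih b) (w a b)

/-- Shortcutting: by the triangle inequality, omitting vertices does not lengthen a path. -/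
theorem pathLen_sublist {n : ℕ} {w : Fin n → Fin n → ℝ} (hw : IsMetric w)
    {l' l : List (Fin n)} (h : l'.Sublist l) : pathLen w l' ≤ pathLen w l := by
  cases h with
  | slnil => exact le_rfl
  | @cons l1 l2 b h =>
    refine le_trans ?_ (pathLen_cons_sublist hw h b)
    cases l' with
    | nil => exact pathLen_nonneg hw _
    | cons c l' => exact le_add_of_nonneg_left (hw.nonneg _ _)
  | @cons_cons l1 l2 b h => exact pathLen_cons_sublist hw h b

/-- Insert `y` directly behind `x`; the detour costs at most the way there and back. The first
vertex is kept so that the induction can prepend to the path. -/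
theorem exists_insert_path {n : ℕ} {w : Fin n → Fin n → ℝ} (hw : IsMetric w) (x y : Fin n) :
    ∀ (l : List (Fin n)) (a : Fin n), x ∈ a :: l →
    ∃ r : List (Fin n), r.Perm (y :: l) ∧ pathLen w (a :: r) ≤ pathLen w (a :: l) + 2 * w x y
  | [], a, h => by
    rw [List.mem_singleton] at h
    subst h
    refine ⟨[y], List.Perm.refl _, ?_⟩
    simp only [pathLen]
    linarith [hw.nonneg x y]
  | b :: l, a, h => by
    by_cases hxa : x = a
    · subst hxa
      refine ⟨y :: b :: l, List.Perm.refl _, ?_⟩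
      simp only [pathLen]
      linarith [hw.triangle y x b, hw.symm x y]
    · obtain ⟨r, h1, h2⟩ := exists_insert_path hw x y l b
        ((List.mem_cons.1 h).resolve_left hxa)
      refine ⟨b :: r, (h1.cons b).trans (List.Perm.swap _ _ _), ?_⟩
      simp only [pathLen]
      linarith

/-- A vertex of greatest height is nobody's parent. Remove it, take a path through the rest, and
insert it next to its parent at twice the length of their edge. -/
theorem exists_path_of_parent {n : ℕ} {w : Fin n → Fin n → ℝ} (hw : IsMetric w) {r : Fin n}
    {par : Fin n → Fin n} {ht : Fin n → ℕ} (A : Finset (Fin n)) :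
    (∀ v ∈ A, v ≠ r → par v ∈ A ∧ ht (par v) < ht v) →
    ∃ l : List (Fin n), l.Nodup ∧ l.toFinset = A ∧
      pathLen w l ≤ 2 * ∑ v ∈ A.erase r, w v (par v) := by
  -- Shifting the heights and giving `r` the value 0 makes the root enter first, whatever its own
  -- height is.
  refine Finset.induction_on_max_value (fun v => if v = r then 0 else ht v + 1) A
    (fun _ => ⟨[], by simp, by simp, by simp [pathLen]⟩) ?_
  intro a s has hmax ih hcl
  by_cases har : a = r
  · subst har
    have hs : s = ∅ := by
      refine Finset.eq_empty_of_forall_notMem fun x hx => ?_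
      have hxa : x ≠ a := fun e => has (e ▸ hx)
      have := hmax x hx
      simp [hxa] at this
    subst hs
    exact ⟨[a], by simp, by simp, by simp [pathLen]⟩
  · obtain ⟨l, h1, h2, h3⟩ := ih fun v hv hvr => by
      obtain ⟨h1, h2⟩ := hcl v (Finset.mem_insert_of_mem hv) hvr
      refine ⟨(Finset.mem_insert.1 h1).resolve_left fun e => ?_, h2⟩
      have := hmax v hv
      simp only [hvr, har, if_false] at this
      rw [e] at h2
      omega
    obtain ⟨h4, h5⟩ := hcl a (Finset.mem_insert_self _ _) har
    have h6 : par a ∈ l := by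
      rw [← List.mem_toFinset, h2]
      refine (Finset.mem_insert.1 h4).resolve_left fun e => ?_
      rw [e] at h5; omega
    cases l with
    | nil => simp at h6
    | cons c l =>
      obtain ⟨r', h7, h8⟩ := exists_insert_path hw (par a) a l c h6
      have hperm : (c :: r').Perm (a :: c :: l) := (h7.cons c).trans (List.Perm.swap _ _ _)
      refine ⟨c :: r', ?_, ?_, ?_⟩
      · refine hperm.symm.nodup (List.nodup_cons.2 ⟨?_, h1⟩)
        rw [← List.mem_toFinset, h2]; exact has
      · rw [List.toFinset_eq_of_perm _ _ hperm, List.toFinset_cons, h2]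
      · rw [Finset.erase_insert_of_ne har, Finset.sum_insert (fun h => has (Finset.mem_of_mem_erase h)),
          hw.symm a (par a)]
        linarith

/-- Order all vertices of the tree on a path, then drop the Steiner vertices. -/
theorem exists_path_of_steinerTree {n : ℕ} {w : Fin n → Fin n → ℝ} (hw : IsMetric w)
    {T : Finset (Fin n)} {H : Graph n} (hT : T.Nonempty) (hH : IsSteinerTree T H) :
    ∃ l : List (Fin n), l.Nodup ∧ l.toFinset = T ∧ pathLen w l ≤ 2 * cost w H := by
  classical
  obtain ⟨r, hr⟩ := hT
  obtain ⟨par, ht, hpar⟩ := exists_parent hH.2.connected (hH.1 r hr)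
  let A : Finset (Fin n) := Finset.univ.filter fun v => v ∈ H.verts
  have hA : ∀ v, v ∈ A ↔ v ∈ H.verts := fun v => by simp [A]
  obtain ⟨l, h1, h2, h3⟩ := exists_path_of_parent hw (r := r) (par := par) (ht := ht) A
    fun v hv hvr => by
      obtain ⟨h1, h2⟩ := hpar v ((hA v).1 hv) hvr
      exact ⟨(hA _).2 (H.edge_vert h1.symm), h2⟩
  refine ⟨l.filter (· ∈ T), h1.filter _, ?_, ?_⟩
  · ext v
    simp only [List.toFinset_filter, h2, Finset.mem_filter, hA, decide_eq_true_eq]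
    exact ⟨fun h => h.2, fun h => ⟨hH.1 v h, h⟩⟩
  · have h4 := sum_parent_le_cost hw (H := H) (par := par) (ht := ht) (s := A.erase r) fun v hv =>
      hpar v ((hA v).1 (Finset.mem_of_mem_erase hv)) (Finset.ne_of_mem_erase hv)
    linarith [pathLen_sublist hw (List.filter_sublist (p := (· ∈ T)) (l := l))]

theorem pathLen_eq_sum {n : ℕ} (w : Fin n → Fin n → ℝ) (d : Fin n) : ∀ l : List (Fin n),
    pathLen w l = ∑ i ∈ Finset.range (l.length - 1), w (l.getD i d) (l.getD (i + 1) d)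
  | [] => by simp [pathLen]
  | [_] => by simp [pathLen]
  | a :: b :: l => by
    rw [pathLen, pathLen_eq_sum w d (b :: l)]
    simp only [List.length_cons, Nat.add_sub_cancel]
    rw [Finset.sum_range_succ', add_comm]
    simp

/-- The `i`-th terminal (or the first one, if there are at most `i` terminals). -/
def terminal {n k : ℕ} (t : Fin k ↪ Fin n) (hk : 0 < k) (i : ℕ) : Fin n :=
  if h : i < k then t ⟨i, h⟩ else t ⟨0, hk⟩

/-- Some path through all terminals has length at most twice the cost of any Steiner tree. -/
theorem exists_short_path {n k : ℕ} (t : Fin k ↪ Fin n) (hk : 0 < k) {w : Fin n → Fin n → ℝ}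
    (hw : IsMetric w) : ∃ p : ℕ → ℕ, (∀ i, p i < k) ∧ (∀ v < k, ∃ i < k, p i = v) ∧
      Set.InjOn p (Set.Iio k) ∧
      ∀ H : Graph n, IsSteinerTree (Finset.univ.map t) H →
        ∑ i ∈ Finset.range (k - 1), w (terminal t hk (p i)) (terminal t hk (p (i + 1))) ≤
          2 * cost w H := by
  classical
  let P : Equiv.Perm (Fin k) → ℕ → ℕ := fun e i => e ⟨i % k, Nat.mod_lt _ hk⟩
  -- A shortest ordering is fixed once, so that the same path works for every Steiner tree.
  obtain ⟨e, he⟩ := Finite.exists_min fun e : Equiv.Perm (Fin k) =>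
    ∑ i ∈ Finset.range (k - 1), w (terminal t hk (P e i)) (terminal t hk (P e (i + 1)))
  refine ⟨P e, fun i => (e _).2, ?_, ?_, ?_⟩
  · intro v hv
    refine ⟨e.symm ⟨v, hv⟩, (e.symm _).2, ?_⟩
    simp only [P, Nat.mod_eq_of_lt (e.symm ⟨v, hv⟩).2]
    simp
  · intro i hi j hj h
    simp only [Set.mem_Iio] at hi hj
    simp only [P, Nat.mod_eq_of_lt hi, Nat.mod_eq_of_lt hj] at h
    have := e.injective (Fin.ext h)
    simpa using this
  · intro H hH
    obtain ⟨l, h1, h2, h3⟩ := exists_path_of_steinerTree hw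
      (T := Finset.univ.map t) ⟨t ⟨0, hk⟩, by simp⟩ hH
    have hlen : l.length = k := by
      rw [← List.toFinset_card_of_nodup h1, h2]; simp
    have hex : ∀ i : Fin k, ∃ j : Fin k, t j = l.getD i (t ⟨0, hk⟩) := by
      intro i
      have hi : (i : ℕ) < l.length := hlen ▸ i.2
      have : l.getD i (t ⟨0, hk⟩) ∈ l.toFinset := by
        rw [List.getD_eq_getElem _ _ hi, List.mem_toFinset]
        exact List.getElem_mem hi
      rw [h2] at this
      simpa using this
    choose g hg using hex
    have hinj : Function.Injective g := by
      intro i j hij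
      have h4 : l.getD i (t ⟨0, hk⟩) = l.getD j (t ⟨0, hk⟩) := by rw [← hg, ← hg, hij]
      have hi : (i : ℕ) < l.length := hlen ▸ i.2
      have hj : (j : ℕ) < l.length := hlen ▸ j.2
      rw [List.getD_eq_getElem _ _ hi, List.getD_eq_getElem _ _ hj] at h4
      exact Fin.ext ((h1.getElem_inj_iff).1 h4)
    let e' : Equiv.Perm (Fin k) := Equiv.ofBijective g (Finite.injective_iff_bijective.1 hinj)
    refine (he e').trans (le_trans (le_of_eq ?_) h3)
    rw [pathLen_eq_sum w (t ⟨0, hk⟩), hlen]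
    refine Finset.sum_congr rfl fun i hi => ?_
    rw [Finset.mem_range] at hi
    have key : ∀ j < k, terminal t hk (P e' j) = l.getD j (t ⟨0, hk⟩) := by
      intro j hj
      have : (⟨j % k, Nat.mod_lt _ hk⟩ : Fin k) = ⟨j, hj⟩ := Fin.ext (Nat.mod_eq_of_lt hj)
      simp only [P, this, terminal, Fin.is_lt, dif_pos, Fin.eta]
      exact hg ⟨j, hj⟩
    rw [key i (by omega), key (i + 1) (by omega)]

/-! ### Prim's algorithm -/

/-- Adjacency in the graph with edges `{e₁ e, e₂ e}`, `e ∈ F`. -/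
def EdgeRel {V ι : Type*} (e₁ e₂ : ι → V) (F : Finset ι) (x y : V) : Prop :=
  ∃ e ∈ F, (e₁ e = x ∧ e₂ e = y) ∨ (e₁ e = y ∧ e₂ e = x)

theorem EdgeRel.symm {V ι : Type*} {e₁ e₂ : ι → V} {F : Finset ι} {x y : V}
    (h : EdgeRel e₁ e₂ F x y) : EdgeRel e₁ e₂ F y x := by
  obtain ⟨e, he, h⟩ := h
  exact ⟨e, he, h.symm⟩

/-- Take the first edge on which the walk from `v` enters `A`; the part before it stays outside `A`.
-/
theorem exists_crossing {V ι : Type*} {e₁ e₂ : ι → V} {F : Finset ι} {A : V → Prop} {v a : V}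
    (ha : A a) (h : Relation.ReflTransGen (EdgeRel e₁ e₂ F) v a) (hv : ¬ A v) :
    ∃ y x, ¬ A y ∧ A x ∧ EdgeRel e₁ e₂ F y x ∧
      Relation.ReflTransGen (fun x y => EdgeRel e₁ e₂ F x y ∧ ¬ A x ∧ ¬ A y) y v := by
  induction h using Relation.ReflTransGen.head_induction_on with
  | refl => exact absurd ha hv
  | @head v c hvc _ ih =>
    by_cases hc : A c
    · exact ⟨v, c, hv, hc, hvc, Relation.ReflTransGen.refl⟩
    · obtain ⟨y, x, h1, h2, h3, h4⟩ := ih hc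
      exact ⟨y, x, h1, h2, h3, h4.tail ⟨hvc.symm, hc, hv⟩⟩

/-- The exchange step for spanning trees. -/
theorem exists_exchange {V ι : Type*} [DecidableEq ι] {e₁ e₂ : ι → V} {F : Finset ι}
    {A U : V → Prop} {v : V} (hv : ¬ A v) (hvU : U v)
    (hconn : ∀ z, U z → ∃ a, A a ∧ Relation.ReflTransGen (EdgeRel e₁ e₂ F) z a) :
    ∃ e ∈ F, ((A (e₁ e) ∧ ¬ A (e₂ e)) ∨ (A (e₂ e) ∧ ¬ A (e₁ e))) ∧
      ∀ z, U z → ∃ a, (A a ∨ a = v) ∧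
        Relation.ReflTransGen (EdgeRel e₁ e₂ (F.erase e)) z a := by
  obtain ⟨a, ha, hva⟩ := hconn v hvU
  obtain ⟨y, x, hy, hx, ⟨e, he, hexy⟩, hyv⟩ := exists_crossing ha hva hv
  have hcross : (A (e₁ e) ∧ ¬ A (e₂ e)) ∨ (A (e₂ e) ∧ ¬ A (e₁ e)) := by
    rcases hexy with ⟨rfl, rfl⟩ | ⟨rfl, rfl⟩
    · exact Or.inr ⟨hx, hy⟩
    · exact Or.inl ⟨hx, hy⟩
  -- This walk avoids `A`, so it cannot use the crossing edge `e`.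
  have hyv' : Relation.ReflTransGen (EdgeRel e₁ e₂ (F.erase e)) y v := by
    refine Relation.ReflTransGen.mono ?_ _ _ hyv
    rintro b c ⟨⟨e', he', h⟩, hb, hc⟩
    refine ⟨e', Finset.mem_erase.2 ⟨?_, he'⟩, h⟩
    rintro rfl
    rcases h with ⟨rfl, rfl⟩ | ⟨rfl, rfl⟩ <;> tauto
  refine ⟨e, he, hcross, fun z hz => ?_⟩
  obtain ⟨a, ha, hza⟩ := hconn z hz
  clear hz
  induction hza using Relation.ReflTransGen.head_induction_on with
  | refl => exact ⟨a, Or.inl ha, Relation.ReflTransGen.refl⟩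
  | @head b c hbc _ ih =>
    obtain ⟨a', ha', hca'⟩ := ih
    obtain ⟨e', he', h⟩ := hbc
    by_cases hee : e' = e
    · subst hee
      by_cases hb : A b
      · exact ⟨b, Or.inl hb, Relation.ReflTransGen.refl⟩
      -- A walk that is about to use `e` from outside `A` stands at `y`, and is rerouted to `v`.
      · refine ⟨v, Or.inr rfl, ?_⟩
        have : b = y := by
          rcases h with ⟨h1, h2⟩ | ⟨h1, h2⟩ <;> rcases hexy with ⟨h3, h4⟩ | ⟨h3, h4⟩ <;> grind
        rw [this]
        exact hyv'
    · exact ⟨a', ha', hca'.head ⟨e', Finset.mem_erase.2 ⟨hee, he'⟩, h⟩⟩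

/-- The tree of Prim's algorithm is at most as expensive as any connected spanning subgraph. -/
theorem prim_cost_le {ι : Type*} [DecidableEq ι] {e₁ e₂ : ι → ℕ} {F : Finset ι} {c : ι → ℝ}
    (hc : ∀ e, 0 ≤ c e) {U : ℕ → Prop} {b : ℕ → ℕ} {val : ℕ → ℝ} {m : ℕ}
    (hU : ∀ x < m, U (b x)) (hb : ∀ x < m, ¬ Visited b x (b x))
    (hval : ∀ x < m, ∀ e ∈ F, (Visited b x (e₁ e) ∧ ¬ Visited b x (e₂ e)) ∨
      (Visited b x (e₂ e) ∧ ¬ Visited b x (e₁ e)) → val x ≤ c e)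
    (hconn : ∀ z, U z → Relation.ReflTransGen (EdgeRel e₁ e₂ F) z 0) :
    ∑ x ∈ Finset.range m, val x ≤ ∑ e ∈ F, c e := by
  -- Each step of Prim's algorithm is charged to one edge of `F` across the current cut, which is
  -- then deleted. The remaining edges still link every vertex of `U` to the visited set.
  have key : ∀ x ≤ m, ∃ F' ⊆ F, (∀ z, U z → ∃ a, Visited b x a ∧
      Relation.ReflTransGen (EdgeRel e₁ e₂ F') z a) ∧
      ∑ y ∈ Finset.range x, val y + ∑ e ∈ F', c e ≤ ∑ e ∈ F, c e := by
    intro x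
    induction x with
    | zero =>
      exact fun _ => ⟨F, Finset.Subset.refl _, fun z hz => ⟨0, Or.inl rfl, hconn z hz⟩, by simp⟩
    | succ x ih =>
      intro hx
      obtain ⟨F', hF, hconn', hsum⟩ := ih (by omega)
      obtain ⟨e, he, hcross, hnew⟩ := exists_exchange (hb x hx) (hU x hx) hconn'
      refine ⟨F'.erase e, (Finset.erase_subset _ _).trans hF, fun z hz => ?_, ?_⟩
      · obtain ⟨a, ha, hza⟩ := hnew z hz
        refine ⟨a, ?_, hza⟩
        rcases ha with (ha | ⟨y, hy, ha⟩) | rfl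
        · exact Or.inl ha
        · exact Or.inr ⟨y, by omega, ha⟩
        · exact Or.inr ⟨x, by omega, rfl⟩
      · have h1 := hval x hx e (hF he) hcross
        rw [← Finset.add_sum_erase _ _ he] at hsum
        rw [Finset.sum_range_succ]
        linarith
  obtain ⟨F', -, -, h⟩ := key m le_rfl
  linarith [Finset.sum_nonneg fun e (_ : e ∈ F') => hc e]

/-! ### Connecting all positions of a path to nearby samples -/

theorem le_sum_Ico {d : ℕ → ℕ → ℝ} (h0 : ∀ i, d i i = 0)
    (ht : ∀ i j l, d i l ≤ d i j + d j l) {i j : ℕ} (h : i ≤ j) :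
    d i j ≤ ∑ x ∈ Finset.Ico i j, d x (x + 1) := by
  induction j, h using Nat.le_induction with
  | base => simp [h0]
  | succ j h ih =>
    rw [Finset.sum_Ico_succ_top h]
    linarith [ht i j (j + 1)]

/-- If every position on a path is moved by at most `L`, then the total distance moved is at most
`2 * L` times the length of the path. -/
theorem sum_near_le {d : ℕ → ℕ → ℝ} (hnn : ∀ i j, 0 ≤ d i j) (h0 : ∀ i, d i i = 0)
    (hs : ∀ i j, d i j = d j i) (ht : ∀ i j l, d i l ≤ d i j + d j l) {k L : ℕ} {near : ℕ → ℕ}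
    (hk : ∀ i < k, near i < k) (h1 : ∀ i < k, near i ≤ i + L) (h2 : ∀ i < k, i ≤ near i + L) :
    ∑ i ∈ Finset.range k, d i (near i) ≤
      2 * L * ∑ x ∈ Finset.range (k - 1), d x (x + 1) := by
  have hb : ∀ i ∈ Finset.range k, d i (near i) ≤ ∑ x ∈ Finset.range (k - 1),
      if i ≤ x + L ∧ x < i + L then d x (x + 1) else 0 := by
    intro i hi
    rw [Finset.mem_range] at hi
    rw [← Finset.sum_filter]
    have := hk i hi
    have := h1 i hi
    have := h2 i hi
    rcases le_total i (near i) with h | h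
    · refine (le_sum_Ico h0 ht h).trans
        (Finset.sum_le_sum_of_subset_of_nonneg ?_ fun x _ _ => hnn _ _)
      intro x hx
      simp only [Finset.mem_Ico, Finset.mem_filter, Finset.mem_range] at hx ⊢
      omega
    · rw [hs]
      refine (le_sum_Ico h0 ht h).trans
        (Finset.sum_le_sum_of_subset_of_nonneg ?_ fun x _ _ => hnn _ _)
      intro x hx
      simp only [Finset.mem_Ico, Finset.mem_filter, Finset.mem_range] at hx ⊢
      omega
  refine (Finset.sum_le_sum hb).trans ?_
  -- Count from the side of the path: its edge `x` lies between a position and its nearby sample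
  -- only for positions from x + 1 - L to x + L, at most 2L of them.
  rw [Finset.sum_comm, Finset.mul_sum]
  refine Finset.sum_le_sum fun x _ => ?_
  rw [← Finset.sum_filter, Finset.sum_const, nsmul_eq_mul]
  refine mul_le_mul_of_nonneg_right ?_ (hnn _ _)
  have hcard : ((Finset.range k).filter fun i => i ≤ x + L ∧ x < i + L).card ≤ 2 * L := by
    have hsub : ((Finset.range k).filter fun i => i ≤ x + L ∧ x < i + L) ⊆
        Finset.Ico (x + 1 - L) (x + 1 + L) := by
      intro i hi
      simp only [Finset.mem_Ico, Finset.mem_filter, Finset.mem_range] at hi ⊢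
      omega
    refine (Finset.card_le_card hsub).trans ?_
    rw [Nat.card_Ico]
    omega
  exact_mod_cast hcard

/-- The edges from the positions to the nearby samples, and between the samples for consecutive
positions, are cheap. -/
theorem sum_comparison_le {d : ℕ → ℕ → ℝ} (hnn : ∀ i j, 0 ≤ d i j) (h0 : ∀ i, d i i = 0)
    (hs : ∀ i j, d i j = d j i) (ht : ∀ i j l, d i l ≤ d i j + d j l) {k L : ℕ} {near : ℕ → ℕ}
    (hk : ∀ i < k, near i < k) (h1 : ∀ i < k, near i ≤ i + L) (h2 : ∀ i < k, i ≤ near i + L) :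
    ∑ i ∈ Finset.range k, d i (near i) +
        ∑ i ∈ Finset.range (k - 1), d (near i) (near (i + 1)) ≤
      (6 * L + 1) * ∑ x ∈ Finset.range (k - 1), d x (x + 1) := by
  have h3 := sum_near_le hnn h0 hs ht hk h1 h2
  have h4 : ∑ i ∈ Finset.range (k - 1), d (near i) (near (i + 1)) ≤
      ∑ i ∈ Finset.range (k - 1), (d i (near i) + d i (i + 1) + d (i + 1) (near (i + 1))) := by
    refine Finset.sum_le_sum fun i _ => ?_
    linarith [ht (near i) i (near (i + 1)), ht i (i + 1) (near (i + 1)), hs i (near i)]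
  rw [Finset.sum_add_distrib, Finset.sum_add_distrib] at h4
  have h5 : ∑ i ∈ Finset.range (k - 1), d i (near i) ≤ ∑ i ∈ Finset.range k, d i (near i) :=
    Finset.sum_le_sum_of_subset_of_nonneg (Finset.range_mono (by omega)) fun i _ _ => hnn _ _
  have h6 : ∑ i ∈ Finset.range (k - 1), d (i + 1) (near (i + 1)) ≤
      ∑ i ∈ Finset.range k, d i (near i) := by
    cases k with
    | zero => simp
    | succ k =>
      rw [Finset.sum_range_succ', Nat.add_sub_cancel]
      linarith [hnn 0 (near 0)]
  linarith

/-! ### The output of the algorithm -/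

/-- The k - 1 targets are distinct and different from the root 0, so together with it they exhaust
the k indices. -/
theorem visited_all {b : ℕ → ℕ} {k : ℕ} (hk : 0 < k) (hb : ∀ x < k - 1, b x < k)
    (hv : ∀ x < k - 1, ¬ Visited b x (b x)) : ∀ i < k, Visited b (k - 1) i := by
  have hinj : Set.InjOn b (Finset.range (k - 1)) := by
    intro x hx y hy h
    simp only [Finset.coe_range, Set.mem_Iio] at hx hy
    rcases lt_trichotomy x y with hxy | hxy | hxy
    · exact absurd (Or.inr ⟨x, hxy, h⟩) (hv y hy)
    · exact hxy
    · exact absurd (Or.inr ⟨y, hxy, h.symm⟩) (hv x hx)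
  have h0 : 0 ∉ (Finset.range (k - 1)).image b := by
    intro h
    obtain ⟨x, hx, h⟩ := Finset.mem_image.1 h
    exact hv x (Finset.mem_range.1 hx) (Or.inl h)
  have heq : insert 0 ((Finset.range (k - 1)).image b) = Finset.range k := by
    refine Finset.eq_of_subset_of_card_le ?_ ?_
    · intro i hi
      rcases Finset.mem_insert.1 hi with rfl | hi
      · exact Finset.mem_range.2 hk
      · obtain ⟨x, hx, rfl⟩ := Finset.mem_image.1 hi
        exact Finset.mem_range.2 (hb x (Finset.mem_range.1 hx))
    · rw [Finset.card_insert_of_notMem h0, Finset.card_image_of_injOn hinj]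
      simp only [Finset.card_range]
      omega
  intro i hi
  have : i ∈ insert 0 ((Finset.range (k - 1)).image b) := heq ▸ Finset.mem_range.2 hi
  rcases Finset.mem_insert.1 this with h | h
  · exact Or.inl h
  · obtain ⟨x, hx, h⟩ := Finset.mem_image.1 h
    exact Or.inr ⟨x, Finset.mem_range.1 hx, h⟩

/-- Every target is linked to a source visited before, so the graph is connected, and k - 1 recorded
pairs on k terminals leave no room for a cycle. -/
theorem steinerTree_of_prim {n k s : ℕ} {t : Fin k ↪ Fin n} (hk : 0 < k)
    {w : Fin n → Fin n → ℝ} (hw : IsMetric w) {σ : State} {tab : ℕ → ℕ → ℝ} {a b : ℕ → ℕ}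
    {val : ℕ → ℝ} (h3 : σ.nat 3 0 = k - 1)
    (h4 : ∀ x < k - 1, σ.nat 4 x = terminal t hk (a x))
    (h5 : ∀ x < k - 1, σ.nat 5 x = terminal t hk (b x))
    (hstep : ∀ x < k - 1, PrimStep k s tab a b val x) :
    IsSteinerTree (Finset.univ.map t) (σ.graph (Finset.univ.map t)) ∧
      cost w (σ.graph (Finset.univ.map t)) ≤
        ∑ x ∈ Finset.range (k - 1), w (terminal t hk (a x)) (terminal t hk (b x)) := by
  set T := Finset.univ.map t with hT
  set H := σ.graph T with hH
  have hterm : ∀ i, terminal t hk i ∈ T := by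
    intro i
    unfold terminal
    split_ifs <;> simp [hT]
  have hverts : H.verts = T := by
    ext v
    constructor
    · rintro (h | ⟨j, hj, h | h⟩)
      · exact h
      · rw [h3] at hj
        rw [h4 j hj] at h
        rw [← Fin.ext h]; exact hterm _
      · rw [h3] at hj
        rw [h5 j hj] at h
        rw [← Fin.ext h]; exact hterm _
    · exact fun h => Or.inl h
  have hadj : ∀ u v, H.Adj u v → ∃ j ∈ Finset.range (k - 1),
      (terminal t hk (a j) = u ∧ terminal t hk (b j) = v) ∨
      (terminal t hk (a j) = v ∧ terminal t hk (b j) = u) := by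
    rintro u v ⟨-, j, hj, h⟩
    rw [h3] at hj
    rw [h4 j hj, h5 j hj] at h
    refine ⟨j, Finset.mem_range.2 hj, ?_⟩
    rcases h with h | h
    · exact Or.inl ⟨Fin.ext h.1, Fin.ext h.2⟩
    · exact Or.inr ⟨Fin.ext h.1, Fin.ext h.2⟩
  have hmem : ∀ i, terminal t hk i ∈ H.verts := fun i => by rw [hverts]; exact hterm i
  have hreach : ∀ x ≤ k - 1, ∀ i, Visited b x i →
      H.coe.Reachable ⟨terminal t hk i, hmem i⟩ ⟨terminal t hk 0, hmem 0⟩ := by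
    intro x
    induction x with
    | zero =>
      rintro - i (rfl | ⟨y, hy, -⟩)
      · exact SimpleGraph.Reachable.refl _
      · omega
    | succ x ih =>
      rintro hx i (rfl | ⟨y, hy, rfl⟩)
      · exact SimpleGraph.Reachable.refl _
      · by_cases hyx : y = x
        · subst hyx
          refine SimpleGraph.Reachable.trans ?_ (ih (by omega) _ (hstep y hx).source)
          by_cases he : terminal t hk (b y) = terminal t hk (a y)
          · rw [show (⟨terminal t hk (b y), hmem (b y)⟩ : H.verts) =
              ⟨terminal t hk (a y), hmem (a y)⟩ from Subtype.ext he]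
          · refine SimpleGraph.Adj.reachable ?_
            refine ⟨he, y, by omega, Or.inr ?_⟩
            exact ⟨h4 y hx, h5 y hx⟩
        · exact ih (by omega) _ (Or.inr ⟨y, by omega, rfl⟩)
  have hall := visited_all hk (fun x hx => (hstep x hx).target_lt)
    (fun x hx => (hstep x hx).target)
  have hr : ∀ v : H.verts, H.coe.Reachable v ⟨terminal t hk 0, hmem 0⟩ := by
    rintro ⟨v, hv⟩
    have : v ∈ T := by rw [hverts] at hv; exact hv
    simp only [hT, Finset.mem_map, Finset.mem_univ, true_and] at this
    obtain ⟨i, rfl⟩ := this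
    have := hreach _ le_rfl i (hall i i.2)
    simpa [terminal] using this
  have : Nonempty H.verts := ⟨⟨_, hmem 0⟩⟩
  have hconn : H.coe.Connected := ⟨fun u v => (hr u).trans (hr v).symm⟩
  refine ⟨⟨fun v hv => Or.inl hv, isTree_of_indexed hverts ?_ hadj hconn⟩,
    cost_le_of_indexed hw hadj⟩
  simp [hT]
  omega

/-- For α > 2k the table plays no role. Otherwise the detour lengths lie between the true distances
and the weights of the comparison graph on nearby samples, and `prim_cost_le` compares the totals.
-/
theorem isApprox_of_prim {n k s : ℕ} {t : Fin k ↪ Fin n} (hk : 0 < k)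
    {w : Fin n → Fin n → ℝ} (hw : IsMetric w) {σ : State} {tab : ℕ → ℕ → ℝ} {a b : ℕ → ℕ}
    {val : ℕ → ℝ} (h3 : σ.nat 3 0 = k - 1)
    (h4 : ∀ x < k - 1, σ.nat 4 x = terminal t hk (a x))
    (h5 : ∀ x < k - 1, σ.nat 5 x = terminal t hk (b x))
    (hstep : ∀ x < k - 1, PrimStep k s tab a b val x) {α : ℝ} {p : ℕ → ℕ} (hp : ∀ i, p i < k)
    (hpsurj : ∀ v < k, ∃ i < k, p i = v)
    (hpath : ∀ H : Graph n, IsSteinerTree (Finset.univ.map t) H →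
        ∑ i ∈ Finset.range (k - 1), w (terminal t hk (p i)) (terminal t hk (p (i + 1))) ≤
          2 * cost w H)
    (hcase : 2 * k < α ∨ ∃ (samp : ℕ → ℕ) (L : ℕ), (∀ q < s, samp q < k) ∧
      (∀ q < s, ∀ j < k, tab q j = w (terminal t hk (samp q)) (terminal t hk j)) ∧
      12 * L + 2 ≤ α ∧ L + 1 ≤ k ∧
      ∀ c, c + (L + 1) ≤ k → ∃ i, c ≤ i ∧ i < c + (L + 1) ∧ ∃ q < s, samp q = p i) :
    IsApproxSteinerTree α w (Finset.univ.map t) (σ.graph (Finset.univ.map t)) := by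
  classical
  obtain ⟨htree, hcost⟩ := steinerTree_of_prim hk hw h3 h4 h5 hstep
  refine ⟨htree, fun H hH => hcost.trans ?_⟩
  have hP := hpath H hH
  let D : ℕ → ℕ → ℝ := fun i j => w (terminal t hk i) (terminal t hk j)
  let d : ℕ → ℕ → ℝ := fun i j => D (p i) (p j)
  have hDnn : ∀ i j, 0 ≤ D i j := fun i j => hw.nonneg _ _
  have hDs : ∀ i j, D i j = D j i := fun i j => hw.symm _ _
  have hDt : ∀ i j l, D i l ≤ D i j + D j l := fun i j l => hw.triangle _ _ _
  have hD0 : ∀ i, D i i = 0 := fun i => hw.self _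
  have hd0 : ∀ i, d i i = 0 := fun i => hw.self _
  have hdt : ∀ i j l, d i l ≤ d i j + d j l := fun i j l => hw.triangle _ _ _
  have hP0 : 0 ≤ ∑ i ∈ Finset.range (k - 1), d i (i + 1) := Finset.sum_nonneg fun i _ => hDnn _ _
  change ∑ i ∈ Finset.range (k - 1), d i (i + 1) ≤ 2 * cost w H at hP
  have hk1 : (1 : ℝ) ≤ k := by exact_mod_cast hk
  rcases hcase with hα | ⟨samp, L, hsamp, htab, hL, hLk, hhit⟩
  -- Two terminals are no farther apart than the whole path is long, which is at most twice the cost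
  -- of `H`; the tree has k - 1 edges.
  · have hle : ∀ i j, i ≤ j → j < k → d i j ≤ 2 * cost w H := by
      intro i j hij hj
      refine (le_sum_Ico hd0 hdt hij).trans (le_trans
        (Finset.sum_le_sum_of_subset_of_nonneg ?_ fun x _ _ => hDnn _ _) hP)
      intro x hx
      simp only [Finset.mem_Ico, Finset.mem_range] at hx ⊢
      omega
    have hle' : ∀ i < k, ∀ j < k, D i j ≤ 2 * cost w H := by
      intro i hi j hj
      obtain ⟨i, hi', rfl⟩ := hpsurj i hi
      obtain ⟨j, hj', rfl⟩ := hpsurj j hj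
      rcases le_total i j with h | h
      · exact hle i j h hj'
      · rw [hDs]; exact hle j i h hi'
    have h1 : ∑ x ∈ Finset.range (k - 1), D (a x) (b x) ≤
        ∑ x ∈ Finset.range (k - 1), 2 * cost w H := by
      refine Finset.sum_le_sum fun x hx => ?_
      rw [Finset.mem_range] at hx
      exact hle' _ (hstep x hx).source_lt _ (hstep x hx).target_lt
    refine h1.trans ?_
    rw [Finset.sum_const, Finset.card_range, nsmul_eq_mul]
    have h2 : ((k - 1 : ℕ) : ℝ) ≤ k := by exact_mod_cast Nat.sub_le _ _
    nlinarith
  · have hnear : ∀ i, ∃ j, i < k → j < k ∧ j ≤ i + L ∧ i ≤ j + L ∧ ∃ q < s, samp q = p j := by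
      intro i
      by_cases hi : i < k
      · obtain ⟨j, h1, h2, h6⟩ := hhit (min i (k - (L + 1))) (by omega)
        exact ⟨j, fun _ => ⟨by omega, by omega, by omega, h6⟩⟩
      · exact ⟨0, fun h => absurd h hi⟩
    choose near hnear using hnear
    have hval : ∀ x < k - 1, D (a x) (b x) ≤ val x := by
      intro x hx
      obtain ⟨q, hq, e⟩ := (hstep x hx).value
      rw [e, htab q hq _ (hstep x hx).source_lt, htab q hq _ (hstep x hx).target_lt]
      change D (a x) (b x) ≤ D (samp q) (a x) + D (samp q) (b x)
      rw [hDs (samp q) (a x)]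
      exact hDt _ _ _
    -- The comparison graph: left indices join a position to its nearby sample, right indices join
    -- the samples near consecutive positions.
    let e₁ : ℕ ⊕ ℕ → ℕ := Sum.elim p fun i => p (near i)
    let e₂ : ℕ ⊕ ℕ → ℕ := Sum.elim (fun i => p (near i)) fun i => p (near (i + 1))
    let F : Finset (ℕ ⊕ ℕ) := (Finset.range k).disjSum (Finset.range (k - 1))
    have hsum : ∑ e ∈ F, D (e₁ e) (e₂ e) ≤ (6 * L + 1) * ∑ i ∈ Finset.range (k - 1), d i (i + 1) := by
      rw [Finset.sum_disjSum]
      exact sum_comparison_le (d := d) (fun i j => hDnn _ _) hd0 (fun i j => hDs _ _) hdt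
        (fun i hi => (hnear i hi).1) (fun i hi => (hnear i hi).2.1)
        (fun i hi => (hnear i hi).2.2.1)
    have hlink : ∀ i < k, EdgeRel e₁ e₂ F (p i) (p (near i)) := fun i hi =>
      ⟨Sum.inl i, by simp [F, hi], Or.inl ⟨rfl, rfl⟩⟩
    have hnext : ∀ i, i + 1 < k →
        Relation.ReflTransGen (EdgeRel e₁ e₂ F) (p (i + 1)) (p i) := by
      intro i hi
      have h6 : EdgeRel e₁ e₂ F (p (near (i + 1))) (p (near i)) :=
        ⟨Sum.inr i, by simp [F]; omega, Or.inr ⟨rfl, rfl⟩⟩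
      exact ((Relation.ReflTransGen.single (hlink (i + 1) hi)).tail h6).tail
        (hlink i (by omega)).symm
    have hzero : ∀ i < k, Relation.ReflTransGen (EdgeRel e₁ e₂ F) (p i) (p 0) := by
      intro i
      induction i with
      | zero => exact fun _ => Relation.ReflTransGen.refl
      | succ i ih => exact fun hi => (hnext i hi).trans (ih (by omega))
    have : Std.Symm (EdgeRel e₁ e₂ F) := ⟨fun _ _ h => h.symm⟩
    have hsymm : Std.Symm (Relation.ReflTransGen (EdgeRel e₁ e₂ F)) := inferInstance
    have hconn : ∀ z, z < k → Relation.ReflTransGen (EdgeRel e₁ e₂ F) z 0 := by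
      intro z hz
      obtain ⟨i, hi, rfl⟩ := hpsurj z hz
      obtain ⟨j, hj, hj0⟩ := hpsurj 0 hk
      have := hsymm.symm _ _ (hzero j hj)
      rw [hj0] at this
      exact (hzero i hi).trans this
    have hprim := prim_cost_le (F := F) (c := fun e => D (e₁ e) (e₂ e)) (fun e => hDnn _ _)
      (U := fun z => z < k) (b := b) (val := val) (m := k - 1)
      (fun x hx => (hstep x hx).target_lt) (fun x hx => (hstep x hx).target) ?_ hconn
    · refine (Finset.sum_le_sum fun x hx => hval x (Finset.mem_range.1 hx)).trans
        (hprim.trans (hsum.trans ?_))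
      have hL0 : (0 : ℝ) ≤ L := Nat.cast_nonneg _
      nlinarith
    · intro x hx e he hcross
      have hmin := (hstep x hx).minimal
      -- The detour via a sample that is itself one end of the edge has the true length, since one
      -- of its two legs is 0.
      have hsam : ∀ i < k, ∀ j < k, (Visited b x (p i) ∧ ¬ Visited b x (p (near j))) ∨
          (Visited b x (p (near j)) ∧ ¬ Visited b x (p i)) →
          val x ≤ D (p i) (p (near j)) := by
        intro i hi j hj hc
        obtain ⟨-, -, -, q, hq, hqe⟩ := hnear j hj
        have h6 : ∀ u < k, tab q u = D (p (near j)) u := fun u hu => by rw [← hqe]; exact htab q hq u hu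
        rcases hc with ⟨g1, g2⟩ | ⟨g1, g2⟩
        · have := hmin _ (hp i) _ (hp (near j)) g1 g2 q hq
          rw [h6 _ (hp i), h6 _ (hp (near j)), hD0, hDs] at this
          linarith
        · have := hmin _ (hp (near j)) _ (hp i) g1 g2 q hq
          rw [h6 _ (hp i), h6 _ (hp (near j)), hD0, hDs _ (p i)] at this
          linarith
      rcases e with i | i
      · have hi : i < k := by simpa [F] using he
        exact hsam i hi i hi (hcross.imp id id)
      · have hi : i < k - 1 := by simpa [F] using he
        exact hsam (near i) (hnear i (by omega)).1 (i + 1) (by omega) (hcross.imp id id)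

open scoped ENNReal

/-! ### Probability of missing a set of terminals -/

theorem toOuterMeasure_bind_le {A B : Type*} (p : PMF A) (f : A → PMF B) (S : Set B) {x : ℝ≥0∞}
    (h : ∀ a ∈ p.support, (f a).toOuterMeasure S ≤ x) : (p.bind f).toOuterMeasure S ≤ x := by
  rw [PMF.toOuterMeasure_bind_apply]
  calc ∑' a, p a * (f a).toOuterMeasure S ≤ ∑' a, p a * x := by
        refine ENNReal.tsum_le_tsum fun a => ?_
        by_cases ha : p a = 0
        · simp [ha]
        · exact mul_le_mul_right (h a ((PMF.mem_support_iff p a).2 ha)) _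
    _ = x := by rw [ENNReal.tsum_mul_right, p.tsum_coe, one_mul]

/-- All failure is blamed on the first stage: outside `M` the second stage never ends in `S`. -/
theorem toOuterMeasure_bind_le_of_imp {A B : Type*} (p : PMF A) (f : A → PMF B) (M : Set A)
    (S : Set B) (h : ∀ a ∈ p.support, a ∉ M → ∀ b ∈ (f a).support, b ∉ S) :
    (p.bind f).toOuterMeasure S ≤ p.toOuterMeasure M := by
  classical
  rw [PMF.toOuterMeasure_bind_apply, PMF.toOuterMeasure_apply]
  refine ENNReal.tsum_le_tsum fun a => ?_
  by_cases ha : p a = 0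
  · simp [ha]
  by_cases haM : a ∈ M
  · rw [Set.indicator_of_mem haM]
    refine mul_le_of_le_one_right (zero_le) ?_
    rw [PMF.toOuterMeasure_apply]
    refine (ENNReal.tsum_le_tsum fun b => Set.indicator_le_self' (fun _ _ => zero_le) b).trans ?_
    exact (PMF.tsum_coe _).le
  · have : (f a).toOuterMeasure S = 0 := by
      rw [PMF.toOuterMeasure_apply_eq_zero_iff, Set.disjoint_left]
      exact h a ((PMF.mem_support_iff p a).2 ha) haM
    rw [this, mul_zero]
    exact zero_le

theorem le_toOuterMeasure_of_compl {A : Type*} (p : PMF A) (S : Set A) {x : ℝ} (hx : 0 ≤ x)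
    (h : p.toOuterMeasure Sᶜ ≤ ENNReal.ofReal x) :
    ENNReal.ofReal (1 - x) ≤ p.toOuterMeasure S := by
  rw [ENNReal.ofReal_sub _ hx, ENNReal.ofReal_one, tsub_le_iff_right]
  have h1 : p.toOuterMeasure Set.univ = 1 := by
    rw [PMF.toOuterMeasure_apply_eq_one_iff]; exact Set.subset_univ _
  rw [← h1, ← Set.union_compl_self S]
  exact (MeasureTheory.measure_union_le _ _).trans (add_le_add_right h _)

/-- One round of sampling. -/
def drawStep : Prog := .seq (.rand 6 (.var 15) (.sub (.var 1) (.lit 1))) (.inc 15)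

-- Induction over the remaining draws: each avoids `W` with probability (k - |W|)/k, independently
-- of the past, and an earlier hit makes a miss impossible.
open Classical in
theorem miss_iterate_le (o : ℕ → ℕ → ℝ) {k : ℕ} (hk : 0 < k) {W : Finset ℕ}
    (hW : W ⊆ Finset.range k) (m : ℕ) : ∀ (c : ℕ) (σ : State), σ.nat 1 0 = k → σ.nat 15 0 = c →
    (iterate (drawStep.run o) m σ).toOuterMeasure {σ' | ∀ q < c + m, σ'.nat 6 q ∉ W} ≤
      if ∀ q < c, σ.nat 6 q ∉ W then (((k - W.card : ℕ) : ℝ≥0∞) / k) ^ m else 0 := by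
  induction m with
  | zero =>
    intro c σ h1 h15
    rw [iterate, PMF.toOuterMeasure_pure_apply]
    simp
  | succ m ih =>
    intro c σ h1 h15
    let st : ℕ → State := fun r =>
      (((σ.tick.writeNat 6 c r).tick).writeNat 15 0 (c + 1)).tick
    have hrun : iterate (drawStep.run o) (m + 1) σ =
        (PMF.uniformOfFintype (Fin ((k - 1) + 1))).bind
          fun r => iterate (drawStep.run o) m (st r) := by
      have hx : (NExp.sub (.var 1) (.lit 1)).eval σ.tick = k - 1 := by
        simp [NExp.eval, h1]
      have hbody : drawStep.run o σ.tick = (PMF.uniformOfFintype (Fin ((k - 1) + 1))).bind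
          fun r => PMF.pure (st r) := by
        change ((Prog.rand 6 (.var 15) (.sub (.var 1) (.lit 1))).run o σ.tick).bind
          ((Prog.inc 15).run o) = _
        rw [run_rand, hx, PMF.bind_map]
        congr 1
        funext r
        simp [Prog.run, NExp.eval, h15, st]
      rw [iterate, hbody, PMF.bind_bind]
      simp only [PMF.pure_bind]
    rw [hrun, PMF.toOuterMeasure_bind_apply, tsum_fintype]
    have hst : ∀ r : Fin ((k - 1) + 1),
        (iterate (drawStep.run o) m (st r)).toOuterMeasure
          {σ' | ∀ q < c + (m + 1), σ'.nat 6 q ∉ W} ≤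
        if (∀ q < c, σ.nat 6 q ∉ W) ∧ (r : ℕ) ∉ W then
          (((k - W.card : ℕ) : ℝ≥0∞) / k) ^ m else 0 := by
      intro r
      have := ih (c + 1) (st r) (by simp [st, h1]) (by simp [st])
      rw [show c + 1 + m = c + (m + 1) by omega] at this
      refine this.trans (le_of_eq ?_)
      refine if_congr ?_ rfl rfl
      have hst6 : ∀ q, (st r).nat 6 q = if q = c then (r : ℕ) else σ.nat 6 q := by
        intro q; simp [st]
      simp only [hst6]
      constructor
      · intro h
        refine ⟨fun q hq => ?_, ?_⟩
        · have := h q (by omega)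
          rwa [if_neg hq.ne] at this
        · have := h c (by omega)
          rwa [if_pos rfl] at this
      · rintro ⟨h2, h3⟩ q hq
        by_cases hqc : q = c
        · rwa [if_pos hqc]
        · rw [if_neg hqc]; exact h2 q (by omega)
    refine (Finset.sum_le_sum fun r _ => mul_le_mul_right (hst r) _).trans ?_
    simp only [PMF.uniformOfFintype_apply, Fintype.card_fin]
    rw [Nat.sub_add_cancel hk]
    by_cases hc : ∀ q < c, σ.nat 6 q ∉ W
    · rw [if_pos hc]
      simp only [eq_true hc, true_and]
      rw [← Finset.mul_sum, Fin.sum_univ_eq_sum_range (fun r => if r ∉ W then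
        (((k - W.card : ℕ) : ℝ≥0∞) / k) ^ m else 0), ← Finset.sum_filter,
        Finset.sum_const, nsmul_eq_mul]
      have hcard : ((Finset.range k).filter fun r => r ∉ W).card = k - W.card := by
        rw [← Finset.sdiff_eq_filter, Finset.card_sdiff_of_subset hW, Finset.card_range]
      rw [hcard, pow_succ, div_eq_mul_inv]
      apply le_of_eq
      ring
    · rw [if_neg hc]
      simp only [eq_false hc, false_and, if_false, mul_zero, Finset.sum_const_zero, le_refl]

theorem miss_drawSamples_le {o : ℕ → ℕ → ℝ} {σ : State} (hk : 0 < σ.nat 1 0) {W : Finset ℕ}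
    (hW : W ⊆ Finset.range (σ.nat 1 0)) (h15 : σ.nat 15 0 = 0) :
    (drawSamples.run o σ).toOuterMeasure {σ' | ∀ q < σ.nat 13 0, σ'.nat 6 q ∉ W} ≤
      (((σ.nat 1 0 - W.card : ℕ) : ℝ≥0∞) / σ.nat 1 0) ^ (σ.nat 13 0) := by
  have := miss_iterate_le o hk hW (σ.nat 13 0) 0 σ.tick rfl h15
  rw [if_pos fun q hq => absurd hq (Nat.not_lt_zero q), zero_add] at this
  exact this

/-- The probability that the samples miss some window of length `B` on the path `p`. -/
theorem miss_window_le {o : ℕ → ℕ → ℝ} {σ : State} (hk : 0 < σ.nat 1 0) (h15 : σ.nat 15 0 = 0)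
    {p : ℕ → ℕ} (hp : ∀ i, p i < σ.nat 1 0) (hinj : Set.InjOn p (Set.Iio (σ.nat 1 0))) (B : ℕ)
    (hB : 0 < B) :
    (drawSamples.run o σ).toOuterMeasure {σ' | ∃ c, c + B ≤ σ.nat 1 0 ∧
      ∀ q < σ.nat 13 0, ∀ i, c ≤ i → i < c + B → σ'.nat 6 q ≠ p i} ≤
      σ.nat 1 0 * (((σ.nat 1 0 - B : ℕ) : ℝ≥0∞) / σ.nat 1 0) ^ (σ.nat 13 0) := by
  classical
  set k := σ.nat 1 0 with hkdef
  set x : ℝ≥0∞ := (((k - B : ℕ) : ℝ≥0∞) / k) ^ (σ.nat 13 0) with hx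
  have hsub : {σ' : State | ∃ c, c + B ≤ k ∧
      ∀ q < σ.nat 13 0, ∀ i, c ≤ i → i < c + B → σ'.nat 6 q ≠ p i} ⊆
      ⋃ c ∈ (Finset.range k).filter (fun c => c + B ≤ k),
        {σ' : State | ∀ q < σ.nat 13 0, σ'.nat 6 q ∉ (Finset.Ico c (c + B)).image p} := by
    rintro σ' ⟨c, hc, h⟩
    simp only [Set.mem_iUnion]
    refine ⟨c, by simp; omega, fun q hq hmem => ?_⟩
    obtain ⟨i, hi, e⟩ := Finset.mem_image.1 hmem
    rw [Finset.mem_Ico] at hi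
    exact h q hq i hi.1 hi.2 e.symm
  refine (MeasureTheory.measure_mono hsub).trans
    ((MeasureTheory.measure_biUnion_finset_le _ _).trans ?_)
  have hb : ∀ c ∈ (Finset.range k).filter (fun c => c + B ≤ k),
      (drawSamples.run o σ).toOuterMeasure
        {σ' : State | ∀ q < σ.nat 13 0, σ'.nat 6 q ∉ (Finset.Ico c (c + B)).image p} ≤ x := by
    intro c hc
    have hc' := (Finset.mem_filter.1 hc).2
    have hW : (Finset.Ico c (c + B)).image p ⊆ Finset.range k := by
      intro y hy
      obtain ⟨i, -, rfl⟩ := Finset.mem_image.1 hy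
      exact Finset.mem_range.2 (hp i)
    -- Injectivity of `p` makes the `B` positions of the window `B` different terminals.
    have hcard : ((Finset.Ico c (c + B)).image p).card = B := by
      rw [Finset.card_image_of_injOn, Nat.card_Ico]
      · omega
      · refine hinj.mono fun i hi => ?_
        simp only [Finset.coe_Ico, Set.mem_Ico] at hi
        exact Set.mem_Iio.2 (by omega)
    have := miss_drawSamples_le (o := o) hk hW h15
    rwa [hcard] at this
  refine (Finset.sum_le_sum hb).trans ?_
  rw [Finset.sum_const, nsmul_eq_mul]
  refine mul_le_mul_left ?_ _
  have : ((Finset.range k).filter (fun c => c + B ≤ k)).card ≤ k := by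
    simpa using Finset.card_filter_le (Finset.range k) (fun c => c + B ≤ k)
  exact_mod_cast this

/-- Enough samples hit all windows with high probability. -/
theorem miss_bound {n k d s₀ L B s : ℕ} {α : ℝ} (hk : 0 < k) (hkn : k ≤ n)
    (hBk : B ≤ k) (hB : α / 14 ≤ B) (hs₀ : (k : ℝ) ≤ s₀ * α) (hL : n < 2 ^ L)
    (hs : s = s₀ * (L * (14 * (d + 1)))) :
    (k : ℝ≥0∞) * (((k - B : ℕ) : ℝ≥0∞) / k) ^ s ≤ ENNReal.ofReal (1 / (n : ℝ) ^ d) := by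
  have hk' : (0 : ℝ) < k := by exact_mod_cast hk
  have hn' : (0 : ℝ) < n := by exact_mod_cast lt_of_lt_of_le hk hkn
  have hfrac : ((k - B : ℕ) : ℝ≥0∞) / k = ENNReal.ofReal (1 - B / k) := by
    rw [← ENNReal.ofReal_natCast, ← ENNReal.ofReal_natCast k, ← ENNReal.ofReal_div_of_pos hk',
      Nat.cast_sub hBk]
    congr 1
    field_simp
  have hBk' : (B : ℝ) / k ≤ 1 := by
    rw [div_le_one hk']; exact_mod_cast hBk
  rw [hfrac, ← ENNReal.ofReal_pow (by linarith), ← ENNReal.ofReal_natCast k,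
    ← ENNReal.ofReal_mul hk'.le]
  apply ENNReal.ofReal_le_ofReal
  have h1 : (1 - (B : ℝ) / k) ^ s ≤ Real.exp (-(B / k)) ^ s := by
    apply pow_le_pow_left₀ (by linarith)
    have := Real.add_one_le_exp (-((B : ℝ) / k))
    linarith
  -- The factor 14 in the number of samples cancels the 14 in B ≥ α/14. The exponent L(d + 1) then
  -- gives n^(-(d + 1)) per window, and one power of n pays for the union bound over at most k
  -- windows.
  have h2 : ((L * (d + 1) : ℕ) : ℝ) ≤ s * (B / k) := by
    rw [hs]
    push_cast
    have h3 : (1 : ℝ) ≤ s₀ * 14 * (B / k) := by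
      rw [mul_div_assoc', le_div_iff₀ hk']
      have h4 : (s₀ : ℝ) * α ≤ s₀ * (14 * B) := by
        apply mul_le_mul_of_nonneg_left _ (Nat.cast_nonneg _)
        linarith
      linarith
    have h5 : (0 : ℝ) ≤ L * (d + 1) := by positivity
    nlinarith
  have h3 : Real.exp (-(B / k)) ^ s ≤ 1 / (n : ℝ) ^ (d + 1) := by
    rw [← Real.exp_nat_mul, mul_neg, Real.exp_neg, one_div]
    apply inv_anti₀ (by positivity)
    calc (n : ℝ) ^ (d + 1) ≤ ((2 : ℝ) ^ L) ^ (d + 1) := by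
          gcongr
          exact_mod_cast hL.le
      _ = 2 ^ (L * (d + 1)) := (pow_mul _ _ _).symm
      _ ≤ Real.exp 1 ^ (L * (d + 1)) := by
          gcongr
          have := Real.add_one_le_exp 1
          linarith
      _ = Real.exp ((L * (d + 1) : ℕ) : ℝ) := by rw [← Real.exp_nat_mul, mul_one]
      _ ≤ _ := Real.exp_le_exp.2 h2
  calc (k : ℝ) * (1 - B / k) ^ s ≤ n * (1 / (n : ℝ) ^ (d + 1)) := by
        gcongr
        exact h1.trans h3
    _ = 1 / (n : ℝ) ^ d := by
        rw [pow_succ]; field_simp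

/-! ### The upper bound -/

/-- The state before and after the sampling. -/
structure Ready {n k : ℕ} (t : Fin k ↪ Fin n) (d : ℕ) (α : ℝ) (σ : State) : Prop where
  count : σ.nat 1 0 = k
  terminals : ∀ (i : ℕ) (h : i < k), σ.nat 2 i = t ⟨i, h⟩
  zero₃ : σ.nat 3 0 = 0
  zero₁₆ : σ.nat 16 0 = 0
  visited : ∀ i, 0 < σ.nat 7 i ↔ i = 0
  edges : σ.nat 25 0 = k - 1
  queries : σ.queries = 0
  samples : (2 * k < α ∧ σ.nat 13 0 = 1 ∧ σ.nat 14 0 = 0) ∨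
    (α ≤ 2 * k ∧ σ.nat 14 0 = σ.nat 13 0 ∧ ∃ s₀ L : ℕ,
      σ.nat 13 0 = s₀ * (L * (14 * (d + 1))) ∧ s₀ ≤ k ∧ 1 ≤ s₀ ∧ (k : ℝ) ≤ s₀ * α ∧
      (s₀ - 1) * α < k ∧ L ≤ n ∧ 1 ≤ L ∧ n < 2 ^ L ∧ 2 ^ L ≤ 2 * n)

theorem wp_setup {o : ℕ → ℕ → ℝ} {n k : ℕ} (t : Fin k ↪ Fin n) (hk : 0 < k) {α : ℝ}
    (hα : 2 ≤ α) (hn : 1 ≤ n) : setup.wp o (fun σ => setup.Same (initial t α) σ ∧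
      σ.real 2 0 = k ∧ σ.queries = 0 ∧
      σ.nat 10 0 ≤ k ∧ 1 ≤ σ.nat 10 0 ∧ (k : ℝ) ≤ σ.nat 10 0 * α ∧ (σ.nat 10 0 - 1) * α < k ∧
      σ.nat 12 0 ≤ n ∧ 1 ≤ σ.nat 12 0 ∧ n < 2 ^ (σ.nat 12 0) ∧ 2 ^ (σ.nat 12 0) ≤ 2 * n)
      (initial t α) := by
  refine (wp_same setup _).and ?_
  rw [setup, wp_seq]
  refine ((wp_countTerminals.and (wp_same _ _)).and
    (wp_queryFree countTerminals (by simp [countTerminals, Prog.QueryFree]) _)).mono ?_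
  rintro σ1 ⟨⟨h1, hs1⟩, hq1⟩
  have i0 : (initial t α).nat 0 0 = n := by simp [initial]
  have i1 : (initial t α).nat 1 0 = k := by simp [initial]
  have r0 : (initial t α).real 0 0 = α := by simp [initial]
  have r2 : (initial t α).real 2 0 = 0 := by simp [initial]
  have r3 : (initial t α).real 3 0 = 0 := by simp [initial]
  have i10 : (initial t α).nat 10 0 = 0 := by simp [initial]
  have i12 : (initial t α).nat 12 0 = 0 := by simp [initial]
  have a0 : σ1.nat 0 0 = n := by rw [hs1.1 0 (by decide), i0]
  have a1 : σ1.nat 1 0 = k := by rw [hs1.1 1 (by decide), i1]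
  have a10 : σ1.nat 10 0 = 0 := by rw [hs1.1 10 (by decide), i10]
  have a12 : σ1.nat 12 0 = 0 := by rw [hs1.1 12 (by decide), i12]
  have b0 : σ1.real 0 0 = α := by rw [hs1.2 0 (by decide), r0]
  have b3 : σ1.real 3 0 = 0 := by rw [hs1.2 3 (by decide), r3]
  have b2 : σ1.real 2 0 = k := by rw [h1, r2, i1, zero_add]
  rw [wp_seq]
  refine (((wp_countBlocks (by rw [b0]; linarith) (by rw [b2, a1]) (by rw [a1]; exact hk) b3
    a10).and (wp_same _ _)).and
    (wp_queryFree countBlocks (by simp [countBlocks, Prog.QueryFree]) _)).mono ?_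
  rintro σ2 ⟨⟨⟨g1, g2, g3, g4⟩, hs2⟩, hq2⟩
  rw [a1, b0] at g3 g4
  rw [a1] at g1
  have c0 : σ2.nat 0 0 = n := by rw [hs2.1 0 (by decide), a0]
  have c12 : σ2.nat 12 0 = 0 := by rw [hs2.1 12 (by decide), a12]
  have d2 : σ2.real 2 0 = k := by rw [hs2.2 2 (by decide), b2]
  refine (((wp_countBits (by rw [c0]; exact hn) c12).and (wp_same _ _)).and
    (wp_queryFree countBits (by simp [countBits, Prog.QueryFree]) _)).mono ?_
  rintro σ3 ⟨⟨f, hs3⟩, hq3⟩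
  rw [c0] at f
  have e10 : σ3.nat 10 0 = σ2.nat 10 0 := by rw [hs3.1 10 (by decide)]
  rw [e10]
  exact ⟨by rw [hs3.2 2 (by decide), d2], by rw [hq3, hq2, hq1]; rfl, g1, g2, g3, g4, f⟩

theorem wp_prepare {o : ℕ → ℕ → ℝ} {n k : ℕ} (t : Fin k ↪ Fin n) (hk : 0 < k) {α : ℝ}
    (hα : 2 ≤ α) (hn : 1 ≤ n) (d : ℕ) :
    (Prog.seq setup (setup' (14 * (d + 1)))).wp o (fun σ => Ready t d α σ ∧ σ.nat 15 0 = 0)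
      (initial t α) := by
  rw [wp_seq]
  refine (wp_setup t hk hα hn).mono ?_
  rintro σ1 ⟨hs1, hK, hq1, g1, g2, g3, g4, g5, g6, g7, g8⟩
  have z : ∀ a, 3 ≤ a → ∀ i, (initial t α).nat a i = 0 := by
    intro a ha i
    have h0 : a ≠ 0 := by omega
    have h1 : a ≠ 1 := by omega
    have h2 : a ≠ 2 := by omega
    simp [initial, h0, h1, h2]
  have i1 : (initial t α).nat 1 0 = k := by simp [initial]
  have r0 : (initial t α).real 0 0 = α := by simp [initial]
  have a1 : σ1.nat 1 0 = k := by rw [hs1.1 1 (by decide), i1]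
  have a2 : σ1.nat 2 = (initial t α).nat 2 := hs1.1 2 (by decide)
  have b0 : σ1.real 0 0 = α := by rw [hs1.2 0 (by decide), r0]
  have b3 : σ1.nat 3 0 = 0 := by rw [hs1.1 3 (by decide), z 3 (by decide)]
  have b7 : ∀ i, σ1.nat 7 i = 0 := fun i => by rw [hs1.1 7 (by decide), z 7 (by decide)]
  have b13 : σ1.nat 13 0 = 0 := by rw [hs1.1 13 (by decide), z 13 (by decide)]
  have b14 : σ1.nat 14 0 = 0 := by rw [hs1.1 14 (by decide), z 14 (by decide)]
  have b15 : σ1.nat 15 0 = 0 := by rw [hs1.1 15 (by decide), z 15 (by decide)]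
  have b16 : σ1.nat 16 0 = 0 := by rw [hs1.1 16 (by decide), z 16 (by decide)]
  rw [setup', wp_seq]
  have hqf : (countSamples (14 * (d + 1))).QueryFree := by simp [countSamples, Prog.QueryFree]
  refine (((wp_countSamples _ b13 b14).and (wp_same _ _)).and (wp_queryFree _ hqf _)).mono ?_
  rintro σ2 ⟨⟨h, hs2⟩, hq2⟩
  rw [hK, b0] at h
  have hqf' : initTree.QueryFree := by simp [initTree, Prog.QueryFree]
  refine ((wp_initTree.and (wp_same _ _)).and (wp_queryFree _ hqf' _)).mono ?_
  rintro σ3 ⟨⟨⟨h25, h7⟩, hs3⟩, hq3⟩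
  have w2 : ∀ a ∉ (countSamples (14 * (d + 1))).natWrites, a ∉ initTree.natWrites →
      σ3.nat a = σ1.nat a := fun a h h' => (hs3.1 a h').trans (hs2.1 a h)
  have hw : (countSamples (14 * (d + 1))).natWrites = {13, 14} := by
    simp only [countSamples, Prog.natWrites]; decide
  have hw' : initTree.natWrites = {7, 25} := by decide
  rw [hw, hw'] at w2
  have e7 : ∀ i, σ2.nat 7 i = 0 := fun i => by rw [hs2.1 7 (by rw [hw]; decide)]; exact b7 i
  refine ⟨?_, by rw [w2 15 (by decide) (by decide), b15]⟩
  constructor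
  · rw [w2 1 (by decide) (by decide), a1]
  · intro i hi
    rw [w2 2 (by decide) (by decide), a2]
    simp [initial, hi]
  · rw [w2 3 (by decide) (by decide), b3]
  · rw [w2 16 (by decide) (by decide), b16]
  · intro i
    rw [h7, e7]
    split_ifs with hi <;> simp [hi]
  · rw [h25, hs2.1 1 (by rw [hw]; decide), a1]
  · rw [hq3, hq2, hq1]
  · have f13 : σ3.nat 13 = σ2.nat 13 := hs3.1 13 (by decide)
    have f14 : σ3.nat 14 = σ2.nat 14 := hs3.1 14 (by decide)
    rw [f13, f14]
    split_ifs at h with hc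
    · exact Or.inl ⟨by linarith, h⟩
    · exact Or.inr ⟨by linarith, by rw [h.1, h.2], _, _, h.1, g1, g2, g3, g4, g5, g6, g7, g8⟩

/-- The samples in the state `σ` hit all windows of length `B` of the path `p`. -/
def HitsWindows (k B : ℕ) (p : ℕ → ℕ) (σ : State) : Prop :=
  ∀ c, c + B ≤ k → ∃ i, c ≤ i ∧ i < c + B ∧ ∃ q < σ.nat 13 0, σ.nat 6 q = p i

/-- After the sampling nothing is random any more: samples that hit all windows guarantee a good
tree. -/
theorem wp_buildTree {n k : ℕ} {t : Fin k ↪ Fin n} (hk : 0 < k) {d : ℕ} {α : ℝ}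
    {w : Fin n → Fin n → ℝ} (hw : IsMetric w) {σ : State} (h : Ready t d α σ)
    (h6 : ∀ q < σ.nat 13 0, σ.nat 6 q < k) {p : ℕ → ℕ} (hp : ∀ i, p i < k)
    (hpsurj : ∀ v < k, ∃ i < k, p i = v)
    (hpath : ∀ H : Graph n, IsSteinerTree (Finset.univ.map t) H →
        ∑ i ∈ Finset.range (k - 1), w (terminal t hk (p i)) (terminal t hk (p (i + 1))) ≤
          2 * cost w H) {L : ℕ} (hL : 12 * L + 2 ≤ α) :
    buildTree.wp (oracle w) (fun σ' => σ'.queries = σ.nat 14 0 * k ∧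
      (2 * k < α ∨ (L + 1 ≤ k ∧ HitsWindows k (L + 1) p σ) →
        IsApproxSteinerTree α w (Finset.univ.map t) (σ'.graph (Finset.univ.map t)))) σ := by
  rw [buildTree, wp_seq]
  refine ((wp_queryTable h.zero₁₆).and (wp_same _ _)).mono ?_
  rintro σ1 ⟨⟨hq, htab⟩, hs⟩
  have e1 : σ1.nat 1 = σ.nat 1 := hs.1 1 (by decide)
  have e2 : σ1.nat 2 = σ.nat 2 := hs.1 2 (by decide)
  have e3 : σ1.nat 3 = σ.nat 3 := hs.1 3 (by decide)
  have e7 : σ1.nat 7 = σ.nat 7 := hs.1 7 (by decide)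
  have e13 : σ1.nat 13 = σ.nat 13 := hs.1 13 (by decide)
  have e25 : σ1.nat 25 = σ.nat 25 := hs.1 25 (by decide)
  have h13 : 1 ≤ σ.nat 13 0 := by
    rcases h.samples with ⟨-, g, -⟩ | ⟨-, -, s₀, L, g, -, g1, -, -, -, g2, -⟩
    · rw [g]
    · rw [g]
      exact Nat.mul_pos g1 (Nat.mul_pos g2 (by omega))
  have hterm : ∀ i < k, σ.nat 2 i = terminal t hk i := by
    intro i hi
    rw [h.terminals i hi]
    simp [terminal, hi]
  have horacle : ∀ u v : Fin n, oracle w u v = w u v := by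
    intro u v
    simp [oracle]
  refine ((wp_growTree (o := oracle w) (by rw [e13]; exact h13) (by rw [e25, e1, h.edges, h.count])
    (by rw [e3, h.zero₃]) (fun i => by rw [e7]; exact h.visited i)).and
    (wp_queryFree growTree (by simp [growTree, scan, scanStep, addEdge, Prog.QueryFree]) _)).mono ?_
  rintro σ2 ⟨hP, hq2⟩
  refine ⟨by rw [hq2, hq, h.queries, h.count, zero_add], fun hcase => ?_⟩
  obtain ⟨p3, -, p4, p5, pstep⟩ := hP
  rw [e1, h.count] at p3 p4 p5 pstep
  refine isApprox_of_prim hk hw p3 (a := σ2.nat 26) (b := σ2.nat 27) (fun x hx => ?_)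
    (fun x hx => ?_) pstep hp hpsurj hpath ?_
  · rw [p4 x hx, e2, hterm _ (pstep x hx).source_lt]
  · rw [p5 x hx, e2, hterm _ (pstep x hx).target_lt]
  · rcases hcase with hc | ⟨hLk, hhit⟩
    · exact Or.inl hc
    · rcases h.samples with ⟨hc, -, -⟩ | ⟨-, h14, -⟩
      · exact Or.inl hc
      · refine Or.inr ⟨σ.nat 6, L, ?_, ?_, hL, hLk, ?_⟩
        · rw [e13]; exact h6
        · rw [e13]
          intro q hq j hj
          have := htab q (by rw [h14]; exact hq) j (by rw [h.count]; exact hj)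
          rw [hterm _ (h6 q hq), hterm j hj, horacle] at this
          exact this
        · rw [e13]; exact hhit

theorem log_bound {n L : ℕ} (hn : 1 ≤ n) (hL : 2 ^ L ≤ 2 * n) : (L : ℝ) ≤ 2 * (1 + Real.log n) := by
  have hn' : (1 : ℝ) ≤ n := by exact_mod_cast hn
  have h1 : ((2 : ℝ) ^ L) ≤ 2 * n := by exact_mod_cast hL
  have h2 := Real.log_le_log (by positivity) h1
  rw [Real.log_pow, Real.log_mul (by norm_num) (by positivity)] at h2
  have h3 := Real.log_nonneg hn'
  have h4 := Real.log_two_gt_d9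
  have h5 := Real.log_two_lt_d9
  nlinarith

/-- There are three phases, each with loop bounds that were fixed before it starts. The largest
bound is the number of samples, at most 14(d + 1)n². -/
theorem wp_steps_total {o : ℕ → ℕ → ℝ} {n k : ℕ} (t : Fin k ↪ Fin n) (hk : 0 < k) {α : ℝ}
    (hα : 2 ≤ α) (hkn : k ≤ n) (d : ℕ) :
    (steinerProg (14 * (d + 1))).wp o (fun σ => σ.steps ≤
      (steinerProg (14 * (d + 1))).runtime (14 * (d + 1) * n ^ 2)) (initial t α) := by
  have hn : 1 ≤ n := by omega
  set M := 14 * (d + 1) * n ^ 2 with hM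
  have hnM : n ≤ M := by
    rw [hM]; nlinarith [Nat.zero_le d]
  have hkM : k ≤ M := hkn.trans hnM
  have h1M : 1 ≤ M := hn.trans hnM
  rw [steinerProg, wp_seq, wp_seq]
  have hb1 : setup.Bounded {0, 1} := by
    simp [setup, countTerminals, countBlocks, countBits, Prog.Bounded]
  have hb2 : (setup' (14 * (d + 1))).Bounded {10, 12} := by
    simp [setup', countSamples, initTree, Prog.Bounded]
  have hb3 : (Prog.seq drawSamples buildTree).Bounded {1, 13, 14, 25} := by
    simp [drawSamples, buildTree, queryTable, growTree, scan, scanStep, addEdge, Prog.Bounded]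
  have hst : setup.wp o _ (initial t α) := wp_steps (M := M) setup hb1 (initial t α) (by
    simp only [Finset.mem_insert, Finset.mem_singleton]
    rintro a (rfl | rfl)
    · simpa [initial] using hnM
    · simpa [initial] using hkM)
  have hready := wp_prepare (o := o) t hk hα hn d
  rw [wp_seq] at hready
  refine ((hst.and (wp_setup t hk hα hn)).and hready).mono ?_
  rintro σ1 ⟨⟨hs1, g⟩, hr⟩
  have hst2 := wp_steps (o := o) (M := M) (setup' (14 * (d + 1))) hb2 σ1 (by
    simp only [Finset.mem_insert, Finset.mem_singleton]
    rintro a (rfl | rfl)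
    · exact g.2.2.2.1.trans hkM
    · exact g.2.2.2.2.2.2.2.1.trans hnM)
  refine (hst2.and hr).mono ?_
  rintro σ2 ⟨hs2, hR, -⟩
  have h13 : σ2.nat 13 0 ≤ M ∧ σ2.nat 14 0 ≤ M := by
    rcases hR.samples with ⟨-, g1, g2⟩ | ⟨-, g1, s₀, L, g2, g3, -, -, -, g4, -⟩
    · rw [g1, g2]; exact ⟨h1M, by omega⟩
    · rw [g1]
      have : σ2.nat 13 0 ≤ M := by
        rw [g2, hM]
        calc s₀ * (L * (14 * (d + 1))) ≤ n * (n * (14 * (d + 1))) := by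
              gcongr
              exact g3.trans hkn
          _ = _ := by ring
      exact ⟨this, this⟩
  refine (wp_steps (o := o) (M := M) (Prog.seq drawSamples buildTree) hb3 σ2 ?_).mono ?_
  · simp only [Finset.mem_insert, Finset.mem_singleton]
    rintro a (rfl | rfl | rfl | rfl)
    · rw [hR.count]; exact hkM
    · exact h13.1
    · exact h13.2
    · rw [hR.edges]; omega
  · intro σ3 hs3
    have h0 : (initial t α).steps = 0 := rfl
    rw [h0] at hs1
    simp only [Prog.runtime] at hs3 ⊢
    omega

theorem wp_drawSamples_ready {o : ℕ → ℕ → ℝ} {n k : ℕ} {t : Fin k ↪ Fin n} (hk : 0 < k) {d : ℕ}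
    {α : ℝ} {σ : State} (h : Ready t d α σ) (h15 : σ.nat 15 0 = 0) :
    drawSamples.wp o (fun σ' => Ready t d α σ' ∧ (∀ q < σ'.nat 13 0, σ'.nat 6 q < k) ∧
      σ'.nat 13 = σ.nat 13) σ := by
  refine ((wp_drawSamples (by rw [h.count]; exact hk) h15).and
    ((wp_same drawSamples σ).and
      (wp_queryFree drawSamples (by simp [drawSamples, Prog.QueryFree]) σ))).mono ?_
  rintro σ' ⟨h1, hs, hq⟩
  have e13 : σ'.nat 13 = σ.nat 13 := hs.1 13 (by decide)
  rw [h.count] at h1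
  refine ⟨?_, by rw [e13]; exact h1, e13⟩
  obtain ⟨c1, c2, c3, c5, c6, c7, c8, c9⟩ := h
  constructor
  · rw [hs.1 1 (by decide), c1]
  · rw [hs.1 2 (by decide)]; exact c2
  · rw [hs.1 3 (by decide), c3]
  · rw [hs.1 16 (by decide), c5]
  · rw [hs.1 7 (by decide)]; exact c6
  · rw [hs.1 25 (by decide), c7]
  · rw [hq, c8]
  · rw [e13, hs.1 14 (by decide)]; exact c9

/-- When rows are queried, α ≤ 2k, so ⌈k/α⌉ ≤ 3k/α. The constant is 84 = 3 · 2 · 14, where 2 comes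
from `log_bound`. -/
theorem queries_bound {n k d : ℕ} {t : Fin k ↪ Fin n} (hk : 0 < k) {α : ℝ} (hα : 2 ≤ α)
    (hn : 1 ≤ n) {σ : State} (h : Ready t d α σ) :
    ((σ.nat 14 0 * k : ℕ) : ℝ) ≤
      84 * (d + 1) * ((k : ℝ) ^ 2 / α) * (1 + Real.log n) := by
  have hn' : (1 : ℝ) ≤ n := by exact_mod_cast hn
  have hlog := Real.log_nonneg hn'
  have hk' : (0 : ℝ) < k := by exact_mod_cast hk
  have hα0 : 0 < α := by linarith
  rcases h.samples with ⟨-, -, g⟩ | ⟨hαk, g, s₀, L, g1, -, -, -, g2, -, -, -, g3⟩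
  · rw [g, zero_mul, Nat.cast_zero]
    positivity
  · rw [g, g1]
    push_cast
    have h1 : (s₀ : ℝ) ≤ 3 * (k / α) := by
      have : ((s₀ : ℝ) - 1) < k / α := by rw [lt_div_iff₀ hα0]; exact g2
      have h2 : 1 ≤ 2 * ((k : ℝ) / α) := by rw [mul_div_assoc', le_div_iff₀ hα0]; linarith
      linarith
    calc (s₀ : ℝ) * (L * (14 * (d + 1))) * k
        ≤ 3 * (k / α) * (2 * (1 + Real.log n) * (14 * (d + 1))) * k := by
          gcongr
          exact log_bound hn g3
      _ = _ := by ring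

theorem upper_bound (d : ℕ) : ∃ (P : Prog) (C : ℕ),
    ∀ (α : ℝ), 2 ≤ α → ∀ (n k : ℕ) (t : Fin k ↪ Fin n), 1 ≤ k →
    ∀ w : Fin n → Fin n → ℝ, IsMetric w →
      (∀ σ ∈ (P.exec w t α).support,
        (σ.queries : ℝ) ≤ C * ((k : ℝ) ^ 2 / α) * (1 + Real.log n) ^ C ∧
        σ.steps ≤ C * n ^ C) ∧
      ENNReal.ofReal (1 - 1 / (n : ℝ) ^ d) ≤
        (P.exec w t α).toOuterMeasure
          {σ | IsApproxSteinerTree α w (Finset.univ.map t)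
            (σ.graph (Finset.univ.map t))} := by
  obtain ⟨C₀, hC₀⟩ := runtime_le (steinerProg (14 * (d + 1)))
  set c := 14 * (d + 1) with hc
  -- The summands cover the coefficient and the exponent of C₀(cn²)^C₀, and the constant in the
  -- number of queries.
  refine ⟨steinerProg c, C₀ * c ^ C₀ + 2 * C₀ + 84 * (d + 1), ?_⟩
  set C := C₀ * c ^ C₀ + 2 * C₀ + 84 * (d + 1) with hC
  intro α hα n k t hk w hw
  have hkn : k ≤ n := by simpa using Fintype.card_le_of_embedding t
  have hn : 1 ≤ n := hk.trans hkn
  have hn' : (1 : ℝ) ≤ n := by exact_mod_cast hn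
  have hlog := Real.log_nonneg hn'
  have hα0 : 0 < α := by linarith
  obtain ⟨p, hp, hpsurj, hpinj, hpath⟩ := exists_short_path t hk hw
  -- The largest window parameter for which the loss 12L + 2 is at most α.
  set L := ⌊(α - 2) / 12⌋₊ with hLdef
  have hL1 : (L : ℝ) ≤ (α - 2) / 12 := Nat.floor_le (by linarith)
  have hL2 : (α - 2) / 12 < L + 1 := Nat.lt_floor_add_one _
  have hL : 12 * (L : ℝ) + 2 ≤ α := by linarith
  have hprep := wp_prepare (o := oracle w) t hk hα hn d
  have hbuild := fun {σ : State} (h : Ready t d α σ) (h6 : ∀ q < σ.nat 13 0, σ.nat 6 q < k) =>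
    wp_buildTree hk hw h h6 hp hpsurj hpath hL
  refine ⟨fun σ hσ => ⟨?_, ?_⟩, ?_⟩
  · have hq : (steinerProg c).wp (oracle w) (fun σ => (σ.queries : ℝ) ≤
        84 * (d + 1) * ((k : ℝ) ^ 2 / α) * (1 + Real.log n)) (initial t α) := by
      rw [steinerProg, wp_seq]
      refine hprep.mono fun σ1 h1 => ?_
      rw [wp_seq]
      refine (wp_drawSamples_ready hk h1.1 h1.2).mono fun σ2 h2 => ?_
      refine (hbuild h2.1 h2.2.1).mono fun σ3 h3 => ?_
      rw [h3.1]
      exact queries_bound hk hα hn h2.1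
    refine (hq σ hσ).trans ?_
    have h1 : (84 * (d + 1) : ℝ) ≤ C := by
      have : 84 * (d + 1) ≤ C := by omega
      exact_mod_cast this
    have h2 : 1 + Real.log n ≤ (1 + Real.log n) ^ C :=
      le_self_pow₀ (by linarith) (by omega)
    gcongr
  · refine (wp_steps_total t hk hα hkn d σ hσ).trans ?_
    have hM : 1 ≤ c * n ^ 2 := Nat.mul_pos (by omega) (pow_pos hn 2)
    refine (hC₀ _ hM).trans ?_
    rw [mul_pow, ← pow_mul, ← mul_assoc]
    refine Nat.mul_le_mul (by omega) (Nat.pow_le_pow_right hn (by omega))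
  · refine le_toOuterMeasure_of_compl _ _ (by positivity) ?_
    rw [Prog.exec, steinerProg, Prog.run]
    refine toOuterMeasure_bind_le _ _ _ fun σ hσ => ?_
    obtain ⟨hR, h15⟩ := hprep σ hσ
    rw [Prog.run]
    have hdraw := wp_drawSamples_ready (o := oracle w) hk hR h15
    rcases hR.samples with ⟨hα2, -⟩ | ⟨hαk, -, s₀, L', g1, -, -, g2, -, -, -, g3, -⟩
    · refine (toOuterMeasure_bind_le_of_imp _ _ ∅ _ ?_).trans ?_
      · intro σ' hσ' _ σ'' hσ'' h
        obtain ⟨h1, h2, -⟩ := hdraw σ' hσ'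
        apply h
        exact (hbuild h1 h2 σ'' hσ'').2 (Or.inl hα2)
      · simp
    · have hk1 : (1 : ℝ) ≤ k := by exact_mod_cast hk
      have hLk : L + 1 ≤ k := by
        have : (L : ℝ) + 1 < k + 1 := by linarith
        have : L + 1 < k + 1 := by exact_mod_cast this
        omega
      refine (toOuterMeasure_bind_le_of_imp _ _ {σ' | ∃ c, c + (L + 1) ≤ σ.nat 1 0 ∧
        ∀ q < σ.nat 13 0, ∀ i, c ≤ i → i < c + (L + 1) → σ'.nat 6 q ≠ p i} _
        ?_).trans ((miss_window_le (by rw [hR.count]; exact hk)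
          h15 (by rw [hR.count]; exact hp) (by rw [hR.count]; exact hpinj) (L + 1)
          (Nat.succ_pos L)).trans ?_)
      · intro σ' hσ' hmiss σ'' hσ'' h
        obtain ⟨h1, h2, h3⟩ := hdraw σ' hσ'
        apply h
        refine (hbuild h1 h2 σ'' hσ'').2 (Or.inr ⟨hLk, fun c hc => ?_⟩)
        by_contra hno
        refine hmiss ⟨c, by rw [hR.count]; exact hc, fun q hq i hi hi' e => hno ?_⟩
        exact ⟨i, hi, hi', q, by rw [h3]; exact hq, e⟩
      · rw [hR.count]
        refine miss_bound hk hkn hLk ?_ g2 g3 g1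
        push_cast
        have : (0 : ℝ) ≤ L := Nat.cast_nonneg _
        -- To see L + 1 ≥ α/14: for small α the left side is at least 1, and for α ≥ 14 one has (α -
        -- 2)/12 ≥ α/14.
        by_cases h14 : α ≤ 14
        · linarith
        · linarith

end SteinerQuery

theorem theorem1p5 :
    -- upper bound
    (∀ d : ℕ, ∃ (P : SteinerQuery.Prog) (C : ℕ),
      ∀ (α : ℝ), 2 ≤ α → ∀ (n k : ℕ) (t : Fin k ↪ Fin n), 1 ≤ k →
      ∀ w : Fin n → Fin n → ℝ, SteinerQuery.IsMetric w →
        (∀ σ ∈ (P.exec w t α).support,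
          (σ.queries : ℝ) ≤ C * ((k : ℝ) ^ 2 / α) * (1 + Real.log n) ^ C ∧
          σ.steps ≤ C * n ^ C) ∧
        ENNReal.ofReal (1 - 1 / (n : ℝ) ^ d) ≤
          (P.exec w t α).toOuterMeasure
            {σ | SteinerQuery.IsApproxSteinerTree α w (Finset.univ.map t)
              (σ.graph (Finset.univ.map t))}) ∧
    -- lower bound
    (∃ c C : ℝ, 0 < c ∧ 0 < C ∧
      ∀ (α : ℝ), 2 ≤ α → ∀ (n : ℕ) (T : Finset (Fin n)), C * α ≤ (T.card : ℝ) →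
      ∀ (Ω : Type*) [MeasurableSpace Ω] (μ : MeasureTheory.Measure Ω)
        [MeasureTheory.IsProbabilityMeasure μ] (A : SteinerQuery.RandAlg n Ω),
        (∀ w : Fin n → Fin n → ℝ, SteinerQuery.IsMetric w →
          2 / 3 ≤ μ {ω | SteinerQuery.IsApproxSteinerTree α w T ((A.alg ω).output w)}) →
        ∃ w : Fin n → Fin n → ℝ, SteinerQuery.IsMetric w ∧
          ENNReal.ofReal (c * ((T.card : ℝ) ^ 2 / α)) ≤
            ∫⁻ ω, ((A.alg ω).queries w : ENNReal) ∂μ) :=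
  ⟨SteinerQuery.upper_bound, SteinerQuery.lower_bound⟩
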